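/- **Setting.** Let $d\ge 1$ and let data points be pairs $z=(x,w)$, where $w\in[-1,1]^d$ is a covariate vector with law $\nu$ such that $\mathbb E_\nu[WW^\top]$ is positive definite, and $x$ is a response. Densities of $z$ are taken with respect to $\mu=\lambda\otimes\nu$, with $\lambda$ Lebesgue measure on $\mathbb R$ (counting measure on $\{0,1\}$ in the logistic model). Consider one of the following likelihoods $f(z;\vartheta)$, $\vartheta\in\Omega$: 1. Gaussian linear regression: $\vartheta=(\theta,\sigma)\in\Omega=\mathbb R^d\times(0,\infty)$, $f=(2\pi\sigma^2)^{-1/2}\exp\bigl(-(x-\theta^\top w)^2/(2\sigma^2)\bigr)$; 2. logistic regression: $\theta\in\Omega=\mathbb R^d$, $f=\Phi(\theta^\top w)^x\Phi(-\theta^\top w)^{1-x}$ with $\Phi(t)=(1+e^{-t})^{-1}$, $x\in\{0,1\}$; 3. Cauchy regression: $\vartheta=(\theta,\gamma)\in\Omega=\mathbb R^d\times(0,\infty)$, $f=\frac{1}{\pi\sqrt\gamma}\bigl(1+(x-\theta^\top w)^2/\gamma\bigr)^{-1}$; 4. quantile regression with $\tau\in(0,1)$: $\theta\in\Omega=\mathbb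 R^d$, $f=\tau(1-\tau)\exp(-Q_\tau(x-\theta^\top w))$ with $Q_\tau(u)=\frac12(|u|+(2\tau-1)u)$. The prior $\pi_0$ is a nondegenerate Gaussian law on $\mathbb R^d$ (models 2, 4), or a nondegenerate Gaussian law on $\mathbb R^{d+1}$ conditioned on the last coordinate being positive (models 1, 3). Let $\vartheta^*\in\Omega$ be the true parameter. Let $g>0$ be a probability density with respect to $\mu$ with tails no lighter than the model: for every $\vartheta\in\Omega$ there is $\kappa>0$ with $\kappa f(\cdot;\vartheta)\le g$. For $p\in[0,1]$ put $k_p(\cdot;\vartheta)=(1-p)f(\cdot;\vartheta)+p\,g$. Datasets consist of $n$ i.i.d. points with density $k_p(\cdot;\vartheta^*)$, and $\mathbb P_{\pi_n}(S|X)=\int_S\prod_i k_p(X_i;\vartheta)\,\pi_0(d\vartheta)\big/\int_\Omega\prod_i k_p(X_i;\vartheta)\,\pi_0(d\vartheta)$ is the posterior. Two datasets are neighbours if they differ in at most one entry. Let $h^2(p,q)=\frac12\int(\sqrt p-\sqrt q)^2d\mu$, let $H_{[]}(u,\mathcal F)$ be the Hellinger bracketing entropy (the logarithm of the least number of pairs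 $[L,U]$ of nonnegative integrable functions with $h(L,U)\le u$ that bracket every member of $\mathcal F$ pointwise), and let $S_{\alpha}(t)=\bigl\{\vartheta\in\Omega:\frac1\alpha\int[(f(\cdot;\vartheta^*)/f(\cdot;\vartheta))^\alpha-1]f(\cdot;\vartheta^*)d\mu\le t\bigr\}$. **Claim.** For every $c>0$ there is $\bar c>0$, depending only on $c$ and $d$, such that for all $c_1\in(0,\bar c]$, $c_2>0$, $q>4$ and every model as above the following holds with $$\phi_n=n^{-1/q},\qquad \psi_n=C\,n^{-1/q},\qquad p_n=n^{-1/(2q)},\qquad t_n=c_1\phi_n^2/8 .$$ There are constants $\alpha\in(0,1]$, $c_3,c_4,C,C_1,T>0$ and sets $\Omega_1\subseteq\Omega_2\subseteq\cdots$ with $\bigcup_n\Omega_n=\Omega$ such that, for all sufficiently large $n$ where $n$ occurs: * (A1) $\phi_n\to0$, $n\phi_n^2\to\infty$ and $\int_{\phi_n^2/2^{10}}^{\phi_n}H_{[]}^{1/2}(u,\{f(\cdot;\vartheta):\vartheta\in\Omega_n\})\,du\le c\sqrt n\,\phi_n^2$; * (A2) $\pi_0(S_\alpha(t_n))\ge c_3e^{-2nt_n}$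 and $nt_n/\log n>\max\{1/\alpha,\,c_1/(8c_2)\}$; * (A3) $\pi_0(\Omega\setminus\Omega_n)\le c_4e^{-2c_1n\phi_n^2}$; * (A4) for each $\vartheta\in\Omega$ all one-sided directional derivatives of $f(z;\cdot)$ at $\vartheta$ exist and are bounded uniformly in $z$ and in the unit direction, and $\sup_z|\tilde\nabla f(z;\vartheta)|/g(z)<\infty$, where $\tilde\nabla f(z;\vartheta)$ is their supremum over unit directions; * (A5) $\inf_{\|\vartheta-\vartheta^*\|_2>\psi}h(f(\cdot;\vartheta),f(\cdot;\vartheta^*))>0$ for every $\psi>0$; * $h(k_{p_n}(\cdot;\vartheta),k_{p_n}(\cdot;\vartheta^*))\le\phi_n$ implies $\|\vartheta-\vartheta^*\|_2\le\psi_n$ for all $\vartheta\in\Omega$; * (privacy) let $\varepsilon_n=2(1-p_n)T\psi_n/p_n$, $\delta_n=\frac4{c_3}e^{-\frac12c_1n\phi_n^2}$, $\epsilon_n=\varepsilon_n+\log(\delta_n+e^{\varepsilon_n})$. If $(X,Z)$ is a random pair of neighbouring datasets of size $n$, each with i.i.d. entries of density $k_{p_n}(\cdot;\vartheta^*)$,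 then outside an event of probability at most $C_1e^{-nc_5\phi_n^2}$, $c_5=\min\{c_1\alpha/8,c_2\}$, $$\mathbb P_{\pi_n}(S|X)\le e^{\epsilon_n}\,\mathbb P_{\pi_n}(S|Z)+\delta_n\qquad\text{for all Borel } S\subseteq\Omega ,$$ where the posterior uses $k_{p_n}$; * $\epsilon_n=O\bigl(n^{-1/(2q)}\bigr)$ and $\delta_n=O\bigl(\exp(-\tfrac12c_1n^{1-2/q})\bigr)$. -/

import Mathlib

open MeasureTheory ProbabilityTheory Filter Asymptotics Set
open scoped ENNReal Topology

noncomputable section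

/-! ### Contaminated parametric models -/

/-- The data of a contaminated Bayesian model: observation space `𝒳` with reference measure `base`,
parameter set `Ω ⊆ ℝ^ι` with the Euclidean norm, likelihood `f θ x` and contamination density `g x`
(both with respect to `base`), prior, and true parameter `θs`. -/
structure ContamModel (𝒳 : Type) [MeasurableSpace 𝒳] (ι : Type) [Fintype ι] where
  base : Measure 𝒳
  Ω : Set (EuclideanSpace ℝ ι)
  f : EuclideanSpace ℝ ι → 𝒳 → ℝ
  g : 𝒳 → ℝ
  prior : Measure (EuclideanSpace ℝ ι)
  θs : EuclideanSpace ℝ ι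

/-- Hellinger distance `h(p, q)`, where `h² = (1/2) ∫ (√p - √q)²`. -/
def hellinger {𝒳 : Type} [MeasurableSpace 𝒳] (μ : Measure 𝒳) (p q : 𝒳 → ℝ) : ℝ :=
  √((1 / 2) * ∫ x, (√(p x) - √(q x)) ^ 2 ∂μ)

/-- A finite family of pairs `[L, U]` of nonnegative integrable functions that is an `r`-Hellinger
bracketing of the class `F`. -/
def IsBracketing {𝒳 : Type} [MeasurableSpace 𝒳] (μ : Measure 𝒳) (r : ℝ) (F : Set (𝒳 → ℝ))
    (B : Finset ((𝒳 → ℝ) × (𝒳 → ℝ))) : Prop :=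
  (∀ b ∈ B, (∀ x, 0 ≤ b.1 x) ∧ (∀ x, 0 ≤ b.2 x) ∧ Integrable b.1 μ ∧ Integrable b.2 μ ∧
    hellinger μ b.1 b.2 ≤ r) ∧
  ∀ p ∈ F, ∃ b ∈ B, ∀ x, b.1 x ≤ p x ∧ p x ≤ b.2 x

/-- Hellinger bracketing number, `⊤` if there is no finite bracketing. -/
def bracketingNumber {𝒳 : Type} [MeasurableSpace 𝒳] (μ : Measure 𝒳) (r : ℝ)
    (F : Set (𝒳 → ℝ)) : ℕ∞ :=
  ⨅ (B : Finset ((𝒳 → ℝ) × (𝒳 → ℝ))) (_ : IsBracketing μ r F B), (B.card : ℕ∞)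

/-- Hellinger bracketing entropy, the logarithm of the bracketing number. -/
def bracketingEntropy {𝒳 : Type} [MeasurableSpace 𝒳] (μ : Measure 𝒳) (r : ℝ)
    (F : Set (𝒳 → ℝ)) : ℝ≥0∞ :=
  if bracketingNumber μ r F = ⊤ then ⊤
  else ENNReal.ofReal (Real.log ((bracketingNumber μ r F).toNat : ℝ))

namespace ContamModel

variable {𝒳 : Type} [MeasurableSpace 𝒳] {ι : Type} [Fintype ι]

/-- The contaminated likelihood `k_p(x; θ) = (1 - p) f(x; θ) + p g(x)`. -/
def k (M : ContamModel 𝒳 ι) (p : ℝ) (θ : EuclideanSpace ℝ ι) (x : 𝒳) : ℝ :=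
  (1 - p) * M.f θ x + p * M.g x

/-- The law of one contaminated data point, with density `k_p(·; θs)`. -/
def dataLaw (M : ContamModel 𝒳 ι) (p : ℝ) : Measure 𝒳 :=
  M.base.withDensity fun x => ENNReal.ofReal (M.k p M.θs x)

/-- `∫_A ∏ k_p(x_i; θ) π₀(dθ)`. -/
def marginal (M : ContamModel 𝒳 ι) (p : ℝ) {n : ℕ} (A : Set (EuclideanSpace ℝ ι))
    (X : Fin n → 𝒳) : ℝ≥0∞ :=
  ∫⁻ θ in A, ∏ i, ENNReal.ofReal (M.k p θ (X i)) ∂M.prior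

/-- Posterior probability of `A` given the contaminated dataset `X`. -/
def posterior (M : ContamModel 𝒳 ι) (p : ℝ) {n : ℕ} (A : Set (EuclideanSpace ℝ ι))
    (X : Fin n → 𝒳) : ℝ≥0∞ :=
  M.marginal p (A ∩ M.Ω) X / M.marginal p M.Ω X

/-- `g` is a contamination density: a positive probability density
whose tails are no lighter than those of any `f(·; θ)`. -/
structure IsContamination (M : ContamModel 𝒳 ι) : Prop where
  measurable : Measurable M.g
  pos : ∀ x, 0 < M.g x
  lintegral_eq_one : ∫⁻ x, ENNReal.ofReal (M.g x) ∂M.base = 1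
  heavy_tail : ∀ θ ∈ M.Ω, ∃ κ > 0, ∀ x, κ * M.f θ x ≤ M.g x

/-! ### The assumptions of the main theorem (for all sufficiently large `n`) -/

/-- Bracketing entropy condition for the sieve `Ωs` and the sequence `φ`. -/
def EntropyAssumption (M : ContamModel 𝒳 ι) (φ : ℕ → ℝ)
    (Ωs : ℕ → Set (EuclideanSpace ℝ ι)) (c : ℝ) : Prop :=
  Tendsto φ atTop (𝓝 0) ∧ Tendsto (fun n : ℕ => (n : ℝ) * φ n ^ 2) atTop atTop ∧
  Monotone Ωs ∧ (⋃ n, Ωs n) = M.Ω ∧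
  ∀ᶠ n : ℕ in atTop, 0 < φ n ∧
    ∫⁻ u in Ioo (φ n ^ 2 / 2 ^ 10) (φ n),
      bracketingEntropy M.base u (M.f '' Ωs n) ^ (1 / 2 : ℝ)
      ≤ ENNReal.ofReal (c * √(n : ℝ) * φ n ^ 2)

/-- The integrand of `α ρ_{0,α}(θs, θ)`. -/
def rhoIntegrand (M : ContamModel 𝒳 ι) (α : ℝ) (θ : EuclideanSpace ℝ ι) (x : 𝒳) : ℝ :=
  ((M.f M.θs x / M.f θ x) ^ α - 1) * M.f M.θs x

/-- The neighbourhood `S_{0,α}(t) = {θ : ρ_{0,α}(θs, θ) ≤ t}`; parameters whose divergence is not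
finite are excluded. -/
def rhoNhd (M : ContamModel 𝒳 ι) (α t : ℝ) : Set (EuclideanSpace ℝ ι) :=
  {θ | θ ∈ M.Ω ∧ Integrable (M.rhoIntegrand α θ) M.base ∧
    (1 / α) * ∫ x, M.rhoIntegrand α θ x ∂M.base ≤ t}

/-- Prior mass near the true parameter, with `t_n = c₁ φ_n² / 8`. -/
def PriorCentreAssumption (M : ContamModel 𝒳 ι) (φ : ℕ → ℝ) (α c₁ c₂ c₃ : ℝ) : Prop :=
  ∀ᶠ n : ℕ in atTop,
    ENNReal.ofReal (c₃ * Real.exp (-(2 * n * (c₁ * φ n ^ 2 / 8)))) ≤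
      M.prior (M.rhoNhd α (c₁ * φ n ^ 2 / 8)) ∧
    max (1 / α) (c₁ / (8 * c₂)) < n * (c₁ * φ n ^ 2 / 8) / Real.log n

/-- Prior mass outside the sieve. -/
def PriorTailAssumption (M : ContamModel 𝒳 ι) (φ : ℕ → ℝ)
    (Ωs : ℕ → Set (EuclideanSpace ℝ ι)) (c₁ c₄ : ℝ) : Prop :=
  ∀ᶠ n : ℕ in atTop,
    M.prior (M.Ω \ Ωs n) ≤ ENNReal.ofReal (c₄ * Real.exp (-(2 * c₁ * n * φ n ^ 2)))

/-- One-sided directional derivative of `f(x; ·)` at `θ` in direction `u`. -/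
def dirDeriv (M : ContamModel 𝒳 ι) (θ : EuclideanSpace ℝ ι) (x : 𝒳)
    (u : EuclideanSpace ℝ ι) : ℝ :=
  derivWithin (fun ξ : ℝ => M.f (θ + ξ • u) x) (Ici 0) 0

/-- Supremum of the directional derivatives over all unit directions. -/
def supDirDeriv (M : ContamModel 𝒳 ι) (θ : EuclideanSpace ℝ ι) (x : 𝒳) : ℝ :=
  ⨆ u : Metric.sphere (0 : EuclideanSpace ℝ ι) 1, M.dirDeriv θ x u

/-- Directional derivatives exist and are bounded, and are dominated by `g`. -/
def RatioAssumption (M : ContamModel 𝒳 ι) : Prop :=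
  ∀ θ ∈ M.Ω,
    (∀ x, ∀ u : EuclideanSpace ℝ ι, ‖u‖ = 1 →
      DifferentiableWithinAt ℝ (fun ξ : ℝ => M.f (θ + ξ • u) x) (Ici 0) 0) ∧
    (∃ B : ℝ, ∀ x, ∀ u : EuclideanSpace ℝ ι, ‖u‖ = 1 → |M.dirDeriv θ x u| ≤ B) ∧
    ∃ T : ℝ, ∀ x, |M.supDirDeriv θ x / M.g x| ≤ T

/-- For every `ψ > 0`, the infimum of `h(f(·; θ), f(·; θs))` over `‖θ - θs‖ > ψ` is positive. -/
def IdentifiabilityAssumption (M : ContamModel 𝒳 ι) : Prop :=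
  ∀ ψ > 0, ∃ η > 0, ∀ θ ∈ M.Ω, ψ < ‖θ - M.θs‖ →
    η ≤ hellinger M.base (M.f θ) (M.f M.θs)

/-- The sequences `φ`, `ψ` and the contamination rates `p` are linked by
`h(k_{p_n}(·; θ), k_{p_n}(·; θs)) ≤ φ_n → ‖θ - θs‖ ≤ ψ_n`. -/
def HellingerLink (M : ContamModel 𝒳 ι) (p φ ψ : ℕ → ℝ) : Prop :=
  ∀ᶠ n : ℕ in atTop, ∀ θ ∈ M.Ω,
    hellinger M.base (M.k (p n) θ) (M.k (p n) M.θs) ≤ φ n → ‖θ - M.θs‖ ≤ ψ n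

/-! ### Privacy -/

/-- A joint law of two neighbouring datasets of size `n`: each has i.i.d. entries with law `P`, and
the two datasets agree except possibly in one entry. -/
structure IsNeighbouringLaw (P : Measure 𝒳) (n : ℕ)
    (Q : Measure ((Fin n → 𝒳) × (Fin n → 𝒳))) : Prop where
  map_fst : Q.map Prod.fst = Measure.pi fun _ => P
  map_snd : Q.map Prod.snd = Measure.pi fun _ => P
  neighbours : ∀ᵐ z ∂Q, ∃ j, ∀ i, i ≠ j → z.1 i = z.2 i

/-- The `(ε, δ)` inequality for posterior sampling at the pair of datasets `X`, `Z`. -/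
def PrivacyIneq (M : ContamModel 𝒳 ι) (p ε δ : ℝ) {n : ℕ} (X Z : Fin n → 𝒳) : Prop :=
  ∀ S : Set (EuclideanSpace ℝ ι), MeasurableSet S →
    M.posterior p S X ≤
      ENNReal.ofReal (Real.exp ε) * M.posterior p S Z + ENNReal.ofReal δ

/-- `2 (1 - p_n) T ψ_n / p_n`. -/
def preEps (p ψ : ℕ → ℝ) (T : ℝ) (n : ℕ) : ℝ := 2 * (1 - p n) * T * ψ n / p n

/-- `δ_n = (4 / c₃) exp(-c₁ n φ_n² / 2)`. -/
def privDelta (φ : ℕ → ℝ) (c₁ c₃ : ℝ) (n : ℕ) : ℝ :=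
  4 / c₃ * Real.exp (-(1 / 2 * c₁ * n * φ n ^ 2))

/-- `ε_n = ϵ_n + log(δ_n + exp ϵ_n)` with `ϵ_n = preEps`. -/
def privEps (p φ ψ : ℕ → ℝ) (T c₁ c₃ : ℝ) (n : ℕ) : ℝ :=
  preEps p ψ T n + Real.log (privDelta φ c₁ c₃ n + Real.exp (preEps p ψ T n))

/-- With `φ_n = n^{-1/q}`, `ψ_n = C n^{-1/q}` and `p_n = n^{-1/(2q)}`: the five assumptions and the
link between `φ` and `ψ` hold, posterior sampling from the contaminated model satisfies the
`(ε_n, δ_n)` inequality outside an event of exponentially small probability, and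
`ε_n = O(n^{-1/(2q)})`, `δ_n = O(exp(-c₁ n^{1-2/q} / 2))`. -/
def SatisfiesRates (M : ContamModel 𝒳 ι) (q c c₁ c₂ : ℝ) : Prop :=
  let φ : ℕ → ℝ := fun n => (n : ℝ) ^ (-(1 / q))
  let p : ℕ → ℝ := fun n => (n : ℝ) ^ (-(1 / (2 * q)))
  ∃ (Ωs : ℕ → Set (EuclideanSpace ℝ ι)) (α c₃ c₄ C C₁ T : ℝ),
    0 < α ∧ α ≤ 1 ∧ 0 < c₃ ∧ 0 < c₄ ∧ 0 < C ∧ 0 < C₁ ∧ 0 < T ∧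
    M.EntropyAssumption φ Ωs c ∧
    M.PriorCentreAssumption φ α c₁ c₂ c₃ ∧
    M.PriorTailAssumption φ Ωs c₁ c₄ ∧
    M.RatioAssumption ∧
    M.IdentifiabilityAssumption ∧
    M.HellingerLink p φ (fun n => C * φ n) ∧
    (∀ᶠ n : ℕ in atTop, ∀ Q : Measure ((Fin n → 𝒳) × (Fin n → 𝒳)),
      IsNeighbouringLaw (M.dataLaw (p n)) n Q →
      Q {z | ¬ M.PrivacyIneq (p n) (privEps p φ (fun n => C * φ n) T c₁ c₃ n)
          (privDelta φ c₁ c₃ n) z.1 z.2} ≤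
        ENNReal.ofReal (C₁ * Real.exp (-(n * min (c₁ * α / 8) c₂ * φ n ^ 2)))) ∧
    privEps p φ (fun n => C * φ n) T c₁ c₃ =O[atTop] (fun n : ℕ => (n : ℝ) ^ (-(1 / (2 * q)))) ∧
    privDelta φ c₁ c₃ =O[atTop]
      (fun n : ℕ => Real.exp (-(1 / 2 * c₁ * (n : ℝ) ^ (1 - 2 / q))))

end ContamModel

/-! ### The regression models -/

/-- Covariate vectors `w ∈ ℝ^d` with `‖w‖_∞ ≤ 1`. -/
abbrev Covariate (d : ℕ) : Type := ↥(Set.Icc (-1 : Fin d → ℝ) 1)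

/-- The second moment matrix of the covariate law is positive definite. -/
def NondegenerateDesign {d : ℕ} (ν : Measure (Covariate d)) : Prop :=
  ∀ v : Fin d → ℝ, v ≠ 0 → 0 < ∫ w, (∑ i, v i * w.1 i) ^ 2 ∂ν

/-- `θᵀ w`. -/
def linPred {d : ℕ} (θ : EuclideanSpace ℝ (Fin d)) (w : Covariate d) : ℝ := ∑ i, θ i * w.1 i

/-- `θᵀ w` for a parameter `(θ, s) ∈ ℝ^{d+1}`, whose last coordinate `s` is the dispersion. -/
def linPredS {d : ℕ} (ϑ : EuclideanSpace ℝ (Fin (d + 1))) (w : Covariate d) : ℝ :=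
  ∑ i : Fin d, ϑ i.castSucc * w.1 i

/-- Parameters `(θ, s) ∈ ℝ^d × (0, ∞)`. -/
def posDispersion (d : ℕ) : Set (EuclideanSpace ℝ (Fin (d + 1))) := {ϑ | 0 < ϑ (Fin.last d)}

/-- Gaussian linear regression with unknown `(θ, σ)`; the prior is a Gaussian law on `ℝ^{d+1}`
conditioned on `σ > 0`. A data point is `(x, w)`, and densities are with respect to
`dx ⊗ ν(dw)`. -/
def linearModel {d : ℕ} (ν : Measure (Covariate d)) (g : ℝ × Covariate d → ℝ)
    (m : EuclideanSpace ℝ (Fin (d + 1))) (S : Matrix (Fin (d + 1)) (Fin (d + 1)) ℝ)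
    (ϑs : EuclideanSpace ℝ (Fin (d + 1))) : ContamModel (ℝ × Covariate d) (Fin (d + 1)) where
  base := (volume : Measure ℝ).prod ν
  Ω := posDispersion d
  f ϑ z := (√(2 * Real.pi * ϑ (Fin.last d) ^ 2))⁻¹ *
    Real.exp (-(z.1 - linPredS ϑ z.2) ^ 2 / (2 * ϑ (Fin.last d) ^ 2))
  g := g
  prior := cond (multivariateGaussian m S) (posDispersion d)
  θs := ϑs

/-- Cauchy regression with unknown `(θ, γ)`, where the error has scale `√γ`; the prior is a Gaussian
law on `ℝ^{d+1}` conditioned on `γ > 0`. -/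
def cauchyModel {d : ℕ} (ν : Measure (Covariate d)) (g : ℝ × Covariate d → ℝ)
    (m : EuclideanSpace ℝ (Fin (d + 1))) (S : Matrix (Fin (d + 1)) (Fin (d + 1)) ℝ)
    (ϑs : EuclideanSpace ℝ (Fin (d + 1))) : ContamModel (ℝ × Covariate d) (Fin (d + 1)) where
  base := (volume : Measure ℝ).prod ν
  Ω := posDispersion d
  f ϑ z := (Real.pi * √(ϑ (Fin.last d)))⁻¹ *
    (1 + (z.1 - linPredS ϑ z.2) ^ 2 / ϑ (Fin.last d))⁻¹
  g := g
  prior := cond (multivariateGaussian m S) (posDispersion d)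
  θs := ϑs

/-- Logistic regression with response in `{0, 1}` and a Gaussian prior. -/
def logisticModel {d : ℕ} (ν : Measure (Covariate d)) (g : Fin 2 × Covariate d → ℝ)
    (m : EuclideanSpace ℝ (Fin d)) (S : Matrix (Fin d) (Fin d) ℝ)
    (θs : EuclideanSpace ℝ (Fin d)) : ContamModel (Fin 2 × Covariate d) (Fin d) where
  base := (Measure.count : Measure (Fin 2)).prod ν
  Ω := Set.univ
  f θ z := Real.sigmoid (linPred θ z.2) ^ (z.1 : ℕ) *
    Real.sigmoid (-linPred θ z.2) ^ (1 - (z.1 : ℕ))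
  g := g
  prior := multivariateGaussian m S
  θs := θs

/-- The check function of quantile regression. -/
def checkLoss (τ u : ℝ) : ℝ := (1 / 2) * (|u| + (2 * τ - 1) * u)

/-- Quantile regression at level `τ` with asymmetric Laplace likelihood and a Gaussian prior. -/
def quantileModel {d : ℕ} (τ : ℝ) (ν : Measure (Covariate d)) (g : ℝ × Covariate d → ℝ)
    (m : EuclideanSpace ℝ (Fin d)) (S : Matrix (Fin d) (Fin d) ℝ)
    (θs : EuclideanSpace ℝ (Fin d)) : ContamModel (ℝ × Covariate d) (Fin d) where
  base := (volume : Measure ℝ).prod ν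
  Ω := Set.univ
  f θ z := τ * (1 - τ) * Real.exp (-checkLoss τ (z.1 - linPred θ z.2))
  g := g
  prior := multivariateGaussian m S
  θs := θs

end

/-! ### Hellinger distance and product likelihoods -/

section Hellinger

variable {𝒳 : Type} [MeasurableSpace 𝒳] {μ : Measure 𝒳}

/-! All four regressions satisfy the abstract conditions `ContamModel.IsRegular`, and
`ContamModel.IsRegular.satisfiesRates` shows that a regular model with D parameters attains the
rates as soon as `3 * D * c₁ ≤ c ^ 2`. Write x = n φ_n² and let θ* be the truth.

Privacy. Contamination gives k_p ≥ p g, while near θ* the density f is Lipschitz in θ with constant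
T g. Hence for ‖θ - θ*‖ ≤ ψ_n each factor k_p(·; θ)/k_p(·; θ*) lies between e^{-a} and e^{a}, a = (1
- p) T ψ_n / p, and changing one entry of the data costs at most e^{2a} (`lr_le_of_neighbours`).
Parameters farther away contribute only δ_n when the posterior is concentrated. The normalizing
integrals of the two datasets must be compared as well, which produces the logarithm in ε_n
(`privacyIneq_of_concentration`). Since φ_n = p_n², the ratio ψ_n / p_n is C p_n.

Concentration rests on three bounds for the integrated likelihood ratio. Far parameters in the
sieve: the root of a likelihood ratio has mean equal to the Hellinger affinity, so Markov's
inequality and a union over brackets apply (`measure_sieve_le`). Parameters outside the sieve: a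
likelihood ratio has mean one, so Fubini leaves the prior mass (`measure_tail_le`). Near the truth:
the inverse ratio has small mean because its chi-square divergence is small and contamination only
decreases it (`measure_centre_le`, with α = 1). The link between φ_n and ψ_n is a lower bound for
Hellinger distance by total variation, which is at least of order min(‖θ - θ*‖, 1).

Entropy. The sieve is a box of side of order n, cut at distance e^{-2 c₁ x} from the singular
boundary. Brackets of size φ_n²/2^10 exist on cells of side κ u² e^{-2 c₁ x}, so their number is at
most e^{3 D c₁ x}: two units of c₁ come from the boundary, one absorbs all powers of n. The
smallness of c₁ is needed only to fit this into the entropy budget c.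

Models. Gaussian, Cauchy and asymmetric Laplace errors are location-scale families with a unimodal
density. Monotonicity on each half-line yields brackets (`exists_bracket`), and comparing
distribution functions at two points yields separation (`exists_separation`). The logistic model is
treated directly with uniform brackets. -/

lemma sq_sqrt_sub_sqrt_le {a b : ℝ} (ha : 0 ≤ a) (hab : a ≤ b) : (√a - √b) ^ 2 ≤ b - a := by
  have h1 := Real.sq_sqrt ha
  have h2 := Real.sq_sqrt (ha.trans hab)
  have h3 := Real.sqrt_le_sqrt hab
  have h4 := Real.sqrt_nonneg a
  nlinarith

lemma hellinger_nonneg (p q : 𝒳 → ℝ) : 0 ≤ hellinger μ p q := Real.sqrt_nonneg _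

lemma hellinger_sq (p q : 𝒳 → ℝ) :
    hellinger μ p q ^ 2 = (1 / 2) * ∫ x, (√(p x) - √(q x)) ^ 2 ∂μ :=
  Real.sq_sqrt (mul_nonneg (by norm_num) (integral_nonneg fun _ => sq_nonneg _))

lemma integrable_sqrt_mul {p q : 𝒳 → ℝ} (hp : Integrable p μ) (hq : Integrable q μ)
    (hp0 : ∀ x, 0 ≤ p x) (hq0 : ∀ x, 0 ≤ q x) : Integrable (fun x => √(p x) * √(q x)) μ := by
  refine (hp.add hq).mono' ((Real.continuous_sqrt.comp_aestronglyMeasurable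
    hp.aestronglyMeasurable).mul (Real.continuous_sqrt.comp_aestronglyMeasurable
    hq.aestronglyMeasurable)) (ae_of_all _ fun x => ?_)
  rw [Real.norm_of_nonneg (by positivity)]
  have h1 := Real.sq_sqrt (hp0 x)
  have h2 := Real.sq_sqrt (hq0 x)
  simp only [Pi.add_apply]
  nlinarith [sq_nonneg (√(p x) - √(q x)), hp0 x, hq0 x]

lemma sq_sqrt_sub_sqrt_eq {a b : ℝ} (ha : 0 ≤ a) (hb : 0 ≤ b) :
    (√a - √b) ^ 2 = a + b - 2 * (√a * √b) := by
  rw [sub_sq, Real.sq_sqrt ha, Real.sq_sqrt hb]; ring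

lemma integrable_sq_sqrt_sub {p q : 𝒳 → ℝ} (hp : Integrable p μ) (hq : Integrable q μ)
    (hp0 : ∀ x, 0 ≤ p x) (hq0 : ∀ x, 0 ≤ q x) :
    Integrable (fun x => (√(p x) - √(q x)) ^ 2) μ := by
  simp_rw [fun x => sq_sqrt_sub_sqrt_eq (hp0 x) (hq0 x)]
  exact (hp.add hq).sub ((integrable_sqrt_mul hp hq hp0 hq0).const_mul 2)

/-- The inequality (√b - √a)² ≤ b - a turns an L¹ bracket of size 2u² into a Hellinger bracket of
size u, which is why cells have side of order u². -/
lemma hellinger_le_of_integral_sub_le {L U : 𝒳 → ℝ} {u : ℝ} (hu : 0 ≤ u)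
    (hL : Integrable L μ) (hU : Integrable U μ) (hL0 : ∀ x, 0 ≤ L x) (hLU : ∀ x, L x ≤ U x)
    (h : ∫ x, U x ∂μ - ∫ x, L x ∂μ ≤ 2 * u ^ 2) : hellinger μ L U ≤ u := by
  refine Real.sqrt_le_iff.2 ⟨hu, ?_⟩
  have : ∫ x, (√(L x) - √(U x)) ^ 2 ∂μ ≤ ∫ x, U x - L x ∂μ :=
    integral_mono (integrable_sq_sqrt_sub hL hU hL0 fun x => (hL0 x).trans (hLU x)) (hU.sub hL)
      fun x => sq_sqrt_sub_sqrt_le (hL0 x) (hLU x)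
  rw [integral_sub hU hL] at this
  linarith

lemma integral_sqrt_mul_sqrt {p q : 𝒳 → ℝ} (hp : Integrable p μ) (hq : Integrable q μ)
    (hp0 : ∀ x, 0 ≤ p x) (hq0 : ∀ x, 0 ≤ q x) (hp1 : ∫ x, p x ∂μ = 1) (hq1 : ∫ x, q x ∂μ = 1) :
    ∫ x, √(p x) * √(q x) ∂μ = 1 - hellinger μ p q ^ 2 := by
  have h := integrable_sqrt_mul hp hq hp0 hq0
  rw [hellinger_sq]
  simp_rw [fun x => sq_sqrt_sub_sqrt_eq (hp0 x) (hq0 x)]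
  rw [integral_sub (f := fun x => p x + q x) (hp.add hq) (h.const_mul 2), integral_add hp hq,
    integral_const_mul, hp1, hq1]
  ring

/-- The total variation distance is controlled by the Hellinger distance. -/
lemma sq_integral_abs_sub_le {p q : 𝒳 → ℝ} (hp : Integrable p μ) (hq : Integrable q μ)
    (hp0 : ∀ x, 0 ≤ p x) (hq0 : ∀ x, 0 ≤ q x) (hp1 : ∫ x, p x ∂μ = 1) (hq1 : ∫ x, q x ∂μ = 1) :
    (∫ x, |p x - q x| ∂μ) ^ 2 ≤ 8 * hellinger μ p q ^ 2 := by
  set V := ∫ x, |p x - q x| ∂μ with hV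
  have hV0 : 0 ≤ V := integral_nonneg fun _ => abs_nonneg _
  rcases hV0.eq_or_lt with h0 | hVpos
  · rw [← h0, zero_pow two_ne_zero]; positivity
  have hs := integrable_sq_sqrt_sub hp hq hp0 hq0
  -- Cauchy–Schwarz for |p - q| = |√p - √q| (√p + √q), in the form of Young's inequality with
  -- weights tuned to V itself, so that half of V can be absorbed on the left.
  have key : V ≤ ∫ x, (2 / V) * (√(p x) - √(q x)) ^ 2 + (V / 4) * (p x + q x) ∂μ := by
    refine integral_mono (hp.sub hq).abs ((hs.const_mul _).add ((hp.add hq).const_mul _))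
      fun x => ?_
    beta_reduce
    have h1 := Real.sq_sqrt (hp0 x)
    have h2 := Real.sq_sqrt (hq0 x)
    set a := √(p x)
    set b := √(q x)
    have ha : 0 ≤ a := Real.sqrt_nonneg _
    have hb : 0 ≤ b := Real.sqrt_nonneg _
    have e : p x - q x = (a - b) * (a + b) := by rw [← h1, ← h2]; ring
    rw [e, abs_mul, abs_of_nonneg (add_nonneg ha hb), ← h1, ← h2]
    have h3 : |a - b| * (a + b) ≤ (2 / V) * |a - b| ^ 2 + (V / 8) * (a + b) ^ 2 := by
      have : 0 ≤ (2 / V) * (|a - b| - V / 4 * (a + b)) ^ 2 := by positivity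
      have e2 : (2 / V) * (|a - b| - V / 4 * (a + b)) ^ 2 =
          (2 / V) * |a - b| ^ 2 - |a - b| * (a + b) + (V / 8) * (a + b) ^ 2 := by
        field_simp; ring
      linarith
    rw [sq_abs] at h3
    nlinarith [mul_nonneg hVpos.le (sq_nonneg (a - b))]
  rw [integral_add (hs.const_mul _) (by exact (hp.add hq).const_mul _), integral_const_mul,
    integral_const_mul, integral_add hp hq, hp1, hq1] at key
  have h2 := hellinger_sq (μ := μ) p q
  have h3 : (2 / V) * ∫ x, (√(p x) - √(q x)) ^ 2 ∂μ = 4 * hellinger μ p q ^ 2 / V := by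
    rw [h2]; ring
  rw [h3] at key
  have h4 : V / 2 ≤ 4 * hellinger μ p q ^ 2 / V := by linarith
  rw [le_div_iff₀ hVpos] at h4
  linarith

/-- Increments of a concave function decrease to the right. Adding the contamination p g to both
ends of a bracket therefore does not widen the gap between their roots. -/
lemma sqrt_add_sub_sqrt_add_le {a b t : ℝ} (ha : 0 ≤ a) (hab : a ≤ b) (ht : 0 ≤ t) :
    √(b + t) - √(a + t) ≤ √b - √a := by
  have h1 := Real.sq_sqrt ha
  have h2 := Real.sq_sqrt (ha.trans hab)
  have h3 := Real.sq_sqrt (add_nonneg ha ht)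
  have h4 := Real.sq_sqrt (add_nonneg (ha.trans hab) ht)
  have h5 := Real.sqrt_le_sqrt hab
  have h6 : √a ≤ √(a + t) := Real.sqrt_le_sqrt (by linarith)
  have h7 : √b ≤ √(b + t) := Real.sqrt_le_sqrt (by linarith)
  have h8 : √(a + t) ≤ √(b + t) := Real.sqrt_le_sqrt (by linarith)
  have h9 := Real.sqrt_nonneg a
  by_contra! hlt
  have : (√(b + t) - √(a + t)) * (√(b + t) + √(a + t)) = (√b - √a) * (√b + √a) := by nlinarith
  nlinarith

/-- Affinity of the upper end of a contaminated bracket with a density `q`. -/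
lemma integral_sqrt_mul_bracket_le {f L U g q : 𝒳 → ℝ} {p u : ℝ} (hp0 : 0 ≤ p) (hp1 : p ≤ 1)
    (hu : 0 < u) (hf : Integrable f μ) (hL : Integrable L μ) (hU : Integrable U μ)
    (hg : Integrable g μ) (hq : Integrable q μ) (hL0 : ∀ x, 0 ≤ L x) (hLf : ∀ x, L x ≤ f x)
    (hfU : ∀ x, f x ≤ U x) (hg0 : ∀ x, 0 ≤ g x) (hq0 : ∀ x, 0 ≤ q x)
    (hf1 : ∫ x, f x ∂μ = 1) (hg1 : ∫ x, g x ∂μ = 1) (hq1 : ∫ x, q x ∂μ = 1)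
    (hLU : hellinger μ L U ≤ u) :
    ∫ x, √((1 - p) * U x + p * g x) * √(q x) ∂μ ≤
      1 - hellinger μ (fun x => (1 - p) * f x + p * g x) q ^ 2 + 3 / 2 * u := by
  have hp1' : 0 ≤ 1 - p := by linarith
  have hf0 : ∀ x, 0 ≤ f x := fun x => (hL0 x).trans (hLf x)
  have hU0 : ∀ x, 0 ≤ U x := fun x => (hf0 x).trans (hfU x)
  have hk : Integrable (fun x => (1 - p) * f x + p * g x) μ :=
    (hf.const_mul _).add (hg.const_mul _)
  have hK : Integrable (fun x => (1 - p) * U x + p * g x) μ :=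
    (hU.const_mul _).add (hg.const_mul _)
  have hk0 : ∀ x, 0 ≤ (1 - p) * f x + p * g x := fun x =>
    add_nonneg (mul_nonneg hp1' (hf0 x)) (mul_nonneg hp0 (hg0 x))
  have hK0 : ∀ x, 0 ≤ (1 - p) * U x + p * g x := fun x =>
    add_nonneg (mul_nonneg hp1' (hU0 x)) (mul_nonneg hp0 (hg0 x))
  have hk1 : ∫ x, (1 - p) * f x + p * g x ∂μ = 1 := by
    rw [integral_add (hf.const_mul _) (hg.const_mul _), integral_const_mul, integral_const_mul,
      hf1, hg1]
    ring
  have hs := integrable_sq_sqrt_sub hL hU hL0 hU0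
  have hkq := integrable_sqrt_mul hk hq hk0 hq0
  have key : ∫ x, √((1 - p) * U x + p * g x) * √(q x) ∂μ ≤
      ∫ x, √((1 - p) * f x + p * g x) * √(q x) +
        (1 / (2 * u) * (√(L x) - √(U x)) ^ 2 + u / 2 * q x) ∂μ := by
    refine integral_mono (integrable_sqrt_mul hK hq hK0 hq0)
      (hkq.add ((hs.const_mul _).add (hq.const_mul _))) fun x => ?_
    have h1 : √((1 - p) * U x + p * g x) - √((1 - p) * f x + p * g x) ≤ √(U x) - √(L x) := by
      have h2 := sqrt_add_sub_sqrt_add_le (mul_nonneg hp1' (hf0 x))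
        (mul_le_mul_of_nonneg_left (hfU x) hp1') (mul_nonneg hp0 (hg0 x))
      rw [Real.sqrt_mul hp1', Real.sqrt_mul hp1'] at h2
      have h3 : √(1 - p) ≤ 1 := Real.sqrt_le_one.2 (by linarith)
      have h4 := Real.sqrt_le_sqrt (hfU x)
      have h5 := Real.sqrt_le_sqrt (hLf x)
      nlinarith
    have h6 := Real.sqrt_nonneg (q x)
    have h7 := Real.sq_sqrt (hq0 x)
    set b := √(q x)
    -- Young's inequality with weight u: after integration both terms are of order u, namely u and
    -- u/2, which gives the factor 3/2.
    have h8 : (√(U x) - √(L x)) * b ≤ 1 / (2 * u) * (√(L x) - √(U x)) ^ 2 + u / 2 * q x := by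
      rw [← h7]
      have : 0 ≤ 1 / (2 * u) * ((√(U x) - √(L x)) - u * b) ^ 2 := by positivity
      have e : 1 / (2 * u) * ((√(U x) - √(L x)) - u * b) ^ 2 =
          1 / (2 * u) * (√(L x) - √(U x)) ^ 2 - (√(U x) - √(L x)) * b + u / 2 * b ^ 2 := by
        field_simp; ring
      linarith
    change √((1 - p) * U x + p * g x) * b ≤ √((1 - p) * f x + p * g x) * b + _
    nlinarith [mul_le_mul_of_nonneg_right h1 h6]
  rw [integral_add hkq (by exact (hs.const_mul _).add (hq.const_mul _)),
    integral_add (hs.const_mul _) (hq.const_mul _), integral_const_mul, integral_const_mul,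
    hq1, integral_sqrt_mul_sqrt hk hq hk0 hq0 hk1 hq1] at key
  have h9 := hellinger_sq (μ := μ) L U
  have h10 : hellinger μ L U ^ 2 ≤ u ^ 2 := by
    have := hellinger_nonneg (μ := μ) L U
    nlinarith
  have h11 : 1 / (2 * u) * ∫ x, (√(L x) - √(U x)) ^ 2 ∂μ ≤ u := by
    rw [show ∫ x, (√(L x) - √(U x)) ^ 2 ∂μ = 2 * hellinger μ L U ^ 2 by rw [h9]; ring]
    calc 1 / (2 * u) * (2 * hellinger μ L U ^ 2) ≤ 1 / (2 * u) * (2 * u ^ 2) := by gcongr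
      _ = u := by field_simp
  linarith

end Hellinger

lemma lintegral_pi_prod {𝒳 : Type} [MeasurableSpace 𝒳] (P : Measure 𝒳) [IsProbabilityMeasure P]
    (n : ℕ) {F : 𝒳 → ℝ≥0∞} (hF : Measurable F) :
    ∫⁻ X : Fin n → 𝒳, ∏ i, F (X i) ∂(Measure.pi fun _ => P) = (∫⁻ x, F x ∂P) ^ n := by
  have hind : iIndepFun (fun (i : Fin n) (X : Fin n → 𝒳) => F (X i)) (Measure.pi fun _ => P) :=
    iIndepFun_pi (X := fun _ => F) (fun _ => hF.aemeasurable)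
  rw [lintegral_prod_eq_prod_lintegral_of_indepFun Finset.univ _ hind
    (fun i => hF.comp (measurable_pi_apply i))]
  have : ∀ i : Fin n, ∫⁻ X : Fin n → 𝒳, F (X i) ∂(Measure.pi fun _ => P) = ∫⁻ x, F x ∂P := fun i =>
    (measurePreserving_eval (fun _ : Fin n => P) i).lintegral_comp hF
  simp [this]

/-! ### Regular contaminated models -/

lemma abs_exp_sub_one_le_abs_mul_exp (y : ℝ) : |Real.exp y - 1| ≤ |y| * Real.exp |y| := by
  rcases le_total 0 y with hy | hy
  · rw [abs_of_nonneg hy, abs_of_nonneg (by linarith [Real.add_one_le_exp y])]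
    have h1 := Real.add_one_le_exp (-y)
    have h2 : Real.exp (-y) * Real.exp y = 1 := by rw [← Real.exp_add]; simp
    nlinarith [Real.exp_pos y]
  · rw [abs_of_nonpos hy, abs_of_nonpos (by linarith [Real.exp_le_one_iff.2 hy])]
    have h1 := Real.add_one_le_exp y
    have h2 : 1 ≤ Real.exp (-y) := Real.one_le_exp (by linarith)
    nlinarith

/-- The derivative is the limit of slopes over ξ > 0, each bounded by K. -/
lemma abs_derivWithin_Ici_le {φ : ℝ → ℝ} {r K : ℝ} (hr : 0 < r)
    (hφ : DifferentiableWithinAt ℝ φ (Ici 0) 0)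
    (hK : ∀ ξ, 0 ≤ ξ → ξ ≤ r → |φ ξ - φ 0| ≤ ξ * K) : |derivWithin φ (Ici 0) 0| ≤ K := by
  have hd := hφ.hasDerivWithinAt
  rw [hasDerivWithinAt_iff_tendsto_slope] at hd
  have hset : Ici (0 : ℝ) \ {0} = Ioi 0 := by ext; simp [lt_iff_le_and_ne, eq_comm]
  rw [hset] at hd
  refine le_of_tendsto hd.abs ?_
  filter_upwards [Ioo_mem_nhdsGT hr] with ξ hξ
  rw [slope_def_field, abs_div, sub_zero, abs_of_pos hξ.1, div_le_iff₀ hξ.1, mul_comm]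
  exact hK ξ hξ.1.le hξ.2.le

namespace ContamModel

variable {𝒳 : Type} [MeasurableSpace 𝒳] {ι : Type} [Fintype ι]

/-- Regularity of a contaminated model: the likelihood is locally log-Lipschitz in the parameter
with a constant controlled by the contamination, it is separated from the truth in total variation,
and the parameter set is exhausted by sieves with small cell brackets and small prior tails. -/
structure IsRegular (M : ContamModel 𝒳 ι) : Prop where
  isProbabilityMeasure : IsProbabilityMeasure M.prior
  measurable_f : Measurable fun z : EuclideanSpace ℝ ι × 𝒳 => M.f z.1 z.2
  measurableSet_Ω : MeasurableSet M.Ω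
  f_pos : ∀ θ ∈ M.Ω, ∀ x, 0 < M.f θ x
  lintegral_f : ∀ θ ∈ M.Ω, ∫⁻ x, ENNReal.ofReal (M.f θ x) ∂M.base = 1
  θs_mem : M.θs ∈ M.Ω
  contamination : M.IsContamination
  logLipschitz : ∀ θ ∈ M.Ω, ∃ r > 0, ∃ (L : 𝒳 → ℝ) (T B : ℝ), (∀ x, 0 ≤ L x) ∧
    (∀ θ', ‖θ' - θ‖ ≤ r → θ' ∈ M.Ω ∧
      ∀ x, |Real.log (M.f θ' x) - Real.log (M.f θ x)| ≤ ‖θ' - θ‖ * L x) ∧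
    ∀ x, L x * Real.exp (r * L x) * M.f θ x ≤ T * M.g x ∧
      L x * Real.exp (r * L x) * M.f θ x ≤ B
  differentiable : ∀ θ ∈ M.Ω, ∀ x, ∀ u : EuclideanSpace ℝ ι, ‖u‖ = 1 →
    DifferentiableWithinAt ℝ (fun ξ : ℝ => M.f (θ + ξ • u) x) (Ici 0) 0
  separation : ∃ c₀ > 0, ∀ θ ∈ M.Ω,
    c₀ * min ‖θ - M.θs‖ 1 ≤ ∫ x, |M.f θ x - M.f M.θs x| ∂M.base
  prior_ball : ∃ c₀ > 0, ∀ r, 0 < r → r ≤ 1 →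
    ENNReal.ofReal (c₀ * r ^ Fintype.card ι) ≤ M.prior (Metric.closedBall M.θs r)
  sieve : ∃ (V : ℝ → Set (EuclideanSpace ℝ ι)) (A κ : ℝ), 0 < A ∧ 0 < κ ∧
    (∀ ε ε', ε ≤ ε' → V ε' ⊆ V ε) ∧ (∀ ε > 0, V ε ⊆ M.Ω) ∧ (∀ θ ∈ M.Ω, ∃ ε > 0, θ ∈ V ε) ∧
    (∀ ε, MeasurableSet (V ε)) ∧
    (∀ ε R : ℝ, 0 < ε → 0 ≤ R → M.prior (M.Ω \ (V ε ∩ {θ | ∀ i, |θ i| ≤ R})) ≤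
      ENNReal.ofReal (A * (ε + Real.exp (-R)))) ∧
    ∀ ε u : ℝ, 0 < ε → ε ≤ 1 → 0 < u → u ≤ 1 → ∀ θ₀ ∈ V ε, ∃ L U : 𝒳 → ℝ,
      (∀ x, 0 ≤ L x) ∧ Measurable L ∧ Measurable U ∧ Integrable L M.base ∧ Integrable U M.base ∧
      hellinger M.base L U ≤ u ∧
      ∀ θ ∈ M.Ω, (∀ i, |θ i - θ₀ i| ≤ κ * u ^ 2 * ε) → ∀ x, L x ≤ M.f θ x ∧ M.f θ x ≤ U x

/-- The likelihood ratio of a dataset. -/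
noncomputable def lr (M : ContamModel 𝒳 ι) (p : ℝ) {n : ℕ} (θ : EuclideanSpace ℝ ι)
    (X : Fin n → 𝒳) : ℝ≥0∞ :=
  ∏ i, ENNReal.ofReal (M.k p θ (X i) / M.k p M.θs (X i))

lemma integrable_of_lintegral_ofReal_eq_one {μ : Measure 𝒳} {f : 𝒳 → ℝ} (hf : Measurable f)
    (h0 : ∀ x, 0 ≤ f x) (h1 : ∫⁻ x, ENNReal.ofReal (f x) ∂μ = 1) :
    Integrable f μ ∧ ∫ x, f x ∂μ = 1 := by
  have hi : Integrable f μ := by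
    rw [← lintegral_ofReal_ne_top_iff_integrable hf.aestronglyMeasurable (ae_of_all _ h0), h1]
    exact ENNReal.one_ne_top
  exact ⟨hi, by
    rw [integral_eq_lintegral_of_nonneg_ae (ae_of_all _ h0) hf.aestronglyMeasurable, h1]; rfl⟩

namespace IsRegular

variable {M : ContamModel 𝒳 ι}

lemma measurable_f_right (h : M.IsRegular) (θ : EuclideanSpace ℝ ι) : Measurable (M.f θ) :=
  h.measurable_f.comp measurable_prodMk_left

lemma integrable_f (h : M.IsRegular)
    {θ : EuclideanSpace ℝ ι} (hθ : θ ∈ M.Ω) : Integrable (M.f θ) M.base :=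
  (integrable_of_lintegral_ofReal_eq_one (h.measurable_f_right θ) (fun x => (h.f_pos θ hθ x).le)
    (h.lintegral_f θ hθ)).1

lemma integral_f (h : M.IsRegular)
    {θ : EuclideanSpace ℝ ι} (hθ : θ ∈ M.Ω) : ∫ x, M.f θ x ∂M.base = 1 :=
  (integrable_of_lintegral_ofReal_eq_one (h.measurable_f_right θ) (fun x => (h.f_pos θ hθ x).le)
    (h.lintegral_f θ hθ)).2

lemma integrable_g (h : M.IsRegular) : Integrable M.g M.base :=
  (integrable_of_lintegral_ofReal_eq_one h.contamination.measurable
    (fun x => (h.contamination.pos x).le) h.contamination.lintegral_eq_one).1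

lemma integral_g (h : M.IsRegular) : ∫ x, M.g x ∂M.base = 1 :=
  (integrable_of_lintegral_ofReal_eq_one h.contamination.measurable
    (fun x => (h.contamination.pos x).le) h.contamination.lintegral_eq_one).2

lemma measurable_k (h : M.IsRegular)
    (p : ℝ) : Measurable fun z : EuclideanSpace ℝ ι × 𝒳 => M.k p z.1 z.2 := by
  have := h.measurable_f
  have := h.contamination.measurable
  unfold k
  fun_prop

lemma measurable_k_right (h : M.IsRegular)
    (p : ℝ) (θ : EuclideanSpace ℝ ι) : Measurable (M.k p θ) :=
  (h.measurable_k p).comp measurable_prodMk_left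

lemma integrable_k (h : M.IsRegular) (p : ℝ) {θ : EuclideanSpace ℝ ι} (hθ : θ ∈ M.Ω) :
    Integrable (M.k p θ) M.base :=
  ((h.integrable_f hθ).const_mul _).add (h.integrable_g.const_mul _)

lemma integral_k (h : M.IsRegular) (p : ℝ) {θ : EuclideanSpace ℝ ι} (hθ : θ ∈ M.Ω) :
    ∫ x, M.k p θ x ∂M.base = 1 := by
  unfold k
  rw [integral_add ((h.integrable_f hθ).const_mul _) (h.integrable_g.const_mul _),
    integral_const_mul, integral_const_mul, h.integral_f hθ, h.integral_g]
  ring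

lemma k_pos (h : M.IsRegular)
    {p : ℝ} (hp : 0 < p) (hp1 : p ≤ 1) {θ : EuclideanSpace ℝ ι} (hθ : θ ∈ M.Ω) (x : 𝒳) :
    0 < M.k p θ x :=
  add_pos_of_nonneg_of_pos (mul_nonneg (by linarith) (h.f_pos θ hθ x).le)
    (mul_pos hp (h.contamination.pos x))

lemma lintegral_k (h : M.IsRegular)
    {p : ℝ} (hp : 0 < p) (hp1 : p ≤ 1) {θ : EuclideanSpace ℝ ι} (hθ : θ ∈ M.Ω) :
    ∫⁻ x, ENNReal.ofReal (M.k p θ x) ∂M.base = 1 := by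
  rw [← ofReal_integral_eq_lintegral_ofReal (h.integrable_k p hθ)
    (ae_of_all _ fun x => (h.k_pos hp hp1 hθ x).le), h.integral_k p hθ, ENNReal.ofReal_one]

lemma isProbabilityMeasure_dataLaw (h : M.IsRegular) {p : ℝ} (hp : 0 < p) (hp1 : p ≤ 1) :
    IsProbabilityMeasure (M.dataLaw p) :=
  ⟨by rw [dataLaw, withDensity_apply _ MeasurableSet.univ, Measure.restrict_univ,
    h.lintegral_k hp hp1 h.θs_mem]⟩

lemma lintegral_dataLaw (h : M.IsRegular)
    {p : ℝ} (hp : 0 < p) (hp1 : p ≤ 1) {F G : 𝒳 → ℝ} (hF : Measurable F)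
    (hFG : ∀ x, F x * M.k p M.θs x = G x) :
    ∫⁻ x, ENNReal.ofReal (F x) ∂(M.dataLaw p) = ∫⁻ x, ENNReal.ofReal (G x) ∂M.base := by
  rw [dataLaw, lintegral_withDensity_eq_lintegral_mul _
    (h.measurable_k_right p M.θs).ennreal_ofReal hF.ennreal_ofReal]
  refine lintegral_congr fun x => ?_
  rw [Pi.mul_apply, ← hFG x, mul_comm (F x),
    ENNReal.ofReal_mul (h.k_pos hp hp1 h.θs_mem x).le]

lemma measurable_lr (h : M.IsRegular) (p : ℝ) (n : ℕ) :
    Measurable fun z : EuclideanSpace ℝ ι × (Fin n → 𝒳) => M.lr p z.1 z.2 := by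
  unfold lr
  refine Finset.measurable_prod _ fun i _ => ?_
  have h1 : Measurable fun z : EuclideanSpace ℝ ι × (Fin n → 𝒳) => M.k p z.1 (z.2 i) :=
    (h.measurable_k p).comp (measurable_fst.prodMk ((measurable_pi_apply i).comp measurable_snd))
  have h2 : Measurable fun z : EuclideanSpace ℝ ι × (Fin n → 𝒳) => M.k p M.θs (z.2 i) :=
    (h.measurable_k_right p _).comp ((measurable_pi_apply i).comp measurable_snd)
  exact (h1.div h2).ennreal_ofReal

/-- The denominators cancel against the density of the data, so each factor integrates to the total
mass of k_p(·; θ). -/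
lemma lintegral_lr (h : M.IsRegular)
    {p : ℝ} (hp : 0 < p) (hp1 : p ≤ 1) (n : ℕ) {θ : EuclideanSpace ℝ ι}
    (hθ : θ ∈ M.Ω) :
    ∫⁻ X : Fin n → 𝒳, M.lr p θ X ∂(Measure.pi fun _ => M.dataLaw p) = 1 := by
  have := h.isProbabilityMeasure_dataLaw hp hp1
  have hm : Measurable fun x => M.k p θ x / M.k p M.θs x :=
    (h.measurable_k_right p θ).div (h.measurable_k_right p _)
  unfold lr
  rw [lintegral_pi_prod (M.dataLaw p) n
      (F := fun x => ENNReal.ofReal (M.k p θ x / M.k p M.θs x)) hm.ennreal_ofReal,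
    h.lintegral_dataLaw hp hp1 hm (G := M.k p θ)
      (fun x => div_mul_cancel₀ _ (h.k_pos hp hp1 h.θs_mem x).ne'), h.lintegral_k hp hp1 hθ,
    one_pow]

/-- Factoring out the likelihood of the truth, which does not depend on θ, lets likelihood ratios
replace likelihoods in the posterior. -/
lemma marginal_eq (h : M.IsRegular)
    {p : ℝ} (hp : 0 < p) (hp1 : p ≤ 1) {n : ℕ} {A : Set (EuclideanSpace ℝ ι)}
    (X : Fin n → 𝒳) :
    M.marginal p A X =
      (∏ i, ENNReal.ofReal (M.k p M.θs (X i))) * ∫⁻ θ in A, M.lr p θ X ∂M.prior := by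
  unfold marginal
  rw [← lintegral_const_mul' _ _ (ENNReal.prod_ne_top fun _ _ => ENNReal.ofReal_ne_top)]
  refine lintegral_congr fun θ => ?_
  unfold lr
  rw [← Finset.prod_mul_distrib]
  refine Finset.prod_congr rfl fun i _ => ?_
  have h0 := h.k_pos hp hp1 h.θs_mem (X i)
  rw [← ENNReal.ofReal_mul h0.le, mul_div_cancel₀ _ h0.ne']

lemma posterior_eq (h : M.IsRegular)
    {p : ℝ} (hp : 0 < p) (hp1 : p ≤ 1) {n : ℕ} {A : Set (EuclideanSpace ℝ ι)}
    (X : Fin n → 𝒳) :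
    M.posterior p A X =
      (∫⁻ θ in A ∩ M.Ω, M.lr p θ X ∂M.prior) / ∫⁻ θ in M.Ω, M.lr p θ X ∂M.prior := by
  rw [posterior, h.marginal_eq hp hp1, h.marginal_eq hp hp1]
  refine ENNReal.mul_div_mul_left _ _ ?_ ?_
  · exact Finset.prod_ne_zero_iff.2 fun i _ =>
      (ENNReal.ofReal_pos.2 (h.k_pos hp hp1 h.θs_mem (X i))).ne'
  · exact ENNReal.prod_ne_top fun _ _ => ENNReal.ofReal_ne_top

/-- Local Lipschitz bounds dominated by the contamination. -/
lemma exists_lipschitz (h : M.IsRegular) {θ : EuclideanSpace ℝ ι} (hθ : θ ∈ M.Ω) :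
    ∃ r > 0, ∃ T > 0, ∃ B, ∀ θ', ‖θ' - θ‖ ≤ r → θ' ∈ M.Ω ∧ ∀ x,
      |M.f θ' x - M.f θ x| ≤ ‖θ' - θ‖ * (T * M.g x) ∧ |M.f θ' x - M.f θ x| ≤ ‖θ' - θ‖ * B ∧
      |(M.f θ x / M.f θ' x - 1) * M.f θ x| ≤ ‖θ' - θ‖ * (T * M.g x) := by
  obtain ⟨r, hr, L, T, B, hL, hlip, hdom⟩ := h.logLipschitz θ hθ
  refine ⟨r, hr, |T| + 1, by positivity, B, fun θ' hθ' => ⟨(hlip θ' hθ').1, fun x => ?_⟩⟩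
  have hm := (hlip θ' hθ').1
  have hy := (hlip θ' hθ').2 x
  have hf := h.f_pos θ hθ x
  have hf' := h.f_pos θ' hm x
  have hg := h.contamination.pos x
  set y := Real.log (M.f θ' x) - Real.log (M.f θ x) with hyd
  have e1 : M.f θ' x = M.f θ x * Real.exp y := by
    rw [hyd, Real.exp_sub, Real.exp_log hf, Real.exp_log hf', mul_div_cancel₀ _ hf.ne']
  have e2 : M.f θ x / M.f θ' x = Real.exp (-y) := by
    rw [e1, Real.exp_neg]; field_simp
  have hT : T * M.g x ≤ (|T| + 1) * M.g x := by
    have := le_abs_self T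
    gcongr; linarith
  -- Both f(θ')/f(θ) and its inverse are exponentials of ±y with |y| ≤ ‖θ' - θ‖ L. One bound on |e^w
  -- - 1| thus serves the density increment and the chi-square integrand alike.
  have main : ∀ w : ℝ, |w| = |y| → M.f θ x * |Real.exp w - 1| ≤
      ‖θ' - θ‖ * (L x * Real.exp (r * L x) * M.f θ x) := by
    intro w hw
    have h1 := abs_exp_sub_one_le_abs_mul_exp w
    rw [hw] at h1
    have h2 : Real.exp |y| ≤ Real.exp (r * L x) :=
      Real.exp_le_exp.2 (hy.trans (by have := hL x; gcongr))
    calc M.f θ x * |Real.exp w - 1| ≤ M.f θ x * (‖θ' - θ‖ * L x * Real.exp (r * L x)) := by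
          refine mul_le_mul_of_nonneg_left (h1.trans ?_) hf.le
          have := hL x
          gcongr
      _ = _ := by ring
  have n0 := norm_nonneg (θ' - θ)
  have hd1 : |M.f θ' x - M.f θ x| = M.f θ x * |Real.exp y - 1| := by
    rw [e1, ← mul_sub_one, abs_mul, abs_of_pos hf]
  have hd2 : |(M.f θ x / M.f θ' x - 1) * M.f θ x| = M.f θ x * |Real.exp (-y) - 1| := by
    rw [e2, abs_mul, abs_of_pos hf]; ring
  rw [hd1, hd2]
  refine ⟨(main y rfl).trans ?_, (main y rfl).trans ?_, (main (-y) (abs_neg y)).trans ?_⟩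
  · exact mul_le_mul_of_nonneg_left ((hdom x).1.trans hT) n0
  · exact mul_le_mul_of_nonneg_left (hdom x).2 n0
  · exact mul_le_mul_of_nonneg_left ((hdom x).1.trans hT) n0

end IsRegular
end ContamModel

/-! ### Posterior concentration -/

/-- Markov's inequality for a product of i.i.d. factors. -/
lemma measure_pi_le_prod_le {𝒳 : Type} [MeasurableSpace 𝒳] (P : Measure 𝒳)
    [IsProbabilityMeasure P] (n : ℕ) {F : 𝒳 → ℝ≥0∞} (hF : Measurable F) {s : ℝ} :
    (Measure.pi fun _ : Fin n => P) {X | ENNReal.ofReal (Real.exp (-s)) ≤ ∏ i, F (X i)} ≤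
      ENNReal.ofReal (Real.exp s) * (∫⁻ x, F x ∂P) ^ n := by
  have hm : Measurable fun X : Fin n → 𝒳 => ∏ i, F (X i) :=
    Finset.measurable_prod _ fun i _ => hF.comp (measurable_pi_apply i)
  have h1 := mul_meas_ge_le_lintegral hm (μ := Measure.pi fun _ : Fin n => P)
    (ENNReal.ofReal (Real.exp (-s)))
  rw [lintegral_pi_prod P n hF] at h1
  have h2 : ENNReal.ofReal (Real.exp s) * ENNReal.ofReal (Real.exp (-s)) = 1 := by
    rw [← ENNReal.ofReal_mul (Real.exp_pos _).le, ← Real.exp_add]; simp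
  calc _ = ENNReal.ofReal (Real.exp s) * (ENNReal.ofReal (Real.exp (-s)) *
        (Measure.pi fun _ : Fin n => P) {X | ENNReal.ofReal (Real.exp (-s)) ≤ ∏ i, F (X i)}) := by
        rw [← mul_assoc, h2, one_mul]
    _ ≤ _ := by gcongr

namespace ContamModel

variable {𝒳 : Type} [MeasurableSpace 𝒳] {ι : Type} [Fintype ι]

namespace IsRegular

variable {M : ContamModel 𝒳 ι}

/-- The event that some upper bracket has a large likelihood ratio. -/
lemma measure_bracket_le (h : M.IsRegular) {p : ℝ} (hp : 0 < p) (hp1 : p ≤ 1) (n : ℕ) {s a : ℝ}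
    {U : 𝒳 → ℝ} (hU : Measurable U) (hU0 : ∀ x, 0 ≤ U x) (hUi : Integrable U M.base)
    (ha : ∫ x, √((1 - p) * U x + p * M.g x) * √(M.k p M.θs x) ∂M.base ≤ Real.exp (-a)) :
    (Measure.pi fun _ : Fin n => M.dataLaw p) {X | ENNReal.ofReal (Real.exp (-s)) <
        ∏ i, ENNReal.ofReal (((1 - p) * U (X i) + p * M.g (X i)) / M.k p M.θs (X i))} ≤
      ENNReal.ofReal (Real.exp (s / 2 - n * a)) := by
  have := h.isProbabilityMeasure_dataLaw hp hp1
  have hk := h.k_pos hp hp1 h.θs_mem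
  have hg := h.contamination.measurable
  have hkm := h.measurable_k_right p M.θs
  set K : 𝒳 → ℝ := fun x => (1 - p) * U x + p * M.g x with hK
  have hK0 : ∀ x, 0 ≤ K x := fun x =>
    add_nonneg (mul_nonneg (by linarith) (hU0 x)) (mul_nonneg hp.le (h.contamination.pos x).le)
  have hKi : Integrable K M.base := (hUi.const_mul _).add (h.integrable_g.const_mul _)
  have hKm : Measurable K := by fun_prop
  have hFm : Measurable fun x => √(K x / M.k p M.θs x) := (hKm.div hkm).sqrt
  -- Under the truth, the mean of the root of K/k* is the affinity of K and k*.
  have hintg : ∫⁻ x, ENNReal.ofReal (√(K x / M.k p M.θs x)) ∂(M.dataLaw p) ≤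
      ENNReal.ofReal (Real.exp (-a)) := by
    rw [h.lintegral_dataLaw hp hp1 hFm (G := fun x => √(K x) * √(M.k p M.θs x)) ?_,
      ← ofReal_integral_eq_lintegral_ofReal (integrable_sqrt_mul hKi (h.integrable_k p h.θs_mem)
        hK0 fun x => (hk x).le) (ae_of_all _ fun x => by positivity)]
    · exact ENNReal.ofReal_le_ofReal ha
    · intro x
      rw [Real.sqrt_div (hK0 x)]
      have h1 := Real.sq_sqrt (hk x).le
      have h2 := Real.sqrt_pos.2 (hk x)
      calc √(K x) / √(M.k p M.θs x) * M.k p M.θs x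
          = √(K x) / √(M.k p M.θs x) * √(M.k p M.θs x) ^ 2 := by rw [h1]
        _ = _ := by field_simp
  -- Taking roots halves the threshold exponent s.
  calc _ ≤ (Measure.pi fun _ : Fin n => M.dataLaw p) {X | ENNReal.ofReal (Real.exp (-(s / 2))) ≤
        ∏ i, ENNReal.ofReal (√(K (X i) / M.k p M.θs (X i)))} := by
        refine measure_mono fun X hX => ?_
        simp only [mem_ofPred_eq] at hX ⊢
        rw [← ENNReal.ofReal_prod_of_nonneg fun i _ => Real.sqrt_nonneg _]
        rw [← ENNReal.ofReal_prod_of_nonneg fun i _ => div_nonneg (hK0 _) (hk _).le] at hX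
        have h1 := (ENNReal.ofReal_lt_ofReal_iff_of_nonneg (Real.exp_pos _).le).1 hX
        refine ENNReal.ofReal_le_ofReal ?_
        rw [← Real.sqrt_prod _ fun i _ => div_nonneg (hK0 _) (hk _).le]
        refine Real.le_sqrt_of_sq_le ?_
        rw [← Real.exp_nat_mul]
        refine le_trans (le_of_eq ?_) h1.le
        congr 1; push_cast; ring
    _ ≤ ENNReal.ofReal (Real.exp (s / 2)) *
        (∫⁻ x, ENNReal.ofReal (√(K x / M.k p M.θs x)) ∂(M.dataLaw p)) ^ n :=
        measure_pi_le_prod_le _ n hFm.ennreal_ofReal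
    _ ≤ ENNReal.ofReal (Real.exp (s / 2)) * ENNReal.ofReal (Real.exp (-a)) ^ n := by gcongr
    _ = _ := by
        rw [← ENNReal.ofReal_pow (Real.exp_pos _).le, ← ENNReal.ofReal_mul (Real.exp_pos _).le,
          ← Real.exp_nat_mul, ← Real.exp_add]
        congr 2; ring

/-- The integrated likelihood ratio over a sieve that is far from the truth is small. -/
lemma measure_sieve_le (h : M.IsRegular) {p : ℝ} (hp : 0 < p) (hp1 : p ≤ 1) (n : ℕ) {s u η : ℝ}
    (hu : 0 < u) {A : Set (EuclideanSpace ℝ ι)} (hA : MeasurableSet A) (hAΩ : A ⊆ M.Ω)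
    {B : Finset ((𝒳 → ℝ) × (𝒳 → ℝ))} (hB : IsBracketing M.base u (M.f '' A) B)
    (hBm : ∀ b ∈ B, Measurable b.2)
    (hη : ∀ θ ∈ A, η ≤ hellinger M.base (M.k p θ) (M.k p M.θs) ^ 2) :
    (Measure.pi fun _ : Fin n => M.dataLaw p)
      {X | ENNReal.ofReal (Real.exp (-s)) < ∫⁻ θ in A, M.lr p θ X ∂M.prior} ≤
      ENNReal.ofReal (B.card * Real.exp (s / 2 - n * (η - 3 / 2 * u))) := by
  classical
  have := h.isProbabilityMeasure
  have hk := h.k_pos hp hp1 h.θs_mem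
  -- Only brackets that contain a member of A are kept: the affinity of an upper end is controlled
  -- through the Hellinger distance of such a member from the truth.
  set B' := B.filter fun b => ∃ θ ∈ A, ∀ x, b.1 x ≤ M.f θ x ∧ M.f θ x ≤ b.2 x with hB'
  have hsub : {X : Fin n → 𝒳 | ENNReal.ofReal (Real.exp (-s)) <
      ∫⁻ θ in A, M.lr p θ X ∂M.prior} ⊆ ⋃ b ∈ B', {X | ENNReal.ofReal (Real.exp (-s)) <
        ∏ i, ENNReal.ofReal (((1 - p) * b.2 (X i) + p * M.g (X i)) / M.k p M.θs (X i))} := by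
    intro X hX
    by_contra hno
    simp only [mem_iUnion, mem_ofPred_eq, not_exists, not_lt] at hno hX
    refine absurd hX (not_lt.2 ?_)
    -- If every kept upper end has a small ratio, so has every θ in A, and integrating against a
    -- probability prior cannot increase the bound.
    have hle : ∀ θ ∈ A, M.lr p θ X ≤ ENNReal.ofReal (Real.exp (-s)) := by
      intro θ hθ
      obtain ⟨b, hb, hbθ⟩ := hB.2 _ ⟨θ, hθ, rfl⟩
      refine le_trans ?_ (hno b (Finset.mem_filter.2 ⟨hb, θ, hθ, hbθ⟩))
      refine Finset.prod_le_prod' fun i _ => ENNReal.ofReal_le_ofReal ?_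
      refine div_le_div_of_nonneg_right ?_ (hk _).le
      exact add_le_add (mul_le_mul_of_nonneg_left (hbθ _).2 (by linarith)) le_rfl
    calc ∫⁻ θ in A, M.lr p θ X ∂M.prior
        ≤ ∫⁻ _ in A, ENNReal.ofReal (Real.exp (-s)) ∂M.prior := setLIntegral_mono' hA hle
      _ = ENNReal.ofReal (Real.exp (-s)) * M.prior A := setLIntegral_const _ _
      _ ≤ ENNReal.ofReal (Real.exp (-s)) * 1 := by gcongr; exact prob_le_one
      _ = _ := mul_one _
  calc _ ≤ _ := measure_mono hsub
    _ ≤ ∑ b ∈ B', _ := measure_biUnion_finset_le _ _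
    _ ≤ ∑ b ∈ B', ENNReal.ofReal (Real.exp (s / 2 - n * (η - 3 / 2 * u))) := by
        refine Finset.sum_le_sum fun b hb => ?_
        obtain ⟨hbB, θ, hθ, hbθ⟩ := Finset.mem_filter.1 hb
        obtain ⟨h1, h2, h3, h4, h5⟩ := hB.1 b hbB
        refine h.measure_bracket_le hp hp1 n (hBm b hbB) h2 h4 ?_
        have h6 := integral_sqrt_mul_bracket_le (q := M.k p M.θs) hp.le hp1 hu
          (h.integrable_f (hAΩ hθ)) h3 h4
          h.integrable_g (h.integrable_k p h.θs_mem) h1 (fun x => (hbθ x).1) (fun x => (hbθ x).2)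
          (fun x => (h.contamination.pos x).le) (fun x => (hk x).le) (h.integral_f (hAΩ hθ))
          h.integral_g (h.integral_k p h.θs_mem) h5
        refine h6.trans ?_
        have h7 := hη θ hθ
        have h8 := Real.add_one_le_exp (-(η - 3 / 2 * u))
        change 1 - hellinger M.base (M.k p θ) (M.k p M.θs) ^ 2 + 3 / 2 * u ≤ _
        linarith
    _ = B'.card * ENNReal.ofReal (Real.exp (s / 2 - n * (η - 3 / 2 * u))) := by
        rw [Finset.sum_const, nsmul_eq_mul]
    _ ≤ B.card * ENNReal.ofReal (Real.exp (s / 2 - n * (η - 3 / 2 * u))) := by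
        gcongr; exact Finset.filter_subset _ _
    _ = _ := by
        rw [ENNReal.ofReal_mul (Nat.cast_nonneg _), ENNReal.ofReal_natCast]

/-- Tonelli, followed by the unit mean of each likelihood ratio. -/
lemma lintegral_lintegral_lr (h : M.IsRegular) {p : ℝ} (hp : 0 < p) (hp1 : p ≤ 1) (n : ℕ)
    {A : Set (EuclideanSpace ℝ ι)} (hA : MeasurableSet A) (hAΩ : A ⊆ M.Ω) :
    ∫⁻ X : Fin n → 𝒳, ∫⁻ θ in A, M.lr p θ X ∂M.prior ∂(Measure.pi fun _ => M.dataLaw p) =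
      M.prior A := by
  have := h.isProbabilityMeasure
  have := h.isProbabilityMeasure_dataLaw hp hp1
  have hm : Measurable fun z : (Fin n → 𝒳) × EuclideanSpace ℝ ι => M.lr p z.2 z.1 := by
    have h1 := (h.measurable_lr p n).comp
      (measurable_swap (α := Fin n → 𝒳) (β := EuclideanSpace ℝ ι))
    exact h1
  rw [lintegral_lintegral_swap (f := fun X θ => M.lr p θ X) hm.aemeasurable]
  rw [setLIntegral_congr_fun hA fun θ hθ => h.lintegral_lr hp hp1 n (hAΩ hθ)]
  simp

/-- The integrated likelihood ratio over a set of small prior mass is small. -/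
lemma measure_tail_le (h : M.IsRegular) {p : ℝ} (hp : 0 < p) (hp1 : p ≤ 1) (n : ℕ) {s : ℝ}
    {A : Set (EuclideanSpace ℝ ι)} (hA : MeasurableSet A) (hAΩ : A ⊆ M.Ω) :
    (Measure.pi fun _ : Fin n => M.dataLaw p)
      {X | ENNReal.ofReal (Real.exp (-s)) < ∫⁻ θ in A, M.lr p θ X ∂M.prior} ≤
      ENNReal.ofReal (Real.exp s) * M.prior A := by
  have := h.isProbabilityMeasure
  have hm : Measurable fun X : Fin n → 𝒳 => ∫⁻ θ in A, M.lr p θ X ∂M.prior :=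
    ((h.measurable_lr p n).comp measurable_swap).lintegral_prod_right'
  have h1 := mul_meas_ge_le_lintegral hm (μ := Measure.pi fun _ : Fin n => M.dataLaw p)
    (ENNReal.ofReal (Real.exp (-s)))
  rw [h.lintegral_lintegral_lr hp hp1 n hA hAΩ] at h1
  have h2 : ENNReal.ofReal (Real.exp s) * ENNReal.ofReal (Real.exp (-s)) = 1 := by
    rw [← ENNReal.ofReal_mul (Real.exp_pos _).le, ← Real.exp_add]; simp
  set E := {X : Fin n → 𝒳 | ENNReal.ofReal (Real.exp (-s)) ≤ ∫⁻ θ in A, M.lr p θ X ∂M.prior}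
  have h3 : {X : Fin n → 𝒳 | ENNReal.ofReal (Real.exp (-s)) < ∫⁻ θ in A, M.lr p θ X ∂M.prior} ⊆ E :=
    fun X hX => by simp only [E, mem_ofPred_eq] at hX ⊢; exact hX.le
  refine (measure_mono h3).trans ?_
  rw [← one_mul ((Measure.pi fun _ : Fin n => M.dataLaw p) E), ← h2, mul_assoc]
  gcongr

/-- Contamination decreases the chi-square divergence. -/
lemma lintegral_inv_ratio_le (h : M.IsRegular) {p : ℝ} (hp : 0 < p) (hp1 : p ≤ 1) {t : ℝ}
    (ht : 0 ≤ t) {θ : EuclideanSpace ℝ ι} (hθ : θ ∈ M.rhoNhd 1 t) :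
    ∫⁻ x, ENNReal.ofReal (M.k p M.θs x / M.k p θ x) ∂(M.dataLaw p) ≤
      ENNReal.ofReal (Real.exp t) := by
  obtain ⟨hΩ, hi, hle⟩ := hθ
  have hk := h.k_pos hp hp1 h.θs_mem
  have hk' := h.k_pos hp hp1 hΩ
  have hm : Measurable fun x => M.k p M.θs x / M.k p θ x :=
    (h.measurable_k_right p _).div (h.measurable_k_right p _)
  rw [h.lintegral_dataLaw hp hp1 hm (G := fun x => M.k p M.θs x ^ 2 / M.k p θ x)
    (fun x => by ring)]
  -- Joint convexity of (a, b) ↦ a²/b. Since α = 1, the integrand plus f(θ*) equals a²/b, and after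
  -- multiplying out, the convexity gap is the nonnegative term in `hq`.
  have hpt : ∀ x, M.k p M.θs x ^ 2 / M.k p θ x ≤
      (1 - p) * (M.rhoIntegrand 1 θ x + M.f M.θs x) + p * M.g x := by
    intro x
    have hb := h.f_pos θ hΩ x
    have hg := h.contamination.pos x
    rw [div_le_iff₀ (hk' x)]
    simp only [rhoIntegrand, Real.rpow_one, k]
    set a := M.f M.θs x
    set b := M.f θ x
    set g := M.g x
    have hq : 0 ≤ (1 - p) * p * g * ((a - b) ^ 2 / b) := by
      have : 0 ≤ 1 - p := by linarith
      positivity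
    have e : ((1 - p) * ((a / b - 1) * a + a) + p * g) * ((1 - p) * b + p * g) -
        ((1 - p) * a + p * g) ^ 2 = (1 - p) * p * g * ((a - b) ^ 2 / b) := by
      field_simp; ring
    linarith
  have hri := (((hi.add (h.integrable_f h.θs_mem)).const_mul (1 - p)).add
    (h.integrable_g.const_mul p))
  calc _ ≤ ∫⁻ x, ENNReal.ofReal
        ((1 - p) * (M.rhoIntegrand 1 θ x + M.f M.θs x) + p * M.g x) ∂M.base :=
        lintegral_mono fun x => ENNReal.ofReal_le_ofReal (hpt x)
    _ = ENNReal.ofReal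
        (∫ x, (1 - p) * (M.rhoIntegrand 1 θ x + M.f M.θs x) + p * M.g x ∂M.base) :=
        (ofReal_integral_eq_lintegral_ofReal hri (ae_of_all _ fun x =>
          (div_nonneg (sq_nonneg _) (hk' x).le).trans (hpt x))).symm
    _ ≤ _ := by
        refine ENNReal.ofReal_le_ofReal ?_
        rw [integral_add (by exact (hi.add (h.integrable_f h.θs_mem)).const_mul (1 - p))
          (h.integrable_g.const_mul p), integral_const_mul, integral_const_mul,
          integral_add hi (h.integrable_f h.θs_mem), h.integral_f h.θs_mem, h.integral_g]
        have := Real.add_one_le_exp t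
        rw [div_one, one_mul] at hle
        nlinarith

/-- The integrated likelihood ratio over a neighbourhood of the truth is not too small. -/
lemma measure_centre_le (h : M.IsRegular) {p : ℝ} (hp : 0 < p) (hp1 : p ≤ 1) (n : ℕ) {t : ℝ}
    (ht : 0 ≤ t) {A : Set (EuclideanSpace ℝ ι)} (hA : MeasurableSet A) (hAt : A ⊆ M.rhoNhd 1 t) :
    (Measure.pi fun _ : Fin n => M.dataLaw p)
      {X | ∫⁻ θ in A, M.lr p θ X ∂M.prior <
        ENNReal.ofReal (Real.exp (-(2 * n * t))) * M.prior A} ≤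
      ENNReal.ofReal (Real.exp (-(n * t))) := by
  have := h.isProbabilityMeasure
  have := h.isProbabilityMeasure_dataLaw hp hp1
  have hAΩ : A ⊆ M.Ω := fun θ hθ => (hAt hθ).1
  rcases eq_or_ne (M.prior A) 0 with h0 | h0
  · simp [h0]
  have hk := h.k_pos hp hp1 h.θs_mem
  set β := ENNReal.ofReal (Real.exp (2 * n * t)) with hβ
  have hβ0 : β ≠ 0 := (ENNReal.ofReal_pos.2 (Real.exp_pos _)).ne'
  have hβt : β ≠ ⊤ := ENNReal.ofReal_ne_top
  have hβinv : ENNReal.ofReal (Real.exp (-(2 * n * t))) = β⁻¹ := by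
    rw [Real.exp_neg, ENNReal.ofReal_inv_of_pos (Real.exp_pos _)]
  -- J is the inverse likelihood ratio. Its mean is at most e^{nt} for every θ in the neighbourhood.
  set J : EuclideanSpace ℝ ι → (Fin n → 𝒳) → ℝ≥0∞ := fun θ X =>
    ∏ i, ENNReal.ofReal (M.k p M.θs (X i) / M.k p θ (X i)) with hJ
  have hJm : Measurable fun z : (Fin n → 𝒳) × EuclideanSpace ℝ ι => J z.2 z.1 := by
    refine Finset.measurable_prod _ fun i _ => ?_
    have h1 : Measurable fun z : (Fin n → 𝒳) × EuclideanSpace ℝ ι => M.k p z.2 (z.1 i) :=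
      (h.measurable_k p).comp (measurable_snd.prodMk ((measurable_pi_apply i).comp measurable_fst))
    have h2 : Measurable fun z : (Fin n → 𝒳) × EuclideanSpace ℝ ι => M.k p M.θs (z.1 i) :=
      (h.measurable_k_right p _).comp ((measurable_pi_apply i).comp measurable_fst)
    exact (h2.div h1).ennreal_ofReal
  clear_value J
  have hIm : Measurable fun X : Fin n → 𝒳 => ∫⁻ θ in A, J θ X ∂M.prior := hJm.lintegral_prod_right'
  have hmean : ∫⁻ X, ∫⁻ θ in A, J θ X ∂M.prior ∂(Measure.pi fun _ : Fin n => M.dataLaw p) ≤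
      ENNReal.ofReal (Real.exp (n * t)) * M.prior A := by
    rw [lintegral_lintegral_swap hJm.aemeasurable]
    calc _ ≤ ∫⁻ _ in A, ENNReal.ofReal (Real.exp (n * t)) ∂M.prior := by
          refine setLIntegral_mono' hA fun θ hθ => ?_
          simp only [hJ]
          rw [lintegral_pi_prod (M.dataLaw p) n
            (F := fun x => ENNReal.ofReal (M.k p M.θs x / M.k p θ x))
            ((h.measurable_k_right p _).div (h.measurable_k_right p _)).ennreal_ofReal,
            Real.exp_nat_mul, ENNReal.ofReal_pow (Real.exp_pos _).le]
          gcongr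
          exact h.lintegral_inv_ratio_le hp hp1 ht (hAt hθ)
      _ = _ := setLIntegral_const _ _
  -- The arithmetic–geometric mean inequality 2β ≤ 1/y + β² y replaces Jensen: if the integral of y
  -- is below π₀(A)/β, then that of 1/y is at least β π₀(A). With β = e^{2nt}, Markov leaves the
  -- probability e^{-nt}.
  have hpt : ∀ X : Fin n → 𝒳, ∀ θ ∈ A, 2 * β ≤ J θ X + β ^ 2 * M.lr p θ X := by
    intro X θ hθ
    have hk' := h.k_pos hp hp1 (hAΩ hθ)
    have e1 : M.lr p θ X = ENNReal.ofReal (∏ i, M.k p θ (X i) / M.k p M.θs (X i)) :=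
      (ENNReal.ofReal_prod_of_nonneg fun i _ => (div_pos (hk' _) (hk _)).le).symm
    have e2 : J θ X = ENNReal.ofReal (∏ i, M.k p θ (X i) / M.k p M.θs (X i))⁻¹ := by
      rw [← Finset.prod_inv_distrib,
        ENNReal.ofReal_prod_of_nonneg fun i _ => (inv_pos.2 (div_pos (hk' _) (hk _))).le]
      simp only [hJ, inv_div]
    have hy : 0 < ∏ i, M.k p θ (X i) / M.k p M.θs (X i) :=
      Finset.prod_pos fun i _ => div_pos (hk' _) (hk _)
    rw [e1, e2, hβ]
    set y := ∏ i, M.k p θ (X i) / M.k p M.θs (X i)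
    set b := Real.exp (2 * n * t) with hb
    have hb0 : 0 < b := Real.exp_pos _
    rw [← ENNReal.ofReal_pow hb0.le, ← ENNReal.ofReal_mul (by positivity),
      ← ENNReal.ofReal_add (by positivity) (by positivity),
      show (2 : ℝ≥0∞) = ENNReal.ofReal 2 by simp, ← ENNReal.ofReal_mul (by norm_num)]
    refine ENNReal.ofReal_le_ofReal ?_
    have h1 : 0 ≤ (b * y - 1) ^ 2 / y := by positivity
    have h2 : (b * y - 1) ^ 2 / y = y⁻¹ + b ^ 2 * y - 2 * b := by field_simp; ring
    linarith
  have hsub : {X : Fin n → 𝒳 | ∫⁻ θ in A, M.lr p θ X ∂M.prior <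
        ENNReal.ofReal (Real.exp (-(2 * n * t))) * M.prior A} ⊆
      {X | β * M.prior A ≤ ∫⁻ θ in A, J θ X ∂M.prior} := by
    intro X hX
    simp only [mem_ofPred_eq, hβinv] at hX ⊢
    have h1 : 2 * β * M.prior A ≤
        ∫⁻ θ in A, J θ X ∂M.prior + β ^ 2 * ∫⁻ θ in A, M.lr p θ X ∂M.prior := by
      have hJX : Measurable fun θ => J θ X := by
        have h1 := hJm.comp (measurable_prodMk_left (β := EuclideanSpace ℝ ι) (x := X))
        exact h1
      rw [← lintegral_const_mul' _ _ (by finiteness), ← lintegral_add_left hJX,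
        ← setLIntegral_const]
      exact setLIntegral_mono' hA (hpt X)
    have h2 : β ^ 2 * ∫⁻ θ in A, M.lr p θ X ∂M.prior ≤ β * M.prior A := by
      calc _ ≤ β ^ 2 * (β⁻¹ * M.prior A) := by gcongr
        _ = β * (β * β⁻¹) * M.prior A := by ring
        _ = _ := by rw [ENNReal.mul_inv_cancel hβ0 hβt, mul_one]
    have h3 : β * M.prior A + β * M.prior A ≤
        ∫⁻ θ in A, J θ X ∂M.prior + β * M.prior A := by
      calc _ = 2 * β * M.prior A := by ring
        _ ≤ _ := h1.trans (by gcongr)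
    exact (ENNReal.add_le_add_iff_right (ENNReal.mul_ne_top hβt (measure_ne_top _ _))).1 h3
  have hM := mul_meas_ge_le_lintegral hIm (μ := Measure.pi fun _ : Fin n => M.dataLaw p)
    (β * M.prior A)
  have hc0 : β * M.prior A ≠ 0 := mul_ne_zero hβ0 h0
  have hct : β * M.prior A ≠ ⊤ := ENNReal.mul_ne_top hβt (measure_ne_top _ _)
  refine (measure_mono hsub).trans ?_
  refine (ENNReal.mul_le_mul_iff_right hc0 hct).1 ((hM.trans hmean).trans (le_of_eq ?_))
  rw [mul_right_comm, hβ, ← ENNReal.ofReal_mul (Real.exp_pos _).le, ← Real.exp_add]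
  congr 3; ring

end IsRegular
end ContamModel

/-! ### Privacy of posterior sampling and bracketing of the sieves -/

namespace ContamModel

variable {𝒳 : Type} [MeasurableSpace 𝒳] {ι : Type} [Fintype ι]

namespace IsRegular

variable {M : ContamModel 𝒳 ι}

/-- All factors but one agree. As k_p ≥ p g for both parameters, an increment of at most a p g keeps
the ratio of the densities between e^{-a} and e^{a}; the differing entry is used once for X and once
for Z, whence 2a. -/
lemma lr_le_of_neighbours (h : M.IsRegular) {p : ℝ} (hp : 0 < p) (hp1 : p ≤ 1) {n : ℕ}
    {X Z : Fin n → 𝒳} {a : ℝ} {θ : EuclideanSpace ℝ ι} (hθ : θ ∈ M.Ω)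
    (hlip : ∀ x, (1 - p) * |M.f θ x - M.f M.θs x| ≤ a * (p * M.g x))
    (hXZ : ∃ j, ∀ i, i ≠ j → X i = Z i) :
    M.lr p θ X ≤ ENNReal.ofReal (Real.exp (2 * a)) * M.lr p θ Z := by
  obtain ⟨j, hj⟩ := hXZ
  have hk := h.k_pos hp hp1 h.θs_mem
  have hk' := h.k_pos hp hp1 hθ
  have hp1' : 0 ≤ 1 - p := by linarith
  have hab : ∀ x, |M.k p θ x - M.k p M.θs x| ≤ a * (p * M.g x) := fun x => by
    refine le_trans (le_of_eq ?_) (hlip x)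
    rw [show M.k p θ x - M.k p M.θs x = (1 - p) * (M.f θ x - M.f M.θs x) by unfold k; ring,
      abs_mul, abs_of_nonneg hp1']
  have ha : 0 ≤ a := by
    have h1 := (abs_nonneg _).trans (hab (X j))
    have h2 := mul_pos hp (h.contamination.pos (X j))
    exact nonneg_of_mul_nonneg_left h1 h2
  have hge : ∀ θ' ∈ M.Ω, ∀ x, p * M.g x ≤ M.k p θ' x := fun θ' hθ' x => by
    unfold k
    have := mul_nonneg hp1' (h.f_pos θ' hθ' x).le
    linarith
  have hexp : 1 + a ≤ Real.exp a := by linarith [Real.add_one_le_exp a]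
  have hup : ∀ x, M.k p θ x / M.k p M.θs x ≤ Real.exp a := fun x => by
    rw [div_le_iff₀ (hk x)]
    have h1 := (abs_le.1 (hab x)).2
    nlinarith [hge _ h.θs_mem x, hk x]
  have hlow : ∀ x, 1 ≤ Real.exp a * (M.k p θ x / M.k p M.θs x) := fun x => by
    rw [mul_div_assoc', le_div_iff₀ (hk x)]
    have h1 := (abs_le.1 (hab x)).1
    nlinarith [hge _ hθ x, hk' x]
  have hrest : ∏ i ∈ Finset.univ.erase j, ENNReal.ofReal (M.k p θ (X i) / M.k p M.θs (X i)) =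
      ∏ i ∈ Finset.univ.erase j, ENNReal.ofReal (M.k p θ (Z i) / M.k p M.θs (Z i)) :=
    Finset.prod_congr rfl fun i hi => by rw [hj i (Finset.ne_of_mem_erase hi)]
  unfold lr
  rw [← Finset.mul_prod_erase _ _ (Finset.mem_univ j), ← Finset.mul_prod_erase Finset.univ
    (fun i => ENNReal.ofReal (M.k p θ (Z i) / M.k p M.θs (Z i))) (Finset.mem_univ j), hrest,
    ← mul_assoc]
  gcongr
  rw [← ENNReal.ofReal_mul (Real.exp_pos _).le]
  refine ENNReal.ofReal_le_ofReal ((hup (X j)).trans ?_)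
  have h1 := hlow (Z j)
  rw [show 2 * a = a + a by ring, Real.exp_add]
  nlinarith [Real.exp_pos a]

/-- If both datasets have concentrated posteriors, the privacy inequality holds. -/
lemma privacyIneq_of_concentration (h : M.IsRegular) {p : ℝ} (hp : 0 < p) (hp1 : p ≤ 1) {n : ℕ}
    {X Z : Fin n → 𝒳} {a ψ s c₃ : ℝ} (hc₃ : 0 < c₃)
    (hlip : ∀ θ ∈ M.Ω, ‖θ - M.θs‖ ≤ ψ → ∀ x,
      (1 - p) * |M.f θ x - M.f M.θs x| ≤ a * (p * M.g x))
    (hXZ : ∃ j, ∀ i, i ≠ j → X i = Z i)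
    (hXout : ∫⁻ θ in M.Ω ∩ {θ | ψ < ‖θ - M.θs‖}, M.lr p θ X ∂M.prior ≤
      ENNReal.ofReal (4 * Real.exp (-s)))
    (hZout : ∫⁻ θ in M.Ω ∩ {θ | ψ < ‖θ - M.θs‖}, M.lr p θ Z ∂M.prior ≤
      ENNReal.ofReal (4 * Real.exp (-s)))
    (hX : ENNReal.ofReal (c₃ * Real.exp (-(s / 2))) ≤ ∫⁻ θ in M.Ω, M.lr p θ X ∂M.prior) :
    M.PrivacyIneq p (2 * a + Real.log (4 / c₃ * Real.exp (-(s / 2)) + Real.exp (2 * a)))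
      (4 / c₃ * Real.exp (-(s / 2))) X Z := by
  intro S hS
  have hZX : ∃ j, ∀ i, i ≠ j → Z i = X i := by
    obtain ⟨j, hj⟩ := hXZ
    exact ⟨j, fun i hi => (hj i hi).symm⟩
  set δ := 4 / c₃ * Real.exp (-(s / 2)) with hδ
  have hδ0 : 0 < δ := by positivity
  set F : Set (EuclideanSpace ℝ ι) := {θ | ψ < ‖θ - M.θs‖} with hF
  have hFm : MeasurableSet F :=
    (isOpen_lt continuous_const (continuous_id.sub continuous_const).norm).measurableSet
  have hΩ := h.measurableSet_Ω
  -- F is the set of far parameters. Near it is pointwise comparison that works, far from the truth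
  -- only the smallness of the whole integral.
  have hsplit : ∀ (A : Set (EuclideanSpace ℝ ι)) (Y : Fin n → 𝒳), A ⊆ M.Ω →
      ∫⁻ θ in A, M.lr p θ Y ∂M.prior ≤ ∫⁻ θ in A \ F, M.lr p θ Y ∂M.prior +
        ∫⁻ θ in M.Ω ∩ F, M.lr p θ Y ∂M.prior := by
    intro A Y hA
    refine le_trans (lintegral_mono_set ?_) (lintegral_union_le _ (A \ F) (M.Ω ∩ F))
    intro θ hθ
    by_cases hθF : θ ∈ F
    · exact Or.inr ⟨hA hθ, hθF⟩
    · exact Or.inl ⟨hθ, hθF⟩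
  have hcmp : ∀ (A : Set (EuclideanSpace ℝ ι)) (Y W : Fin n → 𝒳), MeasurableSet A → A ⊆ M.Ω →
      (∃ j, ∀ i, i ≠ j → Y i = W i) → ∫⁻ θ in A \ F, M.lr p θ Y ∂M.prior ≤
        ENNReal.ofReal (Real.exp (2 * a)) * ∫⁻ θ in A, M.lr p θ W ∂M.prior := by
    intro A Y W hAm hA hYW
    calc _ ≤ ∫⁻ θ in A \ F, ENNReal.ofReal (Real.exp (2 * a)) * M.lr p θ W ∂M.prior := by
          refine setLIntegral_mono' (hAm.diff hFm) fun θ hθ => ?_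
          refine h.lr_le_of_neighbours hp hp1 (hA hθ.1) (hlip θ (hA hθ.1) ?_) hYW
          exact not_lt.1 hθ.2
      _ = ENNReal.ofReal (Real.exp (2 * a)) * ∫⁻ θ in A \ F, M.lr p θ W ∂M.prior :=
          lintegral_const_mul' _ _ ENNReal.ofReal_ne_top
      _ ≤ _ := by gcongr; exact sdiff_subset
  set IX := ∫⁻ θ in M.Ω, M.lr p θ X ∂M.prior with hIX
  set IZ := ∫⁻ θ in M.Ω, M.lr p θ Z ∂M.prior with hIZ
  -- The far integral is of order e^{-s} and the evidence at least of order e^{-s/2}; the quotient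
  -- is δ. The evidence of X alone suffices for both datasets.
  have hout : ENNReal.ofReal (4 * Real.exp (-s)) ≤ ENNReal.ofReal δ * IX := by
    calc ENNReal.ofReal (4 * Real.exp (-s))
        = ENNReal.ofReal δ * ENNReal.ofReal (c₃ * Real.exp (-(s / 2))) := by
          rw [← ENNReal.ofReal_mul hδ0.le, hδ]
          congr 1
          rw [show -s = -(s / 2) + -(s / 2) by ring, Real.exp_add]
          field_simp
      _ ≤ _ := by gcongr
  -- Cost of exchanging the two normalizing integrals; its logarithm is the second summand of the
  -- privacy parameter.
  set κ := ENNReal.ofReal δ + ENNReal.ofReal (Real.exp (2 * a)) with hκ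
  have hκ0 : κ ≠ 0 := by
    have := ENNReal.ofReal_pos.2 hδ0
    exact (lt_of_lt_of_le this le_self_add).ne'
  have hκt : κ ≠ ⊤ := ENNReal.add_ne_top.2 ⟨ENNReal.ofReal_ne_top, ENNReal.ofReal_ne_top⟩
  have hZle : IZ ≤ κ * IX := by
    calc IZ ≤ ENNReal.ofReal (Real.exp (2 * a)) * IX + ENNReal.ofReal δ * IX :=
          (hsplit M.Ω Z Subset.rfl).trans
            (add_le_add (hcmp M.Ω Z X hΩ Subset.rfl hZX) (hZout.trans hout))
      _ = _ := by rw [hκ]; ring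
  have hinv : IX⁻¹ ≤ κ * IZ⁻¹ := by
    have h1 := ENNReal.inv_le_inv.2 hZle
    rw [ENNReal.mul_inv (Or.inl hκ0) (Or.inl hκt)] at h1
    calc IX⁻¹ = κ * (κ⁻¹ * IX⁻¹) := by
          rw [← mul_assoc, ENNReal.mul_inv_cancel hκ0 hκt, one_mul]
      _ ≤ _ := by gcongr
  have hSX := (hsplit (S ∩ M.Ω) X inter_subset_right).trans
    (add_le_add (hcmp (S ∩ M.Ω) X Z (hS.inter hΩ) inter_subset_right hXZ) (hXout.trans hout))
  rw [h.posterior_eq hp hp1, h.posterior_eq hp hp1, ← hIX, ← hIZ]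
  set JZ := ∫⁻ θ in S ∩ M.Ω, M.lr p θ Z ∂M.prior
  have hε : ENNReal.ofReal (Real.exp (2 * a + Real.log (δ + Real.exp (2 * a)))) =
      ENNReal.ofReal (Real.exp (2 * a)) * κ := by
    rw [Real.exp_add, Real.exp_log (by positivity), ENNReal.ofReal_mul (Real.exp_pos _).le,
      ENNReal.ofReal_add hδ0.le (Real.exp_pos _).le]
  rw [hε]
  calc _ ≤ (ENNReal.ofReal (Real.exp (2 * a)) * JZ + ENNReal.ofReal δ * IX) / IX := by gcongr
    _ = ENNReal.ofReal (Real.exp (2 * a)) * JZ * IX⁻¹ + ENNReal.ofReal δ * (IX / IX) := by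
        rw [ENNReal.add_div, div_eq_mul_inv, mul_div_assoc]
    _ ≤ ENNReal.ofReal (Real.exp (2 * a)) * JZ * (κ * IZ⁻¹) + ENNReal.ofReal δ * 1 := by
        gcongr; exact ENNReal.div_self_le_one
    _ = _ := by rw [mul_one, div_eq_mul_inv]; ring

end IsRegular

/-- A class whose cells of side `r` have brackets has a bracketing of polynomial size. -/
lemma exists_bracketing_of_cells (M : ContamModel 𝒳 ι) {A : Set (EuclideanSpace ℝ ι)} {r R u : ℝ}
    (hr : 0 < r) (hR : 0 ≤ R) (hAR : ∀ θ ∈ A, ∀ i, |θ i| ≤ R)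
    (hcell : ∀ θ₀ ∈ A, ∃ L U : 𝒳 → ℝ,
      (∀ x, 0 ≤ L x) ∧ Measurable L ∧ Measurable U ∧ Integrable L M.base ∧ Integrable U M.base ∧
      hellinger M.base L U ≤ u ∧
      ∀ θ ∈ A, (∀ i, |θ i - θ₀ i| ≤ r) → ∀ x, L x ≤ M.f θ x ∧ M.f θ x ≤ U x) :
    ∃ B : Finset ((𝒳 → ℝ) × (𝒳 → ℝ)), IsBracketing M.base u (M.f '' A) B ∧
      (∀ b ∈ B, Measurable b.2) ∧ (B.card : ℝ) ≤ (2 * R / r + 2) ^ Fintype.card ι := by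
  classical
  -- Cells are the cubes of the lattice of mesh r; two points of one cube differ by less than r in
  -- each coordinate.
  set cell : EuclideanSpace ℝ ι → ι → ℤ := fun θ i => ⌊θ i / r⌋ with hcelldef
  set K : Finset (ι → ℤ) := Fintype.piFinset fun _ => Finset.Icc ⌊-R / r⌋ ⌊R / r⌋ with hK
  have hmem : ∀ θ ∈ A, cell θ ∈ K := fun θ hθ => by
    rw [hK, Fintype.mem_piFinset]
    intro i
    have := abs_le.1 (hAR θ hθ i)
    rw [Finset.mem_Icc]
    exact ⟨Int.floor_le_floor (by gcongr; exact this.1),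
      Int.floor_le_floor (by gcongr; exact this.2)⟩
  -- Brackets are attached only to cubes that meet A, and are centred at a point of A in the cube,
  -- where `hcell` applies.
  have hbr : ∀ k : {k // ∃ θ ∈ A, cell θ = k}, ∃ b : (𝒳 → ℝ) × (𝒳 → ℝ),
      ((∀ x, 0 ≤ b.1 x) ∧ (∀ x, 0 ≤ b.2 x) ∧ Integrable b.1 M.base ∧ Integrable b.2 M.base ∧
        hellinger M.base b.1 b.2 ≤ u) ∧ Measurable b.2 ∧
      ∀ θ ∈ A, cell θ = k → ∀ x, b.1 x ≤ M.f θ x ∧ M.f θ x ≤ b.2 x := by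
    rintro ⟨k, θ₀, hθ₀, rfl⟩
    obtain ⟨L, U, h1, h2, h3, h4, h5, h6, h7⟩ := hcell θ₀ hθ₀
    have h8 := h7 θ₀ hθ₀ (fun i => by simpa using hr.le)
    refine ⟨(L, U), ⟨h1, fun x => ((h1 x).trans (h8 x).1).trans (h8 x).2, h4, h5, h6⟩, h3,
      fun θ hθ hc => h7 θ hθ fun i => ?_⟩
    have h9 : ⌊θ i / r⌋ = ⌊θ₀ i / r⌋ := congrFun hc i
    have h10 := Int.abs_sub_lt_one_of_floor_eq_floor h9
    rw [← sub_div, abs_div, abs_of_pos hr, div_lt_one hr] at h10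
    exact h10.le
  choose b hb hbm hbc using hbr
  set K' := K.subtype fun k => ∃ θ ∈ A, cell θ = k with hK'
  refine ⟨K'.image b, ⟨?_, ?_⟩, ?_, ?_⟩
  · intro b' hb'
    obtain ⟨k, _, rfl⟩ := Finset.mem_image.1 hb'
    exact hb _
  · rintro _ ⟨θ, hθ, rfl⟩
    exact ⟨_, Finset.mem_image.2 ⟨⟨cell θ, θ, hθ, rfl⟩, Finset.mem_subtype.2 (hmem θ hθ), rfl⟩,
      hbc _ θ hθ rfl⟩
  · intro b' hb'
    obtain ⟨k, _, rfl⟩ := Finset.mem_image.1 hb'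
    exact hbm _
  · have h1 : (K'.image b).card ≤ K.card := Finset.card_image_le.trans (by
      rw [hK', Finset.card_subtype]; exact Finset.card_le_card (Finset.filter_subset _ _))
    have h2 : (K.card : ℝ) ≤ (2 * R / r + 2) ^ Fintype.card ι := by
      rw [hK, Fintype.card_piFinset, Finset.prod_const, Finset.card_univ, Nat.cast_pow]
      refine pow_le_pow_left₀ (Nat.cast_nonneg _) ?_ _
      rw [Int.card_Icc]
      have h3 := Int.floor_le (R / r)
      have h4 := Int.lt_floor_add_one (-R / r)
      have h5 : -R / r = -(R / r) := by ring
      have h6 : 0 ≤ R / r := by positivity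
      have h7 : ((⌊R / r⌋ + 1 - ⌊-R / r⌋ : ℤ) : ℝ) ≤ 2 * R / r + 2 := by
        push_cast
        rw [h5] at h4 ⊢
        have : 2 * R / r = 2 * (R / r) := by ring
        linarith
      have h8 : (0 : ℝ) ≤ 2 * R / r + 2 := by positivity
      rcases le_total 0 (⌊R / r⌋ + 1 - ⌊-R / r⌋) with h9 | h9
      · calc (((⌊R / r⌋ + 1 - ⌊-R / r⌋).toNat : ℕ) : ℝ)
            = (((⌊R / r⌋ + 1 - ⌊-R / r⌋).toNat : ℤ) : ℝ) := by norm_cast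
          _ = ((⌊R / r⌋ + 1 - ⌊-R / r⌋ : ℤ) : ℝ) := by rw [Int.toNat_of_nonneg h9]
          _ ≤ _ := h7
      · rw [Int.toNat_of_nonpos h9]; simpa using h8
    exact (Nat.cast_le.2 h1).trans h2

/-- Bracketing entropy is decreasing in the bracket size. -/
lemma bracketingEntropy_le_of_isBracketing {μ : Measure 𝒳} {u v K : ℝ} {F : Set (𝒳 → ℝ)}
    {B : Finset ((𝒳 → ℝ) × (𝒳 → ℝ))} (hB : IsBracketing μ u F B) (huv : u ≤ v)
    (hK : (B.card : ℝ) ≤ Real.exp K) (hK0 : 0 ≤ K) :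
    bracketingEntropy μ v F ≤ ENNReal.ofReal K := by
  have hBv : IsBracketing μ v F B :=
    ⟨fun b hb => ⟨(hB.1 b hb).1, (hB.1 b hb).2.1, (hB.1 b hb).2.2.1, (hB.1 b hb).2.2.2.1,
      (hB.1 b hb).2.2.2.2.trans huv⟩, hB.2⟩
  have h1 : bracketingNumber μ v F ≤ (B.card : ℕ∞) := iInf₂_le B hBv
  have h2 : bracketingNumber μ v F ≠ ⊤ := ne_top_of_le_ne_top (ENat.natCast_ne_top _) h1
  rw [bracketingEntropy, if_neg h2]
  refine ENNReal.ofReal_le_ofReal ?_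
  have h3 : (bracketingNumber μ v F).toNat ≤ B.card := ENat.toNat_le_of_le_natCast h1
  -- A class with bracketing number zero has entropy zero because `Real.log 0 = 0`.
  rcases Nat.eq_zero_or_pos (bracketingNumber μ v F).toNat with h0 | h0
  · rw [h0]; simpa using hK0
  · rw [Real.log_le_iff_le_exp (by exact_mod_cast h0)]
    exact (Nat.cast_le.2 h3).trans hK

end ContamModel

/-! ### Rates -/

section Rates

variable {q : ℝ}

lemma rate_pos (q : ℝ) {n : ℕ} (hn : 1 ≤ n) : 0 < (n : ℝ) ^ (-(1 / q)) :=
  Real.rpow_pos_of_pos (by exact_mod_cast hn) _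

lemma tendsto_rate (hq : 0 < q) : Tendsto (fun n : ℕ => (n : ℝ) ^ (-(1 / q))) atTop (𝓝 0) :=
  (tendsto_rpow_neg_atTop (by positivity)).comp tendsto_natCast_atTop_atTop

lemma nat_mul_rate_sq (q : ℝ) {n : ℕ} (hn : 1 ≤ n) :
    (n : ℝ) * ((n : ℝ) ^ (-(1 / q))) ^ 2 = (n : ℝ) ^ (1 - 2 / q) := by
  have h0 : (0 : ℝ) < n := by exact_mod_cast hn
  rw [← Real.rpow_natCast, ← Real.rpow_mul h0.le]
  nth_rw 1 [← Real.rpow_one (n : ℝ)]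
  rw [← Real.rpow_add h0]
  congr 1; push_cast; ring

/-- The essential use of q > 4: φ_n^{-4} ≤ n, so the inverse cell side is polynomial in n apart from
the boundary factor. -/
lemma one_le_nat_mul_rate_pow_four (hq : 4 < q) {n : ℕ} (hn : 1 ≤ n) :
    1 ≤ (n : ℝ) * ((n : ℝ) ^ (-(1 / q))) ^ 4 := by
  have h0 : (0 : ℝ) < n := by exact_mod_cast hn
  rw [← Real.rpow_natCast, ← Real.rpow_mul h0.le]
  nth_rw 1 [← Real.rpow_one (n : ℝ)]
  rw [← Real.rpow_add h0]
  refine Real.one_le_rpow (by exact_mod_cast hn) ?_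
  have : 4 / q < 1 := (div_lt_one (by linarith)).2 hq
  push_cast
  have e : 1 + -(1 / q) * 4 = 1 - 4 / q := by ring
  linarith

/-- Powers of n are negligible against the exponential of any positive multiple of n φ_n²; K is
arbitrary so that constants can be absorbed at the same time. -/
lemma eventually_log_le (hq : 4 < q) (K : ℝ) :
    ∀ᶠ n : ℕ in atTop, K * Real.log n + K ≤ (n : ℝ) * ((n : ℝ) ^ (-(1 / q))) ^ 2 := by
  have hs : 0 < 1 - 2 / q := by
    have : 2 / q < 1 := (div_lt_one (by linarith)).2 (by linarith)
    linarith
  have h1 := (isLittleO_log_rpow_atTop hs).bound (c := 1 / (2 * (|K| + 1))) (by positivity)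
  have h2 := (tendsto_rpow_atTop hs).eventually_ge_atTop (2 * |K|)
  filter_upwards [tendsto_natCast_atTop_atTop.eventually h1,
    tendsto_natCast_atTop_atTop.eventually h2, eventually_ge_atTop 1] with n hn1 hn2 hn
  rw [nat_mul_rate_sq q hn]
  set y := (n : ℝ) ^ (1 - 2 / q)
  have hy : 0 ≤ y := Real.rpow_nonneg (Nat.cast_nonneg _) _
  have hl : 0 ≤ Real.log n := Real.log_nonneg (by exact_mod_cast hn)
  rw [Real.norm_of_nonneg hl, Real.norm_of_nonneg hy] at hn1
  have h3 : |K| * Real.log n ≤ y / 2 := by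
    calc |K| * Real.log n ≤ (|K| + 1) * (1 / (2 * (|K| + 1)) * y) := by gcongr; linarith
      _ = y / 2 := by field_simp
  have h4 : K * Real.log n ≤ |K| * Real.log n := by gcongr; exact le_abs_self K
  linarith [le_abs_self K]

end Rates

/-! ### Separation, differentiability and concentration in regular models -/

namespace ContamModel

variable {𝒳 : Type} [MeasurableSpace 𝒳] {ι : Type} [Fintype ι]

namespace IsRegular

variable {M : ContamModel 𝒳 ι}

/-- Contaminated densities are separated from the truth in Hellinger distance. -/
lemma exists_hellinger_ge (h : M.IsRegular) : ∃ c₀ > 0, ∀ p, 0 ≤ p → p ≤ 1 / 2 → ∀ θ ∈ M.Ω,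
    c₀ * min ‖θ - M.θs‖ 1 ^ 2 ≤ hellinger M.base (M.k p θ) (M.k p M.θs) ^ 2 := by
  obtain ⟨c, hc, hsep⟩ := h.separation
  -- With p ≤ 1/2 contamination at most halves the total variation; squaring gives c²/4, and the
  -- comparison with Hellinger distance costs the factor 8.
  refine ⟨c ^ 2 / 32, by positivity, fun p hp0 hp1 θ hθ => ?_⟩
  have hk : ∀ θ ∈ M.Ω, ∀ x, 0 ≤ M.k p θ x := fun θ hθ x =>
    add_nonneg (mul_nonneg (by linarith) (h.f_pos θ hθ x).le)
      (mul_nonneg hp0 (h.contamination.pos x).le)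
  have h1 := sq_integral_abs_sub_le (h.integrable_k p hθ) (h.integrable_k p h.θs_mem) (hk θ hθ)
    (hk _ h.θs_mem) (h.integral_k p hθ) (h.integral_k p h.θs_mem)
  have h2 : ∫ x, |M.k p θ x - M.k p M.θs x| ∂M.base =
      (1 - p) * ∫ x, |M.f θ x - M.f M.θs x| ∂M.base := by
    rw [← integral_const_mul]
    refine integral_congr_ae (ae_of_all _ fun x => ?_)
    simp only [k]
    rw [← abs_of_nonneg (show 0 ≤ 1 - p by linarith), ← abs_mul,
      abs_of_nonneg (show 0 ≤ 1 - p by linarith)]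
    congr 1; ring
  rw [h2] at h1
  have h3 := hsep θ hθ
  have h4 : 0 ≤ min ‖θ - M.θs‖ 1 := le_min (norm_nonneg _) zero_le_one
  have h5 : 0 ≤ c * min ‖θ - M.θs‖ 1 := by positivity
  have h6 : 1 / 2 * (c * min ‖θ - M.θs‖ 1) ≤ (1 - p) * ∫ x, |M.f θ x - M.f M.θs x| ∂M.base :=
    mul_le_mul (by linarith) h3 h5 (by linarith)
  have h7 := pow_le_pow_left₀ (by positivity) h6 2
  nlinarith

/-- Directional derivatives inherit the local Lipschitz bounds, both the uniform one and the one
proportional to g. -/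
lemma ratioAssumption (h : M.IsRegular) : M.RatioAssumption := by
  intro θ hθ
  obtain ⟨r, hr, T, hT, B, hB⟩ := h.exists_lipschitz hθ
  have hmove : ∀ u : EuclideanSpace ℝ ι, ‖u‖ = 1 → ∀ ξ : ℝ, 0 ≤ ξ → ‖θ + ξ • u - θ‖ = ξ := by
    intro u hu ξ hξ
    rw [add_sub_cancel_left, norm_smul, hu, mul_one, Real.norm_of_nonneg hξ]
  have hg : ∀ x, ∀ u : EuclideanSpace ℝ ι, ‖u‖ = 1 → |M.dirDeriv θ x u| ≤ T * M.g x := by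
    intro x u hu
    refine abs_derivWithin_Ici_le hr (h.differentiable θ hθ x u hu) fun ξ h0 h1 => ?_
    have h2 := ((hB (θ + ξ • u) (by rw [hmove u hu ξ h0]; exact h1)).2 x).1
    rw [hmove u hu ξ h0] at h2
    simpa using h2
  refine ⟨h.differentiable θ hθ, ⟨B, fun x u hu => ?_⟩, T, fun x => ?_⟩
  · refine abs_derivWithin_Ici_le hr (h.differentiable θ hθ x u hu) fun ξ h0 h1 => ?_
    have h2 := ((hB (θ + ξ • u) (by rw [hmove u hu ξ h0]; exact h1)).2 x).2.1
    rw [hmove u hu ξ h0] at h2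
    simpa using h2
  · have hgx := h.contamination.pos x
    rw [abs_div, abs_of_pos hgx, div_le_iff₀ hgx]
    have hall : ∀ u : Metric.sphere (0 : EuclideanSpace ℝ ι) 1,
        |M.dirDeriv θ x u| ≤ T * M.g x := fun u => hg x u (by simp)
    -- With no coordinates the unit sphere is empty and the supremum is zero by convention.
    -- Otherwise its lower bound comes from any single direction.
    unfold supDirDeriv
    rcases isEmpty_or_nonempty (Metric.sphere (0 : EuclideanSpace ℝ ι) 1) with he | ⟨⟨u₀⟩⟩
    · rw [Real.iSup_of_isEmpty, abs_zero]; positivity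
    · have : Nonempty (Metric.sphere (0 : EuclideanSpace ℝ ι) 1) := ⟨u₀⟩
      rw [abs_le]
      refine ⟨?_, ciSup_le fun u => (abs_le.1 (hall u)).2⟩
      refine (abs_le.1 (hall u₀)).1.trans (le_ciSup (f := fun u :
        Metric.sphere (0 : EuclideanSpace ℝ ι) 1 => M.dirDeriv θ x u) ⟨T * M.g x, ?_⟩ u₀)
      rintro _ ⟨u, rfl⟩
      exact (abs_le.1 (hall u)).2

/-- The separation bound at contamination level p = 0. -/
lemma identifiabilityAssumption (h : M.IsRegular) : M.IdentifiabilityAssumption := by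
  intro ψ hψ
  obtain ⟨c, hc, hsep⟩ := h.exists_hellinger_ge
  have hm : 0 < min ψ 1 := lt_min hψ one_pos
  refine ⟨√(c * min ψ 1 ^ 2), Real.sqrt_pos.2 (by positivity), fun θ hθ hlt => ?_⟩
  refine Real.sqrt_le_iff.2 ⟨hellinger_nonneg _ _, ?_⟩
  have h1 := hsep 0 le_rfl (by norm_num) θ hθ
  have e : ∀ θ, M.k 0 θ = M.f θ := fun θ => by ext x; simp [k]
  rw [e, e] at h1
  refine le_trans ?_ h1
  gcongr

/-- Balls around the truth lie in the chi-square neighbourhoods. -/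
lemma closedBall_subset_rhoNhd (h : M.IsRegular) {r T B t : ℝ} (hT : 0 < T)
    (hlip : ∀ θ', ‖θ' - M.θs‖ ≤ r → θ' ∈ M.Ω ∧ ∀ x,
      |M.f θ' x - M.f M.θs x| ≤ ‖θ' - M.θs‖ * (T * M.g x) ∧
      |M.f θ' x - M.f M.θs x| ≤ ‖θ' - M.θs‖ * B ∧
      |(M.f M.θs x / M.f θ' x - 1) * M.f M.θs x| ≤ ‖θ' - M.θs‖ * (T * M.g x)) (htr : t / T ≤ r) :
    Metric.closedBall M.θs (t / T) ⊆ M.rhoNhd 1 t := by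
  intro θ hθ
  rw [mem_closedBall_iff_norm] at hθ
  obtain ⟨hΩ, hx⟩ := hlip θ (hθ.trans htr)
  have hgi := h.integrable_g
  have hbd : ∀ x, |M.rhoIntegrand 1 θ x| ≤ ‖θ - M.θs‖ * (T * M.g x) := fun x => by
    simp only [rhoIntegrand, Real.rpow_one]; exact (hx x).2.2
  have hm : Measurable (M.rhoIntegrand 1 θ) := by
    have h1 := h.measurable_f_right θ
    have h2 := h.measurable_f_right M.θs
    have : M.rhoIntegrand 1 θ = fun x => (M.f M.θs x / M.f θ x - 1) * M.f M.θs x := by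
      ext x; simp [rhoIntegrand]
    rw [this]
    exact ((h2.div h1).sub_const 1).mul h2
  have hi : Integrable (M.rhoIntegrand 1 θ) M.base :=
    ((hgi.const_mul T).const_mul ‖θ - M.θs‖).mono' hm.aestronglyMeasurable
      (ae_of_all _ fun x => hbd x)
  refine ⟨hΩ, hi, ?_⟩
  have h1 : ∫ x, M.rhoIntegrand 1 θ x ∂M.base ≤ ∫ x, ‖θ - M.θs‖ * (T * M.g x) ∂M.base :=
    integral_mono hi ((hgi.const_mul T).const_mul _) fun x => (le_abs_self _).trans (hbd x)
  rw [integral_const_mul, integral_const_mul, h.integral_g, mul_one] at h1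
  rw [div_one, one_mul]
  refine h1.trans ?_
  calc ‖θ - M.θs‖ * T ≤ t / T * T := by gcongr
    _ = t := by field_simp

/-- Outside an event of small probability, the posterior is concentrated near the truth. -/
lemma measure_not_concentrated_le (h : M.IsRegular) {p : ℝ} (hp : 0 < p) (hp1 : p ≤ 1) (n : ℕ)
    {s t u η ψ c₃ : ℝ} (hu : 0 < u) (ht : 0 ≤ t) (hst : 4 * (n * t) = s / 2)
    {A S : Set (EuclideanSpace ℝ ι)} (hA : MeasurableSet A) (hAΩ : A ⊆ M.Ω)
    (hS : MeasurableSet S) (hSt : S ⊆ M.rhoNhd 1 t)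
    (hπ : ENNReal.ofReal (c₃ * Real.exp (-(2 * n * t))) ≤ M.prior S)
    {B : Finset ((𝒳 → ℝ) × (𝒳 → ℝ))} (hB : IsBracketing M.base u (M.f '' A) B)
    (hBm : ∀ b ∈ B, Measurable b.2)
    (hη : ∀ θ ∈ M.Ω, ψ < ‖θ - M.θs‖ → η ≤ hellinger M.base (M.k p θ) (M.k p M.θs) ^ 2) :
    (Measure.pi fun _ : Fin n => M.dataLaw p)
      {X | ¬ (∫⁻ θ in M.Ω ∩ {θ | ψ < ‖θ - M.θs‖}, M.lr p θ X ∂M.prior ≤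
          ENNReal.ofReal (4 * Real.exp (-s)) ∧
        ENNReal.ofReal (c₃ * Real.exp (-(s / 2))) ≤ ∫⁻ θ in M.Ω, M.lr p θ X ∂M.prior)} ≤
      ENNReal.ofReal (B.card * Real.exp (s / 2 - n * (η - 3 / 2 * u))) +
        ENNReal.ofReal (Real.exp s) * M.prior (M.Ω \ A) + ENNReal.ofReal (Real.exp (-(n * t))) := by
  set F : Set (EuclideanSpace ℝ ι) := {θ | ψ < ‖θ - M.θs‖} with hF
  have hFm : MeasurableSet F :=
    (isOpen_lt continuous_const (continuous_id.sub continuous_const).norm).measurableSet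
  -- The same brackets cover the smaller class of far sieve elements, so no new count is needed.
  have hB' : IsBracketing M.base u (M.f '' (A ∩ F)) B :=
    ⟨hB.1, fun f hf => hB.2 f (image_mono inter_subset_left hf)⟩
  have e1 := h.measure_sieve_le hp hp1 n (s := s) hu (hA.inter hFm)
    (inter_subset_left.trans hAΩ) hB' hBm (fun θ hθ => hη θ (hAΩ hθ.1) hθ.2)
  have e2 := h.measure_tail_le hp hp1 n (s := s) (h.measurableSet_Ω.diff hA) sdiff_subset
  have e3 := h.measure_centre_le hp hp1 n ht hS hSt
  refine le_trans (measure_mono ?_) ((measure_union_le _ _).trans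
    (add_le_add ((measure_union_le _ _).trans (add_le_add e1 e2)) e3))
  intro X hX
  by_contra hno
  simp only [mem_union, mem_ofPred_eq, not_or, not_lt] at hno hX
  obtain ⟨⟨h1, h2⟩, h3⟩ := hno
  refine hX ⟨?_, ?_⟩
  -- Far parameters lie in the sieve or outside it; each part contributes at most e^{-s}.
  · calc _ ≤ ∫⁻ θ in (A ∩ F) ∪ (M.Ω \ A), M.lr p θ X ∂M.prior := by
          refine lintegral_mono_set fun θ hθ => ?_
          by_cases hθA : θ ∈ A
          · exact Or.inl ⟨hθA, hθ.2⟩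
          · exact Or.inr ⟨hθ.1, hθA⟩
      _ ≤ _ := (lintegral_union_le _ _ _).trans (add_le_add h1 h2)
      _ ≤ _ := by
          rw [← ENNReal.ofReal_add (Real.exp_pos _).le (Real.exp_pos _).le]
          exact ENNReal.ofReal_le_ofReal (by linarith [Real.exp_pos (-s)])
  -- Since s/2 = 4nt, the exponent splits evenly between the event and the prior mass of the
  -- neighbourhood.
  · calc ENNReal.ofReal (c₃ * Real.exp (-(s / 2)))
        = ENNReal.ofReal (Real.exp (-(2 * n * t))) *
          ENNReal.ofReal (c₃ * Real.exp (-(2 * n * t))) := by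
          rw [← ENNReal.ofReal_mul (Real.exp_pos _).le, mul_left_comm, ← Real.exp_add]
          congr 3; linarith
      _ ≤ ENNReal.ofReal (Real.exp (-(2 * n * t))) * M.prior S := by gcongr
      _ ≤ _ := h3
      _ ≤ _ := lintegral_mono_set fun θ hθ => (hSt hθ).1

end IsRegular
end ContamModel

/-! ### Privacy rates, entropy of the sieves and the main theorem for regular models -/

namespace ContamModel

variable {𝒳 : Type} [MeasurableSpace 𝒳] {ι : Type} [Fintype ι]

/-- As φ = p², the first summand e is at most 2TC p. Moreover log(δ + e^e) ≤ e + δ, and δ, being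
exponentially small, is at most of order 1/n ≤ p. -/
lemma privEps_isBigO {q C T c₁ c₃ : ℝ} (hq : 4 < q) (hC : 0 < C) (hT : 0 < T) (hc₁ : 0 < c₁)
    (hc₃ : 0 < c₃) :
    privEps (fun n => (n : ℝ) ^ (-(1 / (2 * q)))) (fun n => (n : ℝ) ^ (-(1 / q)))
      (fun n => C * (n : ℝ) ^ (-(1 / q))) T c₁ c₃ =O[atTop]
      (fun n : ℕ => (n : ℝ) ^ (-(1 / (2 * q)))) := by
  refine IsBigO.of_bound (4 * T * C + 4 / c₃) ?_
  filter_upwards [eventually_log_le hq (2 / c₁), eventually_ge_atTop 1] with n hlog hn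
  have hn0 : (0 : ℝ) < n := by exact_mod_cast hn
  have hn1 : (1 : ℝ) ≤ n := by exact_mod_cast hn
  set φ := (n : ℝ) ^ (-(1 / q)) with hφ
  set p := (n : ℝ) ^ (-(1 / (2 * q))) with hp
  have hp0 : 0 < p := Real.rpow_pos_of_pos hn0 _
  have hp1 : p ≤ 1 := Real.rpow_le_one_of_one_le_of_nonpos hn1 (by
    have : 0 < 1 / (2 * q) := by positivity
    linarith)
  have hpp : φ = p * p := by
    rw [hφ, hp, ← Real.rpow_add hn0]; congr 1; field_simp; ring
  have hnp : (n : ℝ)⁻¹ ≤ p := by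
    rw [← Real.rpow_neg_one]
    refine Real.rpow_le_rpow_of_exponent_le hn1 ?_
    have : 1 / (2 * q) ≤ 1 := by rw [div_le_one (by linarith)]; linarith
    linarith
  set e := preEps (fun n => (n : ℝ) ^ (-(1 / (2 * q)))) (fun n => C * (n : ℝ) ^ (-(1 / q))) T n
    with he
  set δ := privDelta (fun n => (n : ℝ) ^ (-(1 / q))) c₁ c₃ n with hδ
  have he1 : e = 2 * (1 - p) * T * C * p := by
    rw [he]; unfold preEps
    change 2 * (1 - p) * T * (C * φ) / p = _
    rw [hpp]; field_simp
  have he0 : 0 ≤ e := by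
    rw [he1]
    have : 0 ≤ 1 - p := by linarith
    positivity
  have he2 : e ≤ 2 * T * C * p := by
    rw [he1]
    have : 0 ≤ T * C * p * p := by positivity
    nlinarith
  have hδ0 : 0 < δ := by rw [hδ]; unfold privDelta; positivity
  have hδ1 : δ ≤ 4 / c₃ * p := by
    rw [hδ]; unfold privDelta
    refine mul_le_mul_of_nonneg_left ?_ (by positivity)
    refine le_trans ?_ hnp
    rw [← Real.exp_log hn0, ← Real.exp_neg, Real.exp_log hn0]
    refine Real.exp_le_exp.2 (neg_le_neg ?_)
    have h1 := mul_le_mul_of_nonneg_left hlog (show 0 ≤ 1 / 2 * c₁ by positivity)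
    have h2 : 1 / 2 * c₁ * (2 / c₁ * Real.log n + 2 / c₁) = Real.log n + 1 := by field_simp
    rw [h2] at h1
    nlinarith
  have hlog1 : Real.log (δ + Real.exp e) ≤ e + δ := by
    rw [Real.log_le_iff_le_exp (by positivity), Real.exp_add]
    have h1 := Real.add_one_le_exp δ
    have h2 := Real.one_le_exp he0
    nlinarith
  have hlog0 : 0 ≤ Real.log (δ + Real.exp e) :=
    Real.log_nonneg (by linarith [Real.one_le_exp he0])
  change ‖e + Real.log (δ + Real.exp e)‖ ≤ (4 * T * C + 4 / c₃) * ‖p‖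
  rw [Real.norm_of_nonneg (by positivity), Real.norm_of_nonneg hp0.le]
  linarith

lemma privDelta_isBigO (q c₁ c₃ : ℝ) :
    privDelta (fun n => (n : ℝ) ^ (-(1 / q))) c₁ c₃ =O[atTop]
      (fun n : ℕ => Real.exp (-(1 / 2 * c₁ * (n : ℝ) ^ (1 - 2 / q)))) := by
  refine IsBigO.of_bound |4 / c₃| ?_
  filter_upwards [eventually_ge_atTop 1] with n hn
  unfold privDelta
  rw [norm_mul, Real.norm_eq_abs, ← nat_mul_rate_sq q hn, mul_assoc (1 / 2 * c₁)]

namespace IsRegular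

variable {M : ContamModel 𝒳 ι}

/-- A neighbouring pair violates the privacy inequality with at most twice the probability that a
single dataset fails to have a concentrated posterior. -/
lemma measure_not_privacyIneq_le (h : M.IsRegular) {p : ℝ} (hp : 0 < p) (hp1 : p ≤ 1) {n : ℕ}
    {a ψ s c₃ b : ℝ} (hc₃ : 0 < c₃)
    (hlip : ∀ θ ∈ M.Ω, ‖θ - M.θs‖ ≤ ψ → ∀ x,
      (1 - p) * |M.f θ x - M.f M.θs x| ≤ a * (p * M.g x))
    (hbad : (Measure.pi fun _ : Fin n => M.dataLaw p)
      {X | ¬ (∫⁻ θ in M.Ω ∩ {θ | ψ < ‖θ - M.θs‖}, M.lr p θ X ∂M.prior ≤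
          ENNReal.ofReal (4 * Real.exp (-s)) ∧
        ENNReal.ofReal (c₃ * Real.exp (-(s / 2))) ≤ ∫⁻ θ in M.Ω, M.lr p θ X ∂M.prior)} ≤
      ENNReal.ofReal b) (hb : 0 ≤ b)
    {Q : Measure ((Fin n → 𝒳) × (Fin n → 𝒳))} (hQ : IsNeighbouringLaw (M.dataLaw p) n Q) :
    Q {z | ¬ M.PrivacyIneq p
      (2 * a + Real.log (4 / c₃ * Real.exp (-(s / 2)) + Real.exp (2 * a)))
      (4 / c₃ * Real.exp (-(s / 2))) z.1 z.2} ≤ ENNReal.ofReal (2 * b) := by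
  set bad : Set (Fin n → 𝒳) :=
    {X | ¬ (∫⁻ θ in M.Ω ∩ {θ | ψ < ‖θ - M.θs‖}, M.lr p θ X ∂M.prior ≤
          ENNReal.ofReal (4 * Real.exp (-s)) ∧
        ENNReal.ofReal (c₃ * Real.exp (-(s / 2))) ≤ ∫⁻ θ in M.Ω, M.lr p θ X ∂M.prior)} with hbd
  have h1 : Q (Prod.fst ⁻¹' bad) ≤ ENNReal.ofReal b :=
    -- For an outer measure this inequality holds for arbitrary sets, so measurability of the bad
    -- event is not required.
    (Measure.le_map_apply measurable_fst.aemeasurable _).trans (by rw [hQ.map_fst]; exact hbad)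
  have h2 : Q (Prod.snd ⁻¹' bad) ≤ ENNReal.ofReal b :=
    (Measure.le_map_apply measurable_snd.aemeasurable _).trans (by rw [hQ.map_snd]; exact hbad)
  have h3 : Q {z | ¬ ∃ j, ∀ i, i ≠ j → z.1 i = z.2 i} = 0 := ae_iff.1 hQ.neighbours
  have hsub : {z : (Fin n → 𝒳) × (Fin n → 𝒳) | ¬ M.PrivacyIneq p
      (2 * a + Real.log (4 / c₃ * Real.exp (-(s / 2)) + Real.exp (2 * a)))
      (4 / c₃ * Real.exp (-(s / 2))) z.1 z.2} ⊆
      (Prod.fst ⁻¹' bad ∪ Prod.snd ⁻¹' bad) ∪ {z | ¬ ∃ j, ∀ i, i ≠ j → z.1 i = z.2 i} := by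
    intro z hz
    by_contra hno
    simp only [hbd, mem_union, mem_preimage, mem_ofPred_eq, not_or, not_not] at hno hz
    exact hz (h.privacyIneq_of_concentration hp hp1 hc₃ hlip hno.2 hno.1.1.1 hno.1.2.1 hno.1.1.2)
  calc _ ≤ _ := measure_mono hsub
    _ ≤ (Q (Prod.fst ⁻¹' bad) + Q (Prod.snd ⁻¹' bad)) + 0 :=
        (measure_union_le _ _).trans (add_le_add (measure_union_le _ _) h3.le)
    _ ≤ (ENNReal.ofReal b + ENNReal.ofReal b) + 0 := by gcongr
    _ = _ := by rw [add_zero, ← ENNReal.ofReal_add hb hb]; congr 1; ring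

/-- Per coordinate there are about 2n/(κ u² ε) cells. The factor 1/ε is e^{2 c₁ x} with x = n φ²;
the rest is at most K n² and fits into e^{c₁ x}. This is the source of the constant 3. -/
lemma eventually_exists_bracketing {V : ℝ → Set (EuclideanSpace ℝ ι)} {κ q c₁ : ℝ} (hκ : 0 < κ)
    (hq : 4 < q) (hc₁ : 0 < c₁) (hV : ∀ ε > 0, V ε ⊆ M.Ω)
    (hcell : ∀ ε u : ℝ, 0 < ε → ε ≤ 1 → 0 < u → u ≤ 1 → ∀ θ₀ ∈ V ε, ∃ L U : 𝒳 → ℝ,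
      (∀ x, 0 ≤ L x) ∧ Measurable L ∧ Measurable U ∧ Integrable L M.base ∧ Integrable U M.base ∧
      hellinger M.base L U ≤ u ∧
      ∀ θ ∈ M.Ω, (∀ i, |θ i - θ₀ i| ≤ κ * u ^ 2 * ε) → ∀ x, L x ≤ M.f θ x ∧ M.f θ x ≤ U x) :
    ∀ᶠ n : ℕ in atTop, ∃ B : Finset ((𝒳 → ℝ) × (𝒳 → ℝ)),
      IsBracketing M.base (((n : ℝ) ^ (-(1 / q))) ^ 2 / 2 ^ 10)
        (M.f '' (V (Real.exp (-(2 * c₁ * (n : ℝ) ^ (1 - 2 / q)))) ∩ {θ | ∀ i, |θ i| ≤ n})) B ∧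
      (∀ b ∈ B, Measurable b.2) ∧
      (B.card : ℝ) ≤ Real.exp (3 * Fintype.card ι * c₁ * (n * ((n : ℝ) ^ (-(1 / q))) ^ 2)) := by
  -- 2^21 is 2 · (2^10)²: the factor 2 from the width of the box, the square from u². The summand 2
  -- pays for the boundary cells.
  set K : ℝ := 2 ^ 21 / κ + 2 with hK
  have hK1 : 1 ≤ K := by
    have : 0 < 2 ^ 21 / κ := by positivity
    linarith
  have hlK : 0 ≤ Real.log K := Real.log_nonneg hK1
  filter_upwards [eventually_log_le hq ((2 + Real.log K) / c₁), eventually_ge_atTop 1,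
    (tendsto_rate (q := q) (by linarith)).eventually_le_const one_pos] with n hlog hn hφ1
  have hn0 : (0 : ℝ) < n := by exact_mod_cast hn
  have hn1 : (1 : ℝ) ≤ n := by exact_mod_cast hn
  have hφ0 := rate_pos q hn
  have h4 := one_le_nat_mul_rate_pow_four hq hn
  rw [← nat_mul_rate_sq q hn]
  set φ := (n : ℝ) ^ (-(1 / q)) with hφ
  set x := (n : ℝ) * φ ^ 2 with hx
  have hx0 : 0 < x := by positivity
  set ε := Real.exp (-(2 * c₁ * x)) with hε
  have hε0 : 0 < ε := Real.exp_pos _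
  have hε1 : ε ≤ 1 := Real.exp_le_one_iff.2 (neg_nonpos.2 (by positivity))
  have hu0 : 0 < φ ^ 2 / 2 ^ 10 := by positivity
  have hu1 : φ ^ 2 / 2 ^ 10 ≤ 1 := by
    rw [div_le_one (by norm_num)]; nlinarith
  set u := φ ^ 2 / 2 ^ 10 with hu
  obtain ⟨B, hB, hBm, hBc⟩ := M.exists_bracketing_of_cells
    (A := V ε ∩ {θ | ∀ i, |θ i| ≤ n}) (r := κ * u ^ 2 * ε) (R := n) (u := u) (by positivity)
    hn0.le (fun θ hθ => hθ.2) (fun θ₀ hθ₀ => by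
      obtain ⟨L, U, h1, h2, h3, h4, h5, h6, h7⟩ := hcell ε u hε0 hε1 hu0 hu1 θ₀ hθ₀.1
      exact ⟨L, U, h1, h2, h3, h4, h5, h6, fun θ hθ => h7 θ (hV ε hε0 hθ.1)⟩)
  refine ⟨B, hB, hBm, hBc.trans ?_⟩
  have hbase : 2 * (n : ℝ) / (κ * u ^ 2 * ε) + 2 ≤ Real.exp (3 * c₁ * x) := by
    have e1 : 2 * (n : ℝ) / (κ * u ^ 2 * ε) = 2 ^ 21 / κ * (n / φ ^ 4) * Real.exp (2 * c₁ * x) := by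
      rw [hu, hε, Real.exp_neg]; field_simp
    have e2 : n / φ ^ 4 ≤ (n : ℝ) ^ 2 := by
      rw [div_le_iff₀ (by positivity)]; nlinarith
    have e3 : 1 ≤ Real.exp (2 * c₁ * x) := Real.one_le_exp (by positivity)
    have e4 : (1 : ℝ) ≤ (n : ℝ) ^ 2 := by nlinarith
    have e5 : K * (n : ℝ) ^ 2 ≤ Real.exp (c₁ * x) := by
      rw [← Real.exp_log (show 0 < K by linarith), ← Real.exp_log (show (0 : ℝ) < (n : ℝ) ^ 2 by
        positivity), ← Real.exp_add, Real.log_pow]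
      refine Real.exp_le_exp.2 ?_
      have h1 := mul_le_mul_of_nonneg_left hlog hc₁.le
      have h2 : c₁ * ((2 + Real.log K) / c₁ * Real.log n + (2 + Real.log K) / c₁) =
          (2 + Real.log K) * Real.log n + (2 + Real.log K) := by field_simp
      rw [h2] at h1
      have h3 : 0 ≤ Real.log n := Real.log_nonneg hn1
      push_cast
      nlinarith [mul_nonneg hlK h3]
    rw [e1]
    have e6 : 2 ^ 21 / κ * (n / φ ^ 4) * Real.exp (2 * c₁ * x) ≤
        2 ^ 21 / κ * (n : ℝ) ^ 2 * Real.exp (2 * c₁ * x) := by gcongr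
    have e7 : (2 : ℝ) ≤ 2 * (n : ℝ) ^ 2 * Real.exp (2 * c₁ * x) := by nlinarith
    calc _ ≤ K * (n : ℝ) ^ 2 * Real.exp (2 * c₁ * x) := by rw [hK]; linarith
      _ ≤ Real.exp (c₁ * x) * Real.exp (2 * c₁ * x) := by gcongr
      _ = _ := by rw [← Real.exp_add]; congr 1; ring
  calc _ ≤ Real.exp (3 * c₁ * x) ^ Fintype.card ι :=
        pow_le_pow_left₀ (by positivity) hbase _
    _ = _ := by rw [← Real.exp_nat_mul]; congr 1; ring

end IsRegular
end ContamModel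

namespace ContamModel

variable {𝒳 : Type} [MeasurableSpace 𝒳] {ι : Type} [Fintype ι]

/-- A single bracketing at the smallest radius serves the whole range of integration. It bounds the
integrand by c √n φ over an interval shorter than φ, so no finer chaining is needed. -/
lemma entropyAssumption_of_bracketing {M : ContamModel 𝒳 ι} {q c K : ℝ}
    {Ωs : ℕ → Set (EuclideanSpace ℝ ι)} (hq : 4 < q) (hc : 0 < c) (hK0 : 0 ≤ K) (hKc : K ≤ c ^ 2)
    (hmono : Monotone Ωs) (hunion : ⋃ n, Ωs n = M.Ω)
    (hB : ∀ᶠ n : ℕ in atTop, ∃ B : Finset ((𝒳 → ℝ) × (𝒳 → ℝ)),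
      IsBracketing M.base (((n : ℝ) ^ (-(1 / q))) ^ 2 / 2 ^ 10) (M.f '' Ωs n) B ∧
      (∀ b ∈ B, Measurable b.2) ∧
      (B.card : ℝ) ≤ Real.exp (K * (n * ((n : ℝ) ^ (-(1 / q))) ^ 2))) :
    M.EntropyAssumption (fun n => (n : ℝ) ^ (-(1 / q))) Ωs c := by
  refine ⟨tendsto_rate (by linarith), ?_, hmono, hunion, ?_⟩
  · have hs : 0 < 1 - 2 / q := by
      have : 2 / q < 1 := (div_lt_one (by linarith)).2 (by linarith)
      linarith
    refine ((tendsto_rpow_atTop hs).comp tendsto_natCast_atTop_atTop).congr' ?_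
    filter_upwards [eventually_ge_atTop 1] with n hn
    exact (nat_mul_rate_sq q hn).symm
  · filter_upwards [hB, eventually_ge_atTop 1] with n hBn hn
    obtain ⟨B, hB, -, hcard⟩ := hBn
    have hφ0 := rate_pos q hn
    refine ⟨hφ0, ?_⟩
    set φ := (n : ℝ) ^ (-(1 / q)) with hφ
    have hn0 : (0 : ℝ) < n := by exact_mod_cast hn
    calc _ ≤ ∫⁻ u in Ioo (φ ^ 2 / 2 ^ 10) φ, ENNReal.ofReal (c * √n * φ) := by
          refine setLIntegral_mono' measurableSet_Ioo fun u hu => ?_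
          have h1 := bracketingEntropy_le_of_isBracketing hB hu.1.le hcard (by positivity)
          calc _ ≤ ENNReal.ofReal (K * (n * φ ^ 2)) ^ (1 / 2 : ℝ) := by gcongr
            _ ≤ ENNReal.ofReal ((c * √n * φ) ^ 2) ^ (1 / 2 : ℝ) := by
                refine ENNReal.rpow_le_rpow (ENNReal.ofReal_le_ofReal ?_) (by norm_num)
                rw [mul_pow, mul_pow, Real.sq_sqrt hn0.le, mul_assoc]
                gcongr
            _ = _ := by
                rw [ENNReal.ofReal_rpow_of_nonneg (by positivity) (by norm_num),
                  ← Real.sqrt_eq_rpow, Real.sqrt_sq (by positivity)]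
      _ = ENNReal.ofReal (c * √n * φ) * ENNReal.ofReal (φ - φ ^ 2 / 2 ^ 10) := by
          rw [setLIntegral_const, Real.volume_Ioo]
      _ ≤ ENNReal.ofReal (c * √n * φ) * ENNReal.ofReal φ := by
          gcongr
          have : 0 ≤ φ ^ 2 / 2 ^ 10 := by positivity
          linarith
      _ = _ := by rw [← ENNReal.ofReal_mul (by positivity)]; congr 1; ring

namespace IsRegular

variable {M : ContamModel 𝒳 ι}

/-- The prior mass of small balls dominates any exponentially decreasing sequence. -/
lemma eventually_le_prior_closedBall (h : M.IsRegular) {q c₁ T : ℝ} (hq : 4 < q) (hc₁ : 0 < c₁)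
    (hT : 0 < T) : ∀ᶠ n : ℕ in atTop,
      ENNReal.ofReal (1 * Real.exp (-(2 * n * (c₁ * ((n : ℝ) ^ (-(1 / q))) ^ 2 / 8)))) ≤
        M.prior (Metric.closedBall M.θs (c₁ * ((n : ℝ) ^ (-(1 / q))) ^ 2 / 8 / T)) := by
  obtain ⟨c₀, hc₀, hball⟩ := h.prior_ball
  set D := Fintype.card ι
  -- The radius is c₁φ²/(8T) ≥ (c₁/(8T))/n, so the ball has mass at least b n^{-D}.
  set b := c₀ * (c₁ / 8 / T) ^ D with hb
  have hb0 : 0 < b := by positivity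
  have hlim : Tendsto (fun n : ℕ => c₁ * ((n : ℝ) ^ (-(1 / q))) ^ 2 / 8 / T) atTop (𝓝 0) := by
    have := ((((tendsto_rate (q := q) (by linarith)).pow 2).const_mul c₁).div_const 8).div_const T
    simpa using this
  filter_upwards [eventually_log_le hq (4 / c₁ * (D + |Real.log b|)), eventually_ge_atTop 1,
    hlim.eventually_le_const one_pos] with n hlog hn hle
  have hn0 : (0 : ℝ) < n := by exact_mod_cast hn
  have hn1 : (1 : ℝ) ≤ n := by exact_mod_cast hn
  have hφ0 := rate_pos q hn
  have h4 := one_le_nat_mul_rate_pow_four hq hn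
  have hφ1 : (n : ℝ) ^ (-(1 / q)) ≤ 1 := Real.rpow_le_one_of_one_le_of_nonpos hn1 (by
    have : 0 < 1 / q := by positivity
    linarith)
  set φ := (n : ℝ) ^ (-(1 / q)) with hφ
  refine le_trans (ENNReal.ofReal_le_ofReal ?_) (hball _ (by positivity) hle)
  have h5 : (n : ℝ)⁻¹ ≤ φ ^ 2 := by
    rw [inv_le_iff_one_le_mul₀ hn0, mul_comm]
    have h6 : φ ^ 4 ≤ φ ^ 2 := pow_le_pow_of_le_one hφ0.le hφ1 (by norm_num)
    nlinarith
  have h7 : b * (n : ℝ)⁻¹ ^ D ≤ c₀ * (c₁ * φ ^ 2 / 8 / T) ^ D := by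
    rw [hb, mul_assoc, ← mul_pow]
    gcongr
    calc c₁ / 8 / T * (n : ℝ)⁻¹ ≤ c₁ / 8 / T * φ ^ 2 := by gcongr
      _ = _ := by ring
  refine le_trans ?_ h7
  have h8 : b * (n : ℝ)⁻¹ ^ D = Real.exp (Real.log b - D * Real.log n) := by
    rw [Real.exp_sub, Real.exp_log hb0, Real.exp_nat_mul, Real.exp_log hn0, inv_pow, div_eq_mul_inv]
  rw [h8, one_mul]
  refine Real.exp_le_exp.2 ?_
  have h9 := mul_le_mul_of_nonneg_left hlog (show 0 ≤ c₁ / 4 by positivity)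
  have h10 : c₁ / 4 * (4 / c₁ * (D + |Real.log b|) * Real.log n + 4 / c₁ * (D + |Real.log b|)) =
      (D + |Real.log b|) * Real.log n + (D + |Real.log b|) := by field_simp
  rw [h10] at h9
  have h11 := neg_abs_le (Real.log b)
  have h12 : 0 ≤ Real.log n := Real.log_nonneg hn1
  have h13 : 0 ≤ |Real.log b| * Real.log n := by positivity
  have h14 : (0 : ℝ) ≤ D := Nat.cast_nonneg _
  nlinarith

/-- A regular model attains the rates, provided that `c₁` is small. -/
theorem satisfiesRates (h : M.IsRegular) {q c c₁ c₂ : ℝ} (hq : 4 < q) (hc : 0 < c) (hc₁ : 0 < c₁)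
    (hc₂ : 0 < c₂) (hcc : 3 * Fintype.card ι * c₁ ≤ c ^ 2) : M.SatisfiesRates q c c₁ c₂ := by
  obtain ⟨V, A, κ, hA, hκ, hVanti, hVΩ, hVex, hVm, hVtail, hVcell⟩ := h.sieve
  obtain ⟨c₀, hc₀, hhell⟩ := h.exists_hellinger_ge
  obtain ⟨r, hr, T, hT, B₀, hlip⟩ := h.exists_lipschitz h.θs_mem
  set D : ℝ := ((Fintype.card ι : ℕ) : ℝ) with hD
  have hD0 : 0 ≤ D := Nat.cast_nonneg _
  -- The summands pay, in turn, for the number of brackets, for the likelihood threshold, and for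
  -- the bracket width; 2 > 1 also makes the Hellinger link strict.
  set η₀ := 3 * D * c₁ + c₁ + 2 with hη₀
  have hη₀2 : 2 ≤ η₀ := by
    have : 0 ≤ 3 * D * c₁ := by positivity
    linarith
  -- Since C ≥ 1, C² ≥ C and c₀ C² exceeds η₀: beyond distance Cφ the squared Hellinger distance is
  -- at least η₀ φ².
  set C := η₀ / c₀ + 1 with hC
  have hC1 : 1 ≤ C := by
    have : 0 ≤ η₀ / c₀ := by positivity
    linarith
  have hCη : η₀ ≤ c₀ * C ^ 2 := by
    have h1 : η₀ = c₀ * (C - 1) := by rw [hC]; field_simp; ring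
    nlinarith
  have hq0 : 0 < q := by linarith
  have hs : 0 ≤ 1 - 2 / q := by
    have : 2 / q < 1 := (div_lt_one hq0).2 (by linarith)
    linarith
  -- The boundary cut-off e^{-2 c₁ n φ²} is exactly the prior tail allowed outside the sieve, while
  -- the box of half-width n leaves out mass of order e^{-n}, which is smaller since 2 c₁ φ² ≤ 1
  -- eventually.
  set Ωs : ℕ → Set (EuclideanSpace ℝ ι) := fun n =>
    V (Real.exp (-(2 * c₁ * (n : ℝ) ^ (1 - 2 / q)))) ∩ {θ | ∀ i, |θ i| ≤ n} with hΩs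
  have hΩsub : ∀ n, Ωs n ⊆ M.Ω := fun n => inter_subset_left.trans (hVΩ _ (Real.exp_pos _))
  have hΩm : ∀ n, MeasurableSet (Ωs n) := fun n => (hVm _).inter (by
    simp only [ofPred_forall]
    exact MeasurableSet.iInter fun i => measurableSet_le (by fun_prop) measurable_const)
  have hmono : Monotone Ωs := by
    intro m n hmn
    have hmn' : (m : ℝ) ≤ n := by exact_mod_cast hmn
    refine inter_subset_inter (hVanti _ _ (Real.exp_le_exp.2 (neg_le_neg ?_)))
      fun θ hθ i => (hθ i).trans hmn'
    have := Real.rpow_le_rpow (Nat.cast_nonneg m) hmn' hs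
    gcongr
  have hgrow : Tendsto (fun n : ℕ => (n : ℝ) ^ (1 - 2 / q)) atTop atTop := by
    have hs' : 0 < 1 - 2 / q := by
      have : 2 / q < 1 := (div_lt_one hq0).2 (by linarith)
      linarith
    exact (tendsto_rpow_atTop hs').comp tendsto_natCast_atTop_atTop
  have hunion : ⋃ n, Ωs n = M.Ω := by
    refine Subset.antisymm (iUnion_subset hΩsub) fun θ hθ => ?_
    obtain ⟨ε, hε, hθε⟩ := hVex θ hθ
    have h1 : Tendsto (fun n : ℕ => Real.exp (-(2 * c₁ * (n : ℝ) ^ (1 - 2 / q)))) atTop (𝓝 0) :=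
      Real.tendsto_exp_atBot.comp
        (tendsto_neg_atTop_atBot.comp (hgrow.const_mul_atTop (by positivity)))
    have h2 : ∀ᶠ n : ℕ in atTop, ∀ i, |θ i| ≤ n := by
      rw [eventually_all]
      exact fun i => tendsto_natCast_atTop_atTop.eventually_ge_atTop _
    obtain ⟨n, hn1, hn2⟩ := ((h1.eventually_le_const hε).and h2).exists
    exact mem_iUnion.2 ⟨n, hVanti _ _ hn1 hθε, hn2⟩
  have hbr := eventually_exists_bracketing hκ hq hc₁ hVΩ hVcell
  have hφlim := tendsto_rate (q := q) hq0
  have hplim := tendsto_rate (q := 2 * q) (by positivity)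
  have hfar : ∀ᶠ n : ℕ in atTop, ∀ θ ∈ M.Ω, C * (n : ℝ) ^ (-(1 / q)) < ‖θ - M.θs‖ →
      η₀ * ((n : ℝ) ^ (-(1 / q))) ^ 2 ≤ hellinger M.base (M.k ((n : ℝ) ^ (-(1 / (2 * q)))) θ)
        (M.k ((n : ℝ) ^ (-(1 / (2 * q)))) M.θs) ^ 2 := by
    have h1 : Tendsto (fun n : ℕ => C * (n : ℝ) ^ (-(1 / q))) atTop (𝓝 0) := by
      simpa using hφlim.const_mul C
    filter_upwards [h1.eventually_le_const one_pos, eventually_ge_atTop 1,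
      hplim.eventually_le_const (show (0 : ℝ) < 1 / 2 by norm_num)] with n hCφ hn hp θ hθ hlt
    have hφ0 := rate_pos q hn
    have h2 := hhell _ (rate_pos (2 * q) hn).le hp θ hθ
    refine le_trans ?_ h2
    have h3 : C * (n : ℝ) ^ (-(1 / q)) ≤ min ‖θ - M.θs‖ 1 := le_min hlt.le hCφ
    calc η₀ * ((n : ℝ) ^ (-(1 / q))) ^ 2 ≤ c₀ * C ^ 2 * ((n : ℝ) ^ (-(1 / q))) ^ 2 := by gcongr
      _ = c₀ * (C * (n : ℝ) ^ (-(1 / q))) ^ 2 := by ring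
      _ ≤ _ := by gcongr
  have htail : ∀ᶠ n : ℕ in atTop, M.prior (M.Ω \ Ωs n) ≤
      ENNReal.ofReal (2 * A * Real.exp (-(2 * c₁ * n * ((n : ℝ) ^ (-(1 / q))) ^ 2))) := by
    have h1 : Tendsto (fun n : ℕ => 2 * c₁ * ((n : ℝ) ^ (-(1 / q))) ^ 2) atTop (𝓝 0) := by
      simpa using (hφlim.pow 2).const_mul (2 * c₁)
    filter_upwards [eventually_ge_atTop 1, h1.eventually_le_const one_pos] with n hn hle
    refine (hVtail _ n (Real.exp_pos _) (Nat.cast_nonneg n)).trans (ENNReal.ofReal_le_ofReal ?_)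
    rw [← nat_mul_rate_sq q hn]
    have h2 : Real.exp (-(n : ℝ)) ≤ Real.exp (-(2 * c₁ * n * ((n : ℝ) ^ (-(1 / q))) ^ 2)) := by
      refine Real.exp_le_exp.2 (neg_le_neg ?_)
      have := mul_le_mul_of_nonneg_left hle (Nat.cast_nonneg (α := ℝ) n)
      nlinarith
    rw [← mul_assoc (2 * c₁)]
    nlinarith
  have hcentre := h.eventually_le_prior_closedBall hq hc₁ hT
  have hball : ∀ᶠ n : ℕ in atTop,
      Metric.closedBall M.θs (c₁ * ((n : ℝ) ^ (-(1 / q))) ^ 2 / 8 / T) ⊆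
        M.rhoNhd 1 (c₁ * ((n : ℝ) ^ (-(1 / q))) ^ 2 / 8) := by
    have hlim : Tendsto (fun n : ℕ => c₁ * ((n : ℝ) ^ (-(1 / q))) ^ 2 / 8 / T) atTop (𝓝 0) := by
      have := ((hφlim.pow 2).const_mul c₁).div_const 8 |>.div_const T
      simpa using this
    filter_upwards [hlim.eventually_le_const hr] with n hn
    exact h.closedBall_subset_rhoNhd hT hlip hn
  -- α = 1 and c₃ = 1. The tail constant 2A adds the boundary and box contributions; C₁ is twice the
  -- sum 1 + 2A + 1 of the three failure probabilities, one for each dataset of the pair.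
  refine ⟨Ωs, 1, 1, 2 * A, C, 2 * (2 + 2 * A), T, one_pos, le_rfl, one_pos, by positivity,
    by linarith, by positivity, hT, ?_, ?_, htail, h.ratioAssumption, h.identifiabilityAssumption,
    ?_, ?_, privEps_isBigO hq (by linarith) hT hc₁ one_pos, privDelta_isBigO q c₁ 1⟩
  · exact entropyAssumption_of_bracketing hq hc (by positivity) hcc hmono hunion hbr
  · filter_upwards [hcentre, hball, eventually_ge_atTop 2,
      eventually_log_le hq (8 / c₁ * (1 + c₁ / (8 * c₂) + 1))] with n h1 h2 hn hlog
    refine ⟨h1.trans (measure_mono h2), ?_⟩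
    have hl : 0 < Real.log n := Real.log_pos (by exact_mod_cast hn)
    rw [lt_div_iff₀ hl]
    have h3 := mul_le_mul_of_nonneg_left hlog (show 0 ≤ c₁ / 8 by positivity)
    have h4 : 0 < c₁ / (8 * c₂) := by positivity
    have h5 : max (1 / 1) (c₁ / (8 * c₂)) ≤ 1 + c₁ / (8 * c₂) := by
      rw [div_one]; exact max_le (by linarith) (by linarith)
    set m := c₁ / (8 * c₂) with hm
    have h6 : c₁ / 8 * (8 / c₁ * (1 + m + 1) * Real.log n + 8 / c₁ * (1 + m + 1)) =
        (1 + m + 1) * Real.log n + (1 + m + 1) := by field_simp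
    rw [h6] at h3
    have h7 := mul_le_mul_of_nonneg_right h5 hl.le
    have h8 : (n : ℝ) * (c₁ * ((n : ℝ) ^ (-(1 / q))) ^ 2 / 8) =
      c₁ / 8 * (n * ((n : ℝ) ^ (-(1 / q))) ^ 2) := by ring
    rw [h8]
    linarith
  · filter_upwards [hfar, eventually_ge_atTop 1] with n h1 hn θ hθ hle
    by_contra! hlt
    have h2 := h1 θ hθ hlt
    have hφ0 := rate_pos q hn
    have h3 := pow_le_pow_left₀ (hellinger_nonneg _ _) hle 2
    have h4 : 0 < ((n : ℝ) ^ (-(1 / q))) ^ 2 := by positivity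
    nlinarith
  · have h1 : Tendsto (fun n : ℕ => C * (n : ℝ) ^ (-(1 / q))) atTop (𝓝 0) := by
      simpa using hφlim.const_mul C
    filter_upwards [hbr, hfar, htail, hcentre, hball, eventually_ge_atTop 1,
      h1.eventually_le_const hr, hplim.eventually_le_const one_pos,
      hφlim.eventually_le_const one_pos] with n hbr hfar htail hcentre hball hn hCr hp1 hφ1 Q hQ
    obtain ⟨B, hB, hBm, hBc⟩ := hbr
    have hn0 : (0 : ℝ) < n := by exact_mod_cast hn
    have hφ0 := rate_pos q hn
    have hp0 := rate_pos (2 * q) hn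
    set φ := (n : ℝ) ^ (-(1 / q)) with hφ
    set p := (n : ℝ) ^ (-(1 / (2 * q))) with hp
    set x := (n : ℝ) * φ ^ 2 with hx
    have hx0 : 0 < x := by positivity
    -- The choices t = t_n and s = c₁ x satisfy 4nt = s/2. A closed ball inside the divergence
    -- neighbourhood supplies a measurable set for the central estimate.
    have hbad := h.measure_not_concentrated_le hp0 hp1 n (s := c₁ * x) (t := c₁ * φ ^ 2 / 8)
      (u := φ ^ 2 / 2 ^ 10) (η := η₀ * φ ^ 2) (ψ := C * φ) (c₃ := 1) (by positivity)
      (by positivity) (by rw [hx]; ring) (hΩm n) (hΩsub n) measurableSet_closedBall hball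
      hcentre hB hBm hfar
    have e1 : (B.card : ℝ) * Real.exp (c₁ * x / 2 - n * (η₀ * φ ^ 2 - 3 / 2 * (φ ^ 2 / 2 ^ 10))) ≤
        Real.exp (-(c₁ * x / 8)) := by
      calc _ ≤ Real.exp (3 * D * c₁ * x) *
          Real.exp (c₁ * x / 2 - n * (η₀ * φ ^ 2 - 3 / 2 * (φ ^ 2 / 2 ^ 10))) := by gcongr
        _ ≤ _ := by
          rw [← Real.exp_add]
          refine Real.exp_le_exp.2 ?_
          have : n * (η₀ * φ ^ 2 - 3 / 2 * (φ ^ 2 / 2 ^ 10)) = (η₀ - 3 / 2 / 2 ^ 10) * x := by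
            rw [hx]; ring
          rw [this, hη₀]
          nlinarith [mul_pos hc₁ hx0]
    have e2 : ENNReal.ofReal (Real.exp (c₁ * x)) * M.prior (M.Ω \ Ωs n) ≤
        ENNReal.ofReal (2 * A * Real.exp (-(c₁ * x / 8))) := by
      calc _ ≤ ENNReal.ofReal (Real.exp (c₁ * x)) *
            ENNReal.ofReal (2 * A * Real.exp (-(2 * c₁ * n * φ ^ 2))) := by gcongr
        _ ≤ _ := by
          rw [← ENNReal.ofReal_mul (Real.exp_pos _).le, mul_left_comm, ← Real.exp_add]
          refine ENNReal.ofReal_le_ofReal ?_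
          gcongr
          have : 2 * c₁ * n * φ ^ 2 = 2 * (c₁ * x) := by rw [hx]; ring
          rw [this]
          nlinarith [mul_pos hc₁ hx0]
    have e3 : -(n * (c₁ * φ ^ 2 / 8)) = -(c₁ * x / 8) := by rw [hx]; ring
    rw [e3] at hbad
    have hbad' := hbad.trans (add_le_add (add_le_add (ENNReal.ofReal_le_ofReal e1) e2) le_rfl)
    rw [← ENNReal.ofReal_add (by positivity) (by positivity),
      ← ENNReal.ofReal_add (by positivity) (by positivity)] at hbad'
    -- The Lipschitz constant T at the truth enters here; the coefficient of p g is half of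
    -- `preEps`.
    have hL : ∀ θ ∈ M.Ω, ‖θ - M.θs‖ ≤ C * φ → ∀ y,
        (1 - p) * |M.f θ y - M.f M.θs y| ≤ ((1 - p) * T * (C * φ) / p) * (p * M.g y) := by
      intro θ hθ hle y
      have h2 := ((hlip θ (hle.trans hCr)).2 y).1
      have hg := h.contamination.pos y
      have h3 : |M.f θ y - M.f M.θs y| ≤ C * φ * (T * M.g y) := h2.trans (by gcongr)
      calc (1 - p) * |M.f θ y - M.f M.θs y| ≤ (1 - p) * (C * φ * (T * M.g y)) :=
            mul_le_mul_of_nonneg_left h3 (by linarith)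
        _ = _ := by field_simp
    have hfin := h.measure_not_privacyIneq_le hp0 hp1 one_pos hL hbad' (by positivity) hQ
    have e4 : 2 * ((1 - p) * T * (C * φ) / p) = 2 * (1 - p) * T * (C * φ) / p := by ring
    have e5 : c₁ * x / 2 = 1 / 2 * c₁ * n * φ ^ 2 := by rw [hx]; ring
    rw [e4, e5] at hfin
    refine hfin.trans (ENNReal.ofReal_le_ofReal ?_)
    have e6 : Real.exp (-(c₁ * x / 8)) ≤ Real.exp (-(n * min (c₁ * 1 / 8) c₂ * φ ^ 2)) := by
      refine Real.exp_le_exp.2 (neg_le_neg ?_)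
      have h2 := min_le_left (c₁ * 1 / 8) c₂
      calc n * min (c₁ * 1 / 8) c₂ * φ ^ 2 ≤ n * (c₁ * 1 / 8) * φ ^ 2 := by gcongr
        _ = _ := by rw [hx]; ring
    calc _ = 2 * (2 + 2 * A) * Real.exp (-(c₁ * x / 8)) := by ring
      _ ≤ _ := mul_le_mul_of_nonneg_left e6 (by positivity)

end IsRegular
end ContamModel

/-! ### Gaussian priors -/

section GaussianPrior

lemma EuclideanSpace.norm_le_sum_abs {ι : Type*} [Fintype ι] (v : EuclideanSpace ℝ ι) :
    ‖v‖ ≤ ∑ i, |v i| := by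
  have h0 : 0 ≤ ∑ i, |v i| := Finset.sum_nonneg fun _ _ => abs_nonneg _
  refine abs_le_of_sq_le_sq' ?_ h0 |>.2
  rw [EuclideanSpace.real_norm_sq_eq]
  calc ∑ i, v i ^ 2 = ∑ i, |v i| ^ 2 := by simp
    _ ≤ _ := Finset.sum_sq_le_sq_sum_of_nonneg fun i _ => abs_nonneg _

lemma EuclideanSpace.abs_apply_le_norm {ι : Type*} [Fintype ι] (v : EuclideanSpace ℝ ι) (i : ι) :
    |v i| ≤ ‖v‖ := by
  simpa using PiLp.norm_apply_le v i

/-- On an interval of radius at most 1 about a, the density is at least its value at |a| + 1. -/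
lemma gaussianReal_Icc_ge (a : ℝ) : ∃ c > 0, ∀ ρ, 0 < ρ → ρ ≤ 1 →
    ENNReal.ofReal (c * ρ) ≤ gaussianReal 0 1 (Icc (a - ρ) (a + ρ)) := by
  refine ⟨gaussianPDFReal 0 1 (|a| + 1) * 2, mul_pos (gaussianPDFReal_pos _ _ _ one_ne_zero)
    two_pos, fun ρ hρ hρ1 => ?_⟩
  rw [gaussianReal_apply _ one_ne_zero]
  have h1 : ∀ x ∈ Icc (a - ρ) (a + ρ),
      ENNReal.ofReal (gaussianPDFReal 0 1 (|a| + 1)) ≤ gaussianPDF 0 1 x := by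
    intro x hx
    refine ENNReal.ofReal_le_ofReal ?_
    simp only [gaussianPDFReal, sub_zero, NNReal.coe_one, mul_one]
    have hx2 : x ^ 2 ≤ (|a| + 1) ^ 2 := by
      refine sq_le_sq' ?_ ?_
      · linarith [neg_abs_le a, hx.1]
      · linarith [le_abs_self a, hx.2]
    gcongr
  calc _ = ∫⁻ _ in Icc (a - ρ) (a + ρ), ENNReal.ofReal (gaussianPDFReal 0 1 (|a| + 1)) := by
        rw [setLIntegral_const, Real.volume_Icc,
          ← ENNReal.ofReal_mul (gaussianPDFReal_nonneg _ _ _)]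
        congr 1; ring
    _ ≤ _ := setLIntegral_mono' measurableSet_Icc h1

lemma stdGaussian_box_ge {ι : Type*} [Fintype ι] (y : EuclideanSpace ℝ ι) :
    ∃ c > 0, ∀ ρ, 0 < ρ → ρ ≤ 1 → ENNReal.ofReal (c * ρ ^ Fintype.card ι) ≤
      stdGaussian (EuclideanSpace ℝ ι) {x | ∀ i, |x i - y i| ≤ ρ} := by
  choose c hc hle using gaussianReal_Icc_ge
  refine ⟨∏ i, c (y i), Finset.prod_pos fun i _ => hc _, fun ρ hρ hρ1 => ?_⟩
  have hm : MeasurableSet {x : EuclideanSpace ℝ ι | ∀ i, |x i - y i| ≤ ρ} := by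
    simp only [ofPred_forall]
    exact MeasurableSet.iInter fun i => measurableSet_le (by fun_prop) measurable_const
  rw [← map_pi_eq_stdGaussian, Measure.map_apply (by fun_prop) hm]
  have hpre : WithLp.toLp 2 ⁻¹' {x : EuclideanSpace ℝ ι | ∀ i, |x i - y i| ≤ ρ} =
      Set.pi univ fun i => Icc (y i - ρ) (y i + ρ) := by
    ext x
    simp only [mem_preimage, mem_ofPred_eq, Set.mem_pi, mem_univ, forall_const, mem_Icc]
    refine forall_congr' fun i => ?_
    rw [abs_le]
    constructor <;> rintro ⟨h1, h2⟩ <;> constructor <;> linarith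
  rw [hpre, Measure.pi_pi]
  calc _ = ∏ i, ENNReal.ofReal (c (y i) * ρ) := by
        rw [← ENNReal.ofReal_prod_of_nonneg fun i _ => (mul_pos (hc _) hρ).le,
          Finset.prod_mul_distrib, Finset.prod_const, Finset.card_univ]
    _ ≤ _ := Finset.prod_le_prod' fun i _ => hle _ ρ hρ hρ1

variable {ι : Type*} [Fintype ι] [DecidableEq ι]

-- The square root of a positive definite matrix is invertible, with right inverse √S · S⁻¹.
open scoped MatrixOrder in
lemma exists_toEuclideanCLM_sqrt_eq {S : Matrix ι ι ℝ} (hS : S.PosDef) (v : EuclideanSpace ℝ ι) :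
    ∃ y, Matrix.toEuclideanCLM (𝕜 := ℝ) (CFC.sqrt S) y = v := by
  refine ⟨Matrix.toEuclideanCLM (𝕜 := ℝ) (CFC.sqrt S * S⁻¹) v, ?_⟩
  rw [← ContinuousLinearMap.comp_apply, ← ContinuousLinearMap.mul_def, ← map_mul, ← mul_assoc,
    CFC.sqrt_mul_sqrt_self _ hS.posSemidef.nonneg, Matrix.mul_nonsing_inv _
      (isUnit_iff_ne_zero.2 hS.det_pos.ne')]
  simp

open scoped MatrixOrder in
/-- A nondegenerate Gaussian law charges balls at least like Lebesgue measure. -/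
lemma multivariateGaussian_closedBall_ge {S : Matrix ι ι ℝ} (hS : S.PosDef)
    (m θ : EuclideanSpace ℝ ι) : ∃ c > 0, ∀ r, 0 < r → r ≤ 1 →
      ENNReal.ofReal (c * r ^ Fintype.card ι) ≤
        multivariateGaussian m S (Metric.closedBall θ r) := by
  obtain ⟨y, hy⟩ := exists_toEuclideanCLM_sqrt_eq hS (θ - m)
  obtain ⟨c, hc, hle⟩ := stdGaussian_box_ge y
  set L := Matrix.toEuclideanCLM (𝕜 := ℝ) (CFC.sqrt S) with hL
  -- A box of side r/k in standard coordinates is mapped by √S into the ball of radius r: dimension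
  -- for passing from coordinates to the norm, ‖L‖ for the map. The summands 1 keep k at least 1.
  set k : ℝ := (‖L‖ + 1) * (Fintype.card ι + 1) with hk
  have hk1 : 1 ≤ k := by
    have h1 : (1 : ℝ) ≤ ‖L‖ + 1 := by linarith [norm_nonneg L]
    have h2 : (1 : ℝ) ≤ Fintype.card ι + 1 := by
      have : (0 : ℝ) ≤ Fintype.card ι := Nat.cast_nonneg _
      linarith
    exact one_le_mul_of_one_le_of_one_le h1 h2
  have hk0 : 0 < k := by linarith
  refine ⟨c * (1 / k) ^ Fintype.card ι, by positivity, fun r hr hr1 => ?_⟩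
  have h1 := hle (r / k) (by positivity) ((div_le_one hk0).2 (by linarith))
  rw [multivariateGaussian, Measure.map_apply (by fun_prop) measurableSet_closedBall]
  refine le_trans (le_of_eq ?_) (h1.trans (measure_mono fun x hx => ?_))
  · congr 1; rw [mul_assoc, ← mul_pow]; congr 2; ring
  · simp only [mem_preimage, mem_closedBall_iff_norm, mem_ofPred_eq] at hx ⊢
    have e : m + L x - θ = L (x - y) := by rw [map_sub, hy]; abel
    rw [← hL, e]
    have h2 : ‖x - y‖ ≤ Fintype.card ι * (r / k) := by
      refine (EuclideanSpace.norm_le_sum_abs _).trans ?_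
      calc ∑ i, |(x - y) i| ≤ ∑ _i : ι, r / k := Finset.sum_le_sum fun i _ => by simpa using hx i
        _ = _ := by simp
    calc ‖L (x - y)‖ ≤ ‖L‖ * ‖x - y‖ := L.le_opNorm _
      _ ≤ (‖L‖ + 1) * ((Fintype.card ι + 1) * (r / k)) := by
          gcongr
          · linarith
          · exact h2.trans (by gcongr; linarith)
      _ = r := by rw [hk]; field_simp

/-- Chernoff bounds at parameters 1 and -1; an exponential tail is all that the sieve needs. -/
lemma gaussianReal_tail_le (μ : ℝ) (v : NNReal) : ∃ A > 0, ∀ R : ℝ,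
    gaussianReal μ v {x | ¬ |x| ≤ R} ≤ ENNReal.ofReal (A * Real.exp (-R)) := by
  refine ⟨mgf id (gaussianReal μ v) 1 + mgf id (gaussianReal μ v) (-1), ?_, fun R => ?_⟩
  · rw [mgf_id_gaussianReal]; positivity
  have hintg : ∀ t : ℝ, Integrable (fun x => Real.exp (t * id x)) (gaussianReal μ v) := fun t =>
    integrable_exp_mul_gaussianReal t
  have h1 := measure_ge_le_exp_mul_mgf (X := id) (μ := gaussianReal μ v) R zero_le_one (hintg 1)
  have h2 := measure_le_le_exp_mul_mgf (X := id) (μ := gaussianReal μ v) (-R) (t := -1)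
    (by norm_num) (hintg (-1))
  have hsub : {x : ℝ | ¬ |x| ≤ R} ⊆ {x | R ≤ id x} ∪ {x | id x ≤ -R} := by
    intro x hx
    simp only [mem_ofPred_eq, not_le, lt_abs, mem_union, id] at hx ⊢
    rcases hx with hx | hx
    · exact Or.inl hx.le
    · exact Or.inr (by linarith)
  have h3 : (gaussianReal μ v).real {x | ¬ |x| ≤ R} ≤
      (mgf id (gaussianReal μ v) 1 + mgf id (gaussianReal μ v) (-1)) * Real.exp (-R) := by
    calc _ ≤ _ := measureReal_mono hsub
      _ ≤ _ := measureReal_union_le _ _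
      _ ≤ _ := add_le_add h1 h2
      _ = _ := by ring_nf
  rw [← ofReal_measureReal]
  exact ENNReal.ofReal_le_ofReal h3

lemma multivariateGaussian_box_compl_le {S : Matrix ι ι ℝ} (hS : S.PosDef)
    (m : EuclideanSpace ℝ ι) : ∃ A > 0, ∀ R : ℝ,
      multivariateGaussian m S {θ | ¬ ∀ i, |θ i| ≤ R} ≤ ENNReal.ofReal (A * Real.exp (-R)) := by
  choose A hA hle using fun i => gaussianReal_tail_le (m i) (S i i).toNNReal
  refine ⟨∑ i, A i + 1, add_pos_of_nonneg_of_pos (Finset.sum_nonneg fun i _ => (hA i).le) one_pos,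
    fun R => ?_⟩
  have hsub : {θ : EuclideanSpace ℝ ι | ¬ ∀ i, |θ i| ≤ R} ⊆ ⋃ i, {θ | ¬ |θ i| ≤ R} := by
    intro θ hθ
    simpa using hθ
  calc _ ≤ _ := measure_mono hsub
    _ ≤ _ := measure_iUnion_fintype_le _ _
    _ ≤ ∑ i, ENNReal.ofReal (A i * Real.exp (-R)) := by
        refine Finset.sum_le_sum fun i _ => ?_
        have hp := measurePreserving_eval_multivariateGaussian (μ := m) hS.posSemidef (i := i)
        have hm : MeasurableSet {x : ℝ | ¬ |x| ≤ R} :=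
          (measurableSet_le measurable_norm measurable_const).compl
        have := hp.measure_preimage hm.nullMeasurableSet
        exact this.le.trans (hle i R)
    _ = ENNReal.ofReal (∑ i, A i * Real.exp (-R)) :=
        (ENNReal.ofReal_sum_of_nonneg fun i _ => (mul_pos (hA i) (Real.exp_pos _)).le).symm
    _ ≤ _ := by
        refine ENNReal.ofReal_le_ofReal ?_
        rw [← Finset.sum_mul, add_mul]
        linarith [Real.exp_pos (-R)]

/-- The coordinate is Gaussian with positive variance, so its density is bounded by its peak. -/
lemma multivariateGaussian_slab_le {S : Matrix ι ι ℝ} (hS : S.PosDef) (m : EuclideanSpace ℝ ι)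
    (i : ι) : ∃ A > 0, ∀ ε : ℝ, 0 < ε →
      multivariateGaussian m S {θ | 0 < θ i ∧ θ i < ε} ≤ ENNReal.ofReal (A * ε) := by
  set v := (S i i).toNNReal with hv
  have hv0 : v ≠ 0 := by
    rw [hv]; exact (Real.toNNReal_pos.2 hS.diag_pos).ne'
  have hvpos : (0 : ℝ) < v := NNReal.coe_pos.2 (pos_iff_ne_zero.2 hv0)
  refine ⟨(√(2 * Real.pi * v))⁻¹, by positivity, fun ε hε => ?_⟩
  have hp := measurePreserving_eval_multivariateGaussian (μ := m) hS.posSemidef (i := i)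
  have h1 := hp.measure_preimage (measurableSet_Ioo (a := 0) (b := ε)).nullMeasurableSet
  have h2 : {θ : EuclideanSpace ℝ ι | 0 < θ i ∧ θ i < ε} = (fun x => x i) ⁻¹' Ioo 0 ε := rfl
  rw [h2, h1, gaussianReal_apply _ hv0]
  calc _ ≤ ∫⁻ _ in Ioo 0 ε, ENNReal.ofReal (√(2 * Real.pi * v))⁻¹ := by
        refine lintegral_mono fun x => ENNReal.ofReal_le_ofReal ?_
        rw [gaussianPDFReal]
        refine mul_le_of_le_one_right (by positivity) (Real.exp_le_one_iff.2 ?_)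
        rw [neg_div]
        exact neg_nonpos.2 (by positivity)
    _ = _ := by
        rw [setLIntegral_const, Real.volume_Ioo, sub_zero, ENNReal.ofReal_mul (by positivity)]

end GaussianPrior

/-! ### Gaussian priors conditioned on positive dispersion -/

section PosDispersion

variable {d : ℕ}

lemma isOpen_posDispersion (d : ℕ) : IsOpen (posDispersion d) :=
  isOpen_lt continuous_const (by fun_prop)

lemma closedBall_subset_posDispersion {ϑ : EuclideanSpace ℝ (Fin (d + 1))} {r : ℝ}
    (hr : r ≤ ϑ (Fin.last d) / 2) (hϑ : 0 < ϑ (Fin.last d)) :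
    Metric.closedBall ϑ r ⊆ posDispersion d := by
  intro θ hθ
  rw [mem_closedBall_iff_norm] at hθ
  have h1 := (EuclideanSpace.abs_apply_le_norm (θ - ϑ) (Fin.last d)).trans (hθ.trans hr)
  rw [PiLp.sub_apply] at h1
  have h2 := (abs_le.1 h1).1
  change 0 < θ (Fin.last d)
  linarith

lemma multivariateGaussian_posDispersion_ne_zero {m : EuclideanSpace ℝ (Fin (d + 1))}
    {S : Matrix (Fin (d + 1)) (Fin (d + 1)) ℝ} (hS : S.PosDef) :
    multivariateGaussian m S (posDispersion d) ≠ 0 := by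
  set e : EuclideanSpace ℝ (Fin (d + 1)) := EuclideanSpace.single (Fin.last d) 2 with he
  have hel : e (Fin.last d) = 2 := by simp [he]
  obtain ⟨c, hc, hle⟩ := multivariateGaussian_closedBall_ge hS m e
  have h1 := (hle 1 one_pos le_rfl).trans
    (measure_mono (closedBall_subset_posDispersion (by rw [hel]; norm_num) (by rw [hel]; norm_num)))
  exact (lt_of_lt_of_le (ENNReal.ofReal_pos.2 (by positivity)) h1).ne'

/-- Shrinking the radius by a fixed factor b keeps the ball inside the half-space, and conditioning
can only increase the mass of its subsets. -/
lemma cond_closedBall_ge {m ϑ : EuclideanSpace ℝ (Fin (d + 1))}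
    {S : Matrix (Fin (d + 1)) (Fin (d + 1)) ℝ} (hS : S.PosDef) (hϑ : 0 < ϑ (Fin.last d)) :
    ∃ c > 0, ∀ r, 0 < r → r ≤ 1 → ENNReal.ofReal (c * r ^ Fintype.card (Fin (d + 1))) ≤
      cond (multivariateGaussian m S) (posDispersion d) (Metric.closedBall ϑ r) := by
  obtain ⟨c, hc, hle⟩ := multivariateGaussian_closedBall_ge hS m ϑ
  set b := min 1 (ϑ (Fin.last d) / 2) with hb
  have hb0 : 0 < b := lt_min one_pos (by positivity)
  refine ⟨c * b ^ Fintype.card (Fin (d + 1)), by positivity, fun r hr hr1 => ?_⟩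
  have h1 := hle (b * r) (by positivity)
    (mul_le_one₀ (min_le_left _ _) hr.le hr1)
  rw [mul_pow, ← mul_assoc] at h1
  rw [cond_apply (isOpen_posDispersion d).measurableSet]
  have hsub : Metric.closedBall ϑ (b * r) ⊆ posDispersion d ∩ Metric.closedBall ϑ r :=
    subset_inter (closedBall_subset_posDispersion ((mul_le_of_le_one_right hb0.le hr1).trans
      (min_le_right _ _)) hϑ)
      (Metric.closedBall_subset_closedBall (mul_le_of_le_one_left hr.le (min_le_left _ _)))
  calc _ ≤ 1 * multivariateGaussian m S (posDispersion d ∩ Metric.closedBall ϑ r) := by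
        rw [one_mul]; exact h1.trans (measure_mono hsub)
    _ ≤ _ := by gcongr; exact ENNReal.one_le_inv.2 prob_le_one

/-- What the sieve misses is a thin slab at zero dispersion or the complement of a box; conditioning
multiplies these masses by a finite constant. -/
lemma cond_tail_le {m : EuclideanSpace ℝ (Fin (d + 1))}
    {S : Matrix (Fin (d + 1)) (Fin (d + 1)) ℝ} (hS : S.PosDef) :
    ∃ A > 0, ∀ ε R : ℝ, 0 < ε → 0 ≤ R →
      cond (multivariateGaussian m S) (posDispersion d)
        (posDispersion d \ ({ϑ | ε ≤ ϑ (Fin.last d)} ∩ {ϑ | ∀ i, |ϑ i| ≤ R})) ≤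
      ENNReal.ofReal (A * (ε + Real.exp (-R))) := by
  obtain ⟨A₁, hA₁, h₁⟩ := multivariateGaussian_box_compl_le hS m
  obtain ⟨A₂, hA₂, h₂⟩ := multivariateGaussian_slab_le hS m (Fin.last d)
  set w := multivariateGaussian m S (posDispersion d) with hw
  have hw0 : w ≠ 0 := multivariateGaussian_posDispersion_ne_zero hS
  have hwt : w⁻¹ ≠ ⊤ := ENNReal.inv_ne_top.2 hw0
  set W := w⁻¹.toReal with hW
  have hW0 : 0 ≤ W := ENNReal.toReal_nonneg
  have hWw : w⁻¹ = ENNReal.ofReal W := (ENNReal.ofReal_toReal hwt).symm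
  refine ⟨W * (A₁ + A₂) + 1, by positivity, fun ε R hε _ => ?_⟩
  rw [cond_apply (isOpen_posDispersion d).measurableSet, ← hw, hWw]
  have hsub : posDispersion d ∩ (posDispersion d \
      ({ϑ | ε ≤ ϑ (Fin.last d)} ∩ {ϑ | ∀ i, |ϑ i| ≤ R})) ⊆
      {θ | 0 < θ (Fin.last d) ∧ θ (Fin.last d) < ε} ∪ {θ | ¬ ∀ i, |θ i| ≤ R} := by
    rintro θ ⟨hθ, -, hno⟩
    by_cases hR : ∀ i, |θ i| ≤ R
    · refine Or.inl ⟨hθ, ?_⟩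
      by_contra! hle
      exact hno ⟨hle, hR⟩
    · exact Or.inr hR
  calc _ ≤ ENNReal.ofReal W * (ENNReal.ofReal (A₂ * ε) + ENNReal.ofReal (A₁ * Real.exp (-R))) := by
        gcongr
        exact (measure_mono hsub).trans ((measure_union_le _ _).trans (add_le_add (h₂ ε hε) (h₁ R)))
    _ = ENNReal.ofReal (W * (A₂ * ε + A₁ * Real.exp (-R))) := by
        rw [← ENNReal.ofReal_add (by positivity) (by positivity), ENNReal.ofReal_mul hW0]
    _ ≤ _ := by
        refine ENNReal.ofReal_le_ofReal ?_
        have h3 := Real.exp_pos (-R)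
        have h4 : 0 ≤ W * A₁ * ε := by positivity
        have h5 : 0 ≤ W * A₂ * Real.exp (-R) := by positivity
        nlinarith

lemma gaussian_tail_le {m : EuclideanSpace ℝ (Fin d)} {S : Matrix (Fin d) (Fin d) ℝ}
    (hS : S.PosDef) : ∃ A > 0, ∀ ε R : ℝ, 0 < ε → 0 ≤ R →
      multivariateGaussian m S (univ \ (univ ∩ {ϑ | ∀ i, |ϑ i| ≤ R})) ≤
      ENNReal.ofReal (A * (ε + Real.exp (-R))) := by
  obtain ⟨A, hA, hle⟩ := multivariateGaussian_box_compl_le hS m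
  refine ⟨A, hA, fun ε R hε _ => ?_⟩
  have e : univ \ (univ ∩ {ϑ : EuclideanSpace ℝ (Fin d) | ∀ i, |ϑ i| ≤ R}) =
      {ϑ | ¬ ∀ i, |ϑ i| ≤ R} := by ext; simp
  rw [e]
  exact (hle R).trans (ENNReal.ofReal_le_ofReal (by gcongr; linarith))

end PosDispersion

/-! ### Nondegenerate designs -/

section Design

variable {d : ℕ}

lemma Covariate.abs_le_one (w : Covariate d) (i : Fin d) : |w.1 i| ≤ 1 :=
  abs_le.2 ⟨w.2.1 i, w.2.2 i⟩

lemma measurable_linPred (θ : EuclideanSpace ℝ (Fin d)) : Measurable (linPred θ) := by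
  unfold linPred
  refine Finset.measurable_sum _ fun i _ => ?_
  exact ((measurable_pi_apply i).comp measurable_subtype_coe).const_mul _

lemma abs_linPred_le_sum (θ : EuclideanSpace ℝ (Fin d)) (w : Covariate d) :
    |linPred θ w| ≤ ∑ i, |θ i| := by
  refine (Finset.abs_sum_le_sum_abs _ _).trans (Finset.sum_le_sum fun i _ => ?_)
  rw [abs_mul]
  exact mul_le_of_le_one_right (abs_nonneg _) (w.abs_le_one i)

lemma abs_linPred_le (θ : EuclideanSpace ℝ (Fin d)) (w : Covariate d) :
    |linPred θ w| ≤ d * ‖θ‖ := by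
  refine (abs_linPred_le_sum θ w).trans ?_
  calc ∑ i, |θ i| ≤ ∑ _i : Fin d, ‖θ‖ :=
        Finset.sum_le_sum fun i _ => EuclideanSpace.abs_apply_le_norm θ i
    _ = _ := by simp

lemma linPred_sub (θ θ' : EuclideanSpace ℝ (Fin d)) (w : Covariate d) :
    linPred (θ - θ') w = linPred θ w - linPred θ' w := by
  simp [linPred, sub_mul, Finset.sum_sub_distrib]

lemma linPred_add_smul (θ u : EuclideanSpace ℝ (Fin d)) (ξ : ℝ) (w : Covariate d) :
    linPred (θ + ξ • u) w = linPred θ w + ξ * linPred u w := by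
  simp [linPred, add_mul, Finset.sum_add_distrib, Finset.mul_sum, mul_assoc]

lemma integrable_linPred_sq (ν : Measure (Covariate d)) [IsProbabilityMeasure ν]
    (θ : EuclideanSpace ℝ (Fin d)) : Integrable (fun w => linPred θ w ^ 2) ν := by
  refine Integrable.of_bound ((measurable_linPred θ).pow_const 2).aestronglyMeasurable
    ((d * ‖θ‖) ^ 2) (ae_of_all _ fun w => ?_)
  rw [Real.norm_of_nonneg (sq_nonneg _), ← sq_abs]
  exact pow_le_pow_left₀ (abs_nonneg _) (abs_linPred_le θ w) 2

/-- The second moment form is continuous and positive on the compact unit sphere; homogeneity of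
degree two extends the minimum to all vectors. -/
lemma NondegenerateDesign.exists_sq_ge {ν : Measure (Covariate d)} [IsProbabilityMeasure ν]
    (hν : NondegenerateDesign ν) : ∃ c > 0, ∀ θ : EuclideanSpace ℝ (Fin d),
      c * ‖θ‖ ^ 2 ≤ ∫ w, linPred θ w ^ 2 ∂ν := by
  set G : EuclideanSpace ℝ (Fin d) → ℝ := fun θ => ∫ w, linPred θ w ^ 2 ∂ν with hG
  have hpos : ∀ θ, θ ≠ 0 → 0 < G θ := fun θ hθ => hν (WithLp.ofLp θ) (by
    intro h0; exact hθ (by ext i; simpa using congrFun h0 i))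
  have hcont : Continuous G := by
    refine continuous_iff_continuousAt.2 fun θ₀ => ?_
    refine continuousAt_of_dominated (bound := fun _ => (d * (‖θ₀‖ + 1)) ^ 2)
      (Eventually.of_forall fun θ => ((measurable_linPred θ).pow_const 2).aestronglyMeasurable)
      ?_ (integrable_const _) (ae_of_all _ fun w => ?_)
    · have h1 : ∀ᶠ θ in 𝓝 θ₀, ‖θ‖ < ‖θ₀‖ + 1 :=
        continuous_norm.continuousAt.eventually_lt_const (by linarith)
      filter_upwards [h1] with θ hθ
      refine ae_of_all _ fun w => ?_
      rw [Real.norm_of_nonneg (sq_nonneg _), ← sq_abs]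
      exact pow_le_pow_left₀ (abs_nonneg _) ((abs_linPred_le θ w).trans (by gcongr)) 2
    · unfold linPred; fun_prop
  have hhom : ∀ (t : ℝ) θ, G (t • θ) = t ^ 2 * G θ := by
    intro t θ
    simp only [hG]
    rw [← integral_const_mul]
    refine integral_congr_ae (ae_of_all _ fun w => ?_)
    have := linPred_add_smul 0 θ t w
    simp only [zero_add] at this
    simp only [this]
    simp [linPred, mul_pow]
  rcases (Metric.sphere (0 : EuclideanSpace ℝ (Fin d)) 1).eq_empty_or_nonempty with he | hne
  · refine ⟨1, one_pos, fun θ => ?_⟩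
    have h0 : θ = 0 := by
      by_contra hθ
      have : (‖θ‖⁻¹ • θ) ∈ Metric.sphere (0 : EuclideanSpace ℝ (Fin d)) 1 := by
        rw [mem_sphere_zero_iff_norm, norm_smul, norm_inv, norm_norm,
          inv_mul_cancel₀ (norm_ne_zero_iff.2 hθ)]
      rw [he] at this
      exact this
    rw [h0]
    simpa using integral_nonneg fun w => sq_nonneg (linPred (0 : EuclideanSpace ℝ (Fin d)) w)
  · obtain ⟨e, he, hmin⟩ := (isCompact_sphere (0 : EuclideanSpace ℝ (Fin d)) 1).exists_isMinOn
      hne hcont.continuousOn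
    have he0 : e ≠ 0 := by
      intro h0
      rw [h0] at he
      simp at he
    refine ⟨G e, hpos e he0, fun θ => ?_⟩
    rcases eq_or_ne θ 0 with rfl | hθ
    · simpa using integral_nonneg fun w => sq_nonneg (linPred (0 : EuclideanSpace ℝ (Fin d)) w)
    have hn := norm_pos_iff.2 hθ
    have hmem : (‖θ‖⁻¹ • θ) ∈ Metric.sphere (0 : EuclideanSpace ℝ (Fin d)) 1 := by
      rw [mem_sphere_zero_iff_norm, norm_smul, norm_inv, norm_norm, inv_mul_cancel₀ hn.ne']
    have h1 : G e ≤ G (‖θ‖⁻¹ • θ) := hmin hmem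
    rw [hhom] at h1
    change G e * ‖θ‖ ^ 2 ≤ G θ
    calc G e * ‖θ‖ ^ 2 ≤ (‖θ‖⁻¹ ^ 2 * G θ) * ‖θ‖ ^ 2 := by gcongr
      _ = G θ := by field_simp

lemma integrable_min_abs_linPred (ν : Measure (Covariate d)) [IsProbabilityMeasure ν]
    (θ : EuclideanSpace ℝ (Fin d)) : Integrable (fun w => min |linPred θ w| 1) ν := by
  refine Integrable.of_bound
    ((measurable_linPred θ).abs.min measurable_const).aestronglyMeasurable 1
    (ae_of_all _ fun w => ?_)
  rw [Real.norm_of_nonneg (le_min (abs_nonneg _) zero_le_one)]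
  exact min_le_right _ _

/-- Covariates are bounded, so s = |θᵀw| ≤ b = d‖θ‖ and s² ≤ b(b + 1) min(s, 1). This turns the
quadratic lower bound into one for truncated absolute values. -/
lemma NondegenerateDesign.exists_min_ge {ν : Measure (Covariate d)} [IsProbabilityMeasure ν]
    (hν : NondegenerateDesign ν) (hd : 0 < d) : ∃ c > 0, ∀ θ : EuclideanSpace ℝ (Fin d),
      c * min ‖θ‖ 1 ≤ ∫ w, min |linPred θ w| 1 ∂ν := by
  obtain ⟨c, hc, hle⟩ := hν.exists_sq_ge
  have hd0 : (0 : ℝ) < d := by exact_mod_cast hd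
  refine ⟨c / (d * (d + 1)), by positivity, fun θ => ?_⟩
  rcases eq_or_ne θ 0 with rfl | hθ
  · rw [norm_zero, min_eq_left zero_le_one, mul_zero]
    exact integral_nonneg fun w => le_min (abs_nonneg _) zero_le_one
  have hn := norm_pos_iff.2 hθ
  set N := ‖θ‖ with hN
  set b := d * N with hb
  have hb0 : 0 < b := by positivity
  have h1 : ∫ w, linPred θ w ^ 2 ∂ν ≤ ∫ w, b * (b + 1) * min |linPred θ w| 1 ∂ν := by
    refine integral_mono (integrable_linPred_sq ν θ)
      ((integrable_min_abs_linPred ν θ).const_mul _) fun w => ?_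
    have h2 := abs_linPred_le θ w
    rw [← hN, ← hb] at h2
    beta_reduce
    rw [← sq_abs]
    have h3 := abs_nonneg (linPred θ w)
    set s := |linPred θ w|
    rcases le_total s 1 with h4 | h4
    · rw [min_eq_left h4]
      nlinarith [mul_nonneg h3 hb0.le, mul_nonneg (mul_nonneg h3 hb0.le) hb0.le]
    · rw [min_eq_right h4]
      nlinarith
  rw [integral_const_mul] at h1
  set I := ∫ w, min |linPred θ w| 1 ∂ν
  have h5 : c * N ^ 2 ≤ b * (b + 1) * I := (hle θ).trans h1
  have h6 : c * N ≤ d * (b + 1) * I := by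
    refine le_of_mul_le_mul_right ?_ hn
    calc c * N * N = c * N ^ 2 := by ring
      _ ≤ _ := h5
      _ = _ := by rw [hb]; ring
  have h7 : min N 1 * (b + 1) ≤ N * (d + 1) := by
    rcases le_total N 1 with h8 | h8
    · rw [min_eq_left h8, hb]; gcongr; nlinarith
    · rw [min_eq_right h8, hb]; nlinarith
  rw [div_mul_eq_mul_div, div_le_iff₀ (by positivity)]
  refine le_of_mul_le_mul_right ?_ (show 0 < b + 1 by positivity)
  calc c * min N 1 * (b + 1) = c * (min N 1 * (b + 1)) := by ring
    _ ≤ c * (N * (d + 1)) := by gcongr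
    _ = (c * N) * (d + 1) := by ring
    _ ≤ (d * (b + 1) * I) * (d + 1) := by gcongr
    _ = _ := by ring

end Design

/-! ### Location-scale families -/

/-- A positive probability density on `ℝ` that is unimodal with mode `0`. -/
structure IsUnimodalDensity (f₀ : ℝ → ℝ) : Prop where
  measurable : Measurable f₀
  pos : ∀ x, 0 < f₀ x
  mono : MonotoneOn f₀ (Iic 0)
  anti : AntitoneOn f₀ (Ici 0)
  integrable : Integrable f₀
  integral_eq_one : ∫ x, f₀ x = 1

lemma integrable_comp_affine {F : ℝ → ℝ} (hF : Integrable F) (a : ℝ) {s : ℝ} (hs : 0 < s) :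
    Integrable fun x => F ((x - a) / s) :=
  (hF.comp_div hs.ne').comp_sub_right a

lemma integral_comp_affine (F : ℝ → ℝ) (a : ℝ) {s : ℝ} (hs : 0 < s) :
    ∫ x, F ((x - a) / s) = s * ∫ x, F x := by
  rw [integral_sub_right_eq_self (fun x => F (x / s)) a, Measure.integral_comp_div, abs_of_pos hs,
    smul_eq_mul]

section Product

variable {W : Type} [MeasurableSpace W] (ν : Measure W) [IsProbabilityMeasure ν]

/-- By translation invariance the inner integral of the norm does not depend on w. -/
lemma integrable_prod_of_shift {F : ℝ → ℝ} (hF : Integrable F) (hFm : Measurable F) {a : W → ℝ}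
    (ha : Measurable a) :
    Integrable (fun z : ℝ × W => F (z.1 - a z.2)) ((volume : Measure ℝ).prod ν) := by
  have hm : Measurable fun z : ℝ × W => F (z.1 - a z.2) :=
    hFm.comp (measurable_fst.sub (ha.comp measurable_snd))
  rw [integrable_prod_iff' hm.aestronglyMeasurable]
  refine ⟨ae_of_all _ fun w => hF.comp_sub_right (a w), ?_⟩
  have e : ∀ w, ∫ x, ‖F (x - a w)‖ = ∫ x, ‖F x‖ := fun w =>
    integral_sub_right_eq_self (fun x => ‖F x‖) (a w)
  simp only [e]
  exact integrable_const _

lemma integral_prod_of_shift {F : ℝ → ℝ} (hF : Integrable F) (hFm : Measurable F) {a : W → ℝ}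
    (ha : Measurable a) :
    ∫ z : ℝ × W, F (z.1 - a z.2) ∂((volume : Measure ℝ).prod ν) = ∫ x, F x := by
  rw [integral_prod_symm _ (integrable_prod_of_shift ν hF hFm ha)]
  have e : ∀ w, ∫ x, F (x - a w) = ∫ x, F x := fun w => integral_sub_right_eq_self F (a w)
  simp [e]

end Product

namespace IsUnimodalDensity

variable {f₀ : ℝ → ℝ}

lemma le_zero_val (hf : IsUnimodalDensity f₀) (x : ℝ) : f₀ x ≤ f₀ 0 := by
  rcases le_total x 0 with h | h
  · exact hf.mono h self_mem_Iic h
  · exact hf.anti self_mem_Ici h h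

lemma integrable_scale (hf : IsUnimodalDensity f₀) (a : ℝ) {s : ℝ} (hs : 0 < s) :
    Integrable fun x => s⁻¹ * f₀ ((x - a) / s) :=
  (integrable_comp_affine hf.integrable a hs).const_mul _

lemma integral_scale (hf : IsUnimodalDensity f₀) (a : ℝ) {s : ℝ} (hs : 0 < s) :
    ∫ x, s⁻¹ * f₀ ((x - a) / s) = 1 := by
  rw [integral_const_mul, integral_comp_affine f₀ a hs, hf.integral_eq_one, mul_one,
    inv_mul_cancel₀ hs.ne']

lemma lintegral_prod_scale (hf : IsUnimodalDensity f₀) {W : Type} [MeasurableSpace W]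
    (ν : Measure W) [IsProbabilityMeasure ν] {a : W → ℝ} (ha : Measurable a) {s : ℝ} (hs : 0 < s) :
    ∫⁻ z : ℝ × W, ENNReal.ofReal (s⁻¹ * f₀ ((z.1 - a z.2) / s)) ∂((volume : Measure ℝ).prod ν) =
      1 := by
  have hFm : Measurable fun x => s⁻¹ * f₀ (x / s) :=
    (hf.measurable.comp (measurable_id.div_const s)).const_mul _
  have hFi : Integrable fun x => s⁻¹ * f₀ (x / s) := by simpa using hf.integrable_scale 0 hs
  have h1 : ∫ x, s⁻¹ * f₀ (x / s) = 1 := by simpa using hf.integral_scale 0 hs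
  have hi := integrable_prod_of_shift ν hFi hFm ha
  rw [← ofReal_integral_eq_lintegral_ofReal hi (ae_of_all _ fun z =>
    mul_nonneg (inv_nonneg.2 hs.le) (hf.pos _).le), integral_prod_of_shift ν hFi hFm ha, h1,
    ENNReal.ofReal_one]

/-- Brackets for location-scale densities whose parameters lie in a small cell. -/
lemma exists_bracket (hf : IsUnimodalDensity f₀) {W : Type} [MeasurableSpace W] (ν : Measure W)
    [IsProbabilityMeasure ν] {a₀ : W → ℝ} (ha₀ : Measurable a₀) {s₀ η : ℝ} (hs₀ : 0 < s₀)
    (hη : 0 < η) (hη2 : η ≤ 1 / 2) :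
    ∃ L U : ℝ × W → ℝ, (∀ z, 0 ≤ L z) ∧ (∀ z, L z ≤ U z) ∧ Measurable L ∧ Measurable U ∧
      Integrable L ((volume : Measure ℝ).prod ν) ∧ Integrable U ((volume : Measure ℝ).prod ν) ∧
      (∫ z, U z ∂((volume : Measure ℝ).prod ν) - ∫ z, L z ∂((volume : Measure ℝ).prod ν) ≤
        (6 + 8 * f₀ 0) * η) ∧
      ∀ a s, |s - s₀| ≤ η * s₀ → ∀ z : ℝ × W, |a - a₀ z.2| ≤ η * s₀ →
        L z ≤ s⁻¹ * f₀ ((z.1 - a) / s) ∧ s⁻¹ * f₀ ((z.1 - a) / s) ≤ U z := by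
  set e := η * s₀ with he
  set s₁ := s₀ * (1 - η) with hs₁
  set s₂ := s₀ * (1 + η) with hs₂
  have he0 : 0 < e := by positivity
  have hs₁0 : 0 < s₁ := mul_pos hs₀ (by linarith)
  have hs₂0 : 0 < s₂ := mul_pos hs₀ (by linarith)
  have h00 := hf.pos 0
  set fp := indicator (Ioi 0) f₀ with hfp
  set fm := indicator (Iio 0) f₀ with hfm
  -- The lower halves start at 2e/s₁ so that, after the shift by e, they vanish for |y| ≤ e, where
  -- the sign of the true argument is unknown.
  set gp := indicator (Ioi (2 * e / s₁)) f₀ with hgp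
  set gm := indicator (Iio (-(2 * e / s₁))) f₀ with hgm
  have hfpm : Measurable fp := hf.measurable.indicator measurableSet_Ioi
  have hfmm : Measurable fm := hf.measurable.indicator measurableSet_Iio
  have hgpm : Measurable gp := hf.measurable.indicator measurableSet_Ioi
  have hgmm : Measurable gm := hf.measurable.indicator measurableSet_Iio
  have hfpi : Integrable fp := hf.integrable.indicator measurableSet_Ioi
  have hfmi : Integrable fm := hf.integrable.indicator measurableSet_Iio
  have hgpi : Integrable gp := hf.integrable.indicator measurableSet_Ioi
  have hgmi : Integrable gm := hf.integrable.indicator measurableSet_Iio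
  have hci : ∀ b : ℝ, Integrable ((Icc (-b) b).indicator fun _ => f₀ 0) := fun b =>
    (integrableOn_const (by rw [Real.volume_Icc]; exact ENNReal.ofReal_ne_top)).integrable_indicator
      measurableSet_Icc
  have hcv : ∀ b : ℝ, 0 ≤ b → ∫ x, (Icc (-b) b).indicator (fun _ => f₀ 0) x = 2 * b * f₀ 0 := by
    intro b hb
    rw [integral_indicator measurableSet_Icc, setIntegral_const, smul_eq_mul,
      Real.volume_real_Icc_of_le (by linarith)]
    ring
  -- Upper end: smallest scale in the prefactor, and on each side of the mode the argument moved as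
  -- close to zero as the cell allows; near the mode the peak value f₀(0) is used. The lower end
  -- makes the opposite choices.
  set FU : ℝ → ℝ := fun y => s₁⁻¹ * (fp ((y - e) / s₂) + fm ((y - (-e)) / s₂) +
    (Icc (-e) e).indicator (fun _ => f₀ 0) y) with hFU
  set FL : ℝ → ℝ := fun y => s₂⁻¹ * (gp ((y - (-e)) / s₁) + gm ((y - e) / s₁)) with hFL
  have hFUm : Measurable FU := by
    have : Measurable ((Icc (-e) e).indicator fun _ => f₀ 0) :=
      measurable_const.indicator measurableSet_Icc
    simp only [hFU]
    exact (((hfpm.comp ((measurable_id.sub_const _).div_const _)).add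
      (hfmm.comp ((measurable_id.sub_const _).div_const _))).add this).const_mul _
  have hFLm : Measurable FL := by
    simp only [hFL]
    exact ((hgpm.comp ((measurable_id.sub_const _).div_const _)).add
      (hgmm.comp ((measurable_id.sub_const _).div_const _))).const_mul _
  have i1 := integrable_comp_affine hfpi e hs₂0
  have i2 := integrable_comp_affine hfmi (-e) hs₂0
  have i3 := integrable_comp_affine hgpi (-e) hs₁0
  have i4 := integrable_comp_affine hgmi e hs₁0
  have hFUi : Integrable FU := ((i1.add i2).add (hci e)).const_mul _
  have hFLi : Integrable FL := (i3.add i4).const_mul _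
  have hFUv : ∫ y, FU y ≤ s₁⁻¹ * (s₂ + 2 * e * f₀ 0) := by
    simp only [hFU]
    rw [integral_const_mul, integral_add (by exact i1.add i2) (hci e), integral_add i1 i2,
      hcv e he0.le, integral_comp_affine fp e hs₂0, integral_comp_affine fm (-e) hs₂0]
    refine mul_le_mul_of_nonneg_left ?_ (inv_nonneg.2 hs₁0.le)
    have h1 : ∫ x, (fp x + fm x) ≤ ∫ x, f₀ x := by
      refine integral_mono (hfpi.add hfmi) hf.integrable fun x => ?_
      simp only [hfp, hfm, indicator_apply, mem_Ioi, mem_Iio]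
      have := hf.pos x
      split_ifs <;> linarith
    rw [integral_add hfpi hfmi, hf.integral_eq_one] at h1
    nlinarith
  have hFLv : s₂⁻¹ * (s₁ - 4 * e * f₀ 0) ≤ ∫ y, FL y := by
    simp only [hFL]
    rw [integral_const_mul, integral_add i3 i4, integral_comp_affine gp (-e) hs₁0,
      integral_comp_affine gm e hs₁0]
    refine mul_le_mul_of_nonneg_left ?_ (inv_nonneg.2 hs₂0.le)
    -- Cutting out the centre loses at most its length times the peak f₀(0).
    have h1 : ∫ x, f₀ x ≤
        ∫ x, (gp x + gm x + (Icc (-(2 * e / s₁)) (2 * e / s₁)).indicator (fun _ => f₀ 0) x) := by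
      refine integral_mono hf.integrable ((hgpi.add hgmi).add (hci _)) fun x => ?_
      simp only [hgp, hgm, indicator_apply, mem_Ioi, mem_Iio, mem_Icc]
      have h2 := hf.pos x
      have h3 := hf.le_zero_val x
      by_cases h4 : 2 * e / s₁ < x
      · rw [if_pos h4]; split_ifs <;> linarith
      · by_cases h5 : x < -(2 * e / s₁)
        · rw [if_pos h5]; split_ifs <;> linarith
        · rw [if_neg h4, if_neg h5, if_pos ⟨not_lt.1 h5, not_lt.1 h4⟩]; linarith
    rw [integral_add (by exact hgpi.add hgmi) (hci _), integral_add hgpi hgmi,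
      hf.integral_eq_one, hcv _ (by positivity)] at h1
    have h2 := mul_le_mul_of_nonneg_left h1 hs₁0.le
    have h3 : s₁ * (2 * (2 * e / s₁) * f₀ 0) = 4 * e * f₀ 0 := by field_simp; ring
    nlinarith
  have hcell : ∀ a s, |s - s₀| ≤ e → ∀ z : ℝ × W, |a - a₀ z.2| ≤ e →
      FL (z.1 - a₀ z.2) ≤ s⁻¹ * f₀ ((z.1 - a) / s) ∧
      s⁻¹ * f₀ ((z.1 - a) / s) ≤ FU (z.1 - a₀ z.2) := by
    intro a s hs z ha
    obtain ⟨hs1, hs2⟩ := abs_le.1 hs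
    obtain ⟨ha1, ha2⟩ := abs_le.1 ha
    have hs1' : s₁ ≤ s := by rw [hs₁]; nlinarith
    have hs2' : s ≤ s₂ := by rw [hs₂]; nlinarith
    have hs0 : 0 < s := lt_of_lt_of_le hs₁0 hs1'
    have hv := hf.pos ((z.1 - a) / s)
    set y := z.1 - a₀ z.2 with hy
    set x := (z.1 - a) / s with hx
    -- To the right of e, the argument x is positive for all parameters in the cell and lies between
    -- the extreme arguments; `hL` is the mirror image.
    have hR : e < y → 0 < (y - e) / s₂ ∧ (y - e) / s₂ ≤ x ∧ x ≤ (y - -e) / s₁ := fun h =>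
      ⟨div_pos (by linarith) hs₂0, div_le_div₀ (by linarith) (by linarith) hs0 hs2',
        div_le_div₀ (by linarith) (by linarith) hs₁0 hs1'⟩
    have hL : y < -e → (y - -e) / s₂ < 0 ∧ x ≤ (y - -e) / s₂ ∧ (y - e) / s₁ ≤ x := by
      intro h
      have h1 : (-(y - -e)) / s₂ ≤ (-(z.1 - a)) / s :=
        div_le_div₀ (by linarith) (by linarith) hs0 hs2'
      have h2 : (-(z.1 - a)) / s ≤ (-(y - e)) / s₁ :=
        div_le_div₀ (by linarith) (by linarith) hs₁0 hs1'
      rw [neg_div, neg_div] at h1 h2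
      exact ⟨div_neg_of_neg_of_pos (by linarith) hs₂0, by linarith, by linarith⟩
    constructor
    · have hle : gp ((y - -e) / s₁) + gm ((y - e) / s₁) ≤ f₀ x := by
        have c1 : 2 * e / s₁ < (y - -e) / s₁ ↔ e < y := by
          rw [div_lt_div_iff_of_pos_right hs₁0]; constructor <;> intro h <;> linarith
        have c2 : (y - e) / s₁ < -(2 * e / s₁) ↔ y < -e := by
          rw [← neg_div, div_lt_div_iff_of_pos_right hs₁0]; constructor <;> intro h <;> linarith
        simp only [hgp, hgm, indicator_apply, mem_Ioi, mem_Iio, c1, c2]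
        by_cases h1 : e < y
        · obtain ⟨k1, k2, k3⟩ := hR h1
          rw [if_pos h1, if_neg (by linarith), add_zero]
          exact hf.anti (k1.le.trans k2) ((k1.le.trans k2).trans k3) k3
        · by_cases h2 : y < -e
          · obtain ⟨k1, k2, k3⟩ := hL h2
            rw [if_neg h1, if_pos h2, zero_add]
            exact hf.mono (k3.trans (k2.trans k1.le)) (k2.trans k1.le) k3
          · rw [if_neg h1, if_neg h2, add_zero]; exact hv.le
      calc _ ≤ s₂⁻¹ * f₀ x := mul_le_mul_of_nonneg_left hle (inv_nonneg.2 hs₂0.le)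
        _ ≤ _ := mul_le_mul_of_nonneg_right (inv_anti₀ hs0 hs2') hv.le
    · have hle : f₀ x ≤ fp ((y - e) / s₂) + fm ((y - -e) / s₂) +
          (Icc (-e) e).indicator (fun _ => f₀ 0) y := by
        have n1 : 0 ≤ fp ((y - e) / s₂) := indicator_nonneg (fun t _ => (hf.pos t).le) _
        have n2 : 0 ≤ fm ((y - -e) / s₂) := indicator_nonneg (fun t _ => (hf.pos t).le) _
        have n3 : 0 ≤ (Icc (-e) e).indicator (fun _ => f₀ 0) y :=
          indicator_nonneg (fun t _ => h00.le) _
        by_cases h1 : e < y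
        · obtain ⟨k1, k2, k3⟩ := hR h1
          have : fp ((y - e) / s₂) = f₀ ((y - e) / s₂) :=
            indicator_of_mem (s := Ioi 0) (show _ ∈ Ioi (0 : ℝ) from k1) f₀
          have := hf.anti k1.le (k1.le.trans k2) k2
          linarith
        · by_cases h2 : y < -e
          · obtain ⟨k1, k2, k3⟩ := hL h2
            have : fm ((y - -e) / s₂) = f₀ ((y - -e) / s₂) :=
              indicator_of_mem (s := Iio 0) (show _ ∈ Iio (0 : ℝ) from k1) f₀
            have := hf.mono (k2.trans k1.le) k1.le k2
            linarith
          · have : (Icc (-e) e).indicator (fun _ => f₀ 0) y = f₀ 0 :=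
              indicator_of_mem (show y ∈ Icc (-e) e from ⟨not_lt.1 h2, not_lt.1 h1⟩) _
            linarith [hf.le_zero_val x]
      calc _ ≤ s₁⁻¹ * f₀ x := mul_le_mul_of_nonneg_right (inv_anti₀ hs₁0 hs1') hv.le
        _ ≤ _ := mul_le_mul_of_nonneg_left hle (inv_nonneg.2 hs₁0.le)
  refine ⟨fun z => FL (z.1 - a₀ z.2), fun z => FU (z.1 - a₀ z.2), fun z => ?_, fun z => ?_,
    hFLm.comp (measurable_fst.sub (ha₀.comp measurable_snd)),
    hFUm.comp (measurable_fst.sub (ha₀.comp measurable_snd)),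
    integrable_prod_of_shift ν hFLi hFLm ha₀, integrable_prod_of_shift ν hFUi hFUm ha₀, ?_, hcell⟩
  · exact mul_nonneg (inv_nonneg.2 hs₂0.le) (add_nonneg
      (indicator_nonneg (fun t _ => (hf.pos t).le) _)
      (indicator_nonneg (fun t _ => (hf.pos t).le) _))
  · have := hcell (a₀ z.2) s₀ (by simpa using he0.le) z (by simpa using he0.le)
    exact this.1.trans this.2
  · rw [integral_prod_of_shift ν hFUi hFUm ha₀, integral_prod_of_shift ν hFLi hFLm ha₀]
    -- The factors s₀ cancel, so the bracket width depends only on the relative cell size η. Here η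
    -- ≤ 1/2 controls 1/(1 - η).
    have h1 : s₁⁻¹ * (s₂ + 2 * e * f₀ 0) ≤ 1 + (4 + 4 * f₀ 0) * η := by
      rw [inv_mul_le_iff₀ hs₁0, hs₁, hs₂, he]
      have : 0 ≤ s₀ * (η * (1 + f₀ 0) * (2 - 4 * η)) := by
        have : 0 ≤ 2 - 4 * η := by linarith
        positivity
      nlinarith
    have h2 : 1 - (2 + 4 * f₀ 0) * η ≤ s₂⁻¹ * (s₁ - 4 * e * f₀ 0) := by
      rw [inv_mul_eq_div, le_div_iff₀ hs₂0, hs₁, hs₂, he]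
      have : 0 ≤ s₀ * (η * η * (2 + 4 * f₀ 0)) := by positivity
      nlinarith
    linarith

/-- Distribution functions grow at least linearly near `0` and `1`. -/
lemma exists_cdf_ge (hf : IsUnimodalDensity f₀) : ∃ c > 0, ∀ t y : ℝ, 0 ≤ t → t ≤ 1 →
    c * min |y - t| 1 ≤ |(∫ x in Iic y, f₀ x) - ∫ x in Iic t, f₀ x| := by
  -- By unimodality the minimum of the density over [-1, 2] is attained at an endpoint; this
  -- interval contains every point within distance one of [0, 1].
  set c := min (f₀ (-1)) (f₀ 2) with hc
  have hc0 : 0 < c := lt_min (hf.pos _) (hf.pos _)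
  have hge : ∀ x, -1 ≤ x → x ≤ 2 → c ≤ f₀ x := by
    intro x h1 h2
    rcases le_total x 0 with h | h
    · exact (min_le_left _ _).trans (hf.mono (by norm_num : (-1 : ℝ) ≤ 0) h h1)
    · exact (min_le_right _ _).trans (hf.anti h (by norm_num : (0 : ℝ) ≤ 2) h2)
  have hseg : ∀ a b : ℝ, a ≤ b →
      (∫ x in Iic b, f₀ x) - ∫ x in Iic a, f₀ x = ∫ x in Ioc a b, f₀ x := by
    intro a b hab
    rw [intervalIntegral.integral_Iic_sub_Iic hf.integrable.integrableOn
      hf.integrable.integrableOn, intervalIntegral.integral_of_le hab]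
  have hlow : ∀ a b a' b' : ℝ, a ≤ a' → a' ≤ b' → b' ≤ b → -1 ≤ a' → b' ≤ 2 →
      c * (b' - a') ≤ ∫ x in Ioc a b, f₀ x := by
    intro a b a' b' h1 h2 h3 h4 h5
    calc c * (b' - a') = ∫ _ in Ioc a' b', c := by
          rw [setIntegral_const, smul_eq_mul, Real.volume_real_Ioc_of_le h2, mul_comm]
      _ ≤ ∫ x in Ioc a' b', f₀ x :=
          setIntegral_mono_on (integrableOn_const (by simp)) hf.integrable.integrableOn
            measurableSet_Ioc fun x hx => hge x (by linarith [hx.1]) (by linarith [hx.2])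
      _ ≤ _ := setIntegral_mono_set hf.integrable.integrableOn
          (ae_of_all _ fun x => (hf.pos x).le) (Ioc_subset_Ioc h1 h3).eventuallyLE
  refine ⟨c, hc0, fun t y ht0 ht1 => ?_⟩
  rcases le_total t y with h | h
  · rw [hseg t y h, abs_of_nonneg (by linarith : 0 ≤ y - t)]
    refine le_trans ?_ (le_abs_self _)
    have h1 := min_le_left (y - t) 1
    have h2 := min_le_right (y - t) 1
    have h3 : 0 ≤ min (y - t) 1 := le_min (by linarith) zero_le_one
    have := hlow t y t (t + min (y - t) 1) le_rfl (by linarith) (by linarith) (by linarith)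
      (by linarith)
    simpa using this
  · rw [abs_sub_comm (∫ x in Iic y, f₀ x), hseg y t h, abs_sub_comm,
      abs_of_nonneg (by linarith : 0 ≤ t - y)]
    refine le_trans ?_ (le_abs_self _)
    have h1 := min_le_left (t - y) 1
    have h2 := min_le_right (t - y) 1
    have h3 : 0 ≤ min (t - y) 1 := le_min (by linarith) zero_le_one
    have := hlow y t (t - min (t - y) 1) t (by linarith) (by linarith) le_rfl (by linarith)
      (by linarith)
    simpa using this

lemma setIntegral_Iic_scale (f₀ : ℝ → ℝ) (a b : ℝ) {s : ℝ} (hs : 0 < s) :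
    ∫ x in Iic b, s⁻¹ * f₀ ((x - a) / s) = ∫ x in Iic ((b - a) / s), f₀ x := by
  rw [← integral_indicator measurableSet_Iic, ← integral_indicator measurableSet_Iic]
  have e : ∀ x, (Iic b).indicator (fun x => s⁻¹ * f₀ ((x - a) / s)) x =
      s⁻¹ * (Iic ((b - a) / s)).indicator f₀ ((x - a) / s) := by
    intro x
    have hiff : (x - a) / s ≤ (b - a) / s ↔ x ≤ b := by
      rw [div_le_div_iff_of_pos_right hs]; constructor <;> intro h <;> linarith
    simp only [indicator_apply, mem_Iic, hiff]
    split_ifs <;> simp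
  simp only [e]
  rw [integral_const_mul, integral_comp_affine ((Iic ((b - a) / s)).indicator f₀) a hs,
    ← mul_assoc, inv_mul_cancel₀ hs.ne', one_mul]

/-- Location-scale densities are separated in total variation. -/
lemma exists_separation (hf : IsUnimodalDensity f₀) {s' : ℝ} (hs' : 0 < s') :
    ∃ c > 0, ∀ a a' s : ℝ, 0 < s → c * min (max |a - a'| |s - s'|) 1 ≤
      ∫ x, |s⁻¹ * f₀ ((x - a) / s) - s'⁻¹ * f₀ ((x - a') / s')| := by
  obtain ⟨c, hc, hcdf⟩ := hf.exists_cdf_ge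
  refine ⟨min (c / 4) (c / (4 * s')), lt_min (by positivity) (by positivity),
    fun a a' s hs => ?_⟩
  have hi := hf.integrable_scale a hs
  have hi' := hf.integrable_scale a' hs'
  set δ := ∫ x, |s⁻¹ * f₀ ((x - a) / s) - s'⁻¹ * f₀ ((x - a') / s')| with hδ
  -- Total variation dominates the difference of distribution functions, tested on half-lines.
  have htest : ∀ b, 
      |(∫ x in Iic ((b - a) / s), f₀ x) - ∫ x in Iic ((b - a') / s'), f₀ x| ≤ δ := by
    intro b
    rw [← setIntegral_Iic_scale f₀ a b hs, ← setIntegral_Iic_scale f₀ a' b hs',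
      ← integral_sub hi.integrableOn hi'.integrableOn]
    refine abs_integral_le_integral_abs.trans ?_
    exact setIntegral_le_integral (hi.sub hi').abs (ae_of_all _ fun x => abs_nonneg _)
  have hM0 : 0 ≤ min (max |a - a'| |s - s'|) 1 :=
    le_min ((abs_nonneg _).trans (le_max_left _ _)) zero_le_one
  rcases le_or_gt (c / 4) δ with hbig | hsmall
  · calc _ ≤ (c / 4) * 1 :=
          mul_le_mul (min_le_left _ _) (min_le_right _ _) hM0 (by positivity)
      _ ≤ δ := by linarith
  -- Choosing b = a' + t s' makes the reference quantile t. As δ/c < 1, the truncation in the growth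
  -- bound is inactive.
  have hkey : ∀ t : ℝ, 0 ≤ t → t ≤ 1 → |(a' + t * s' - a) / s - t| ≤ δ / c := by
    intro t h0 h1
    have h2 := htest (a' + t * s')
    rw [show (a' + t * s' - a') / s' = t by field_simp; ring] at h2
    have h3 := (hcdf t ((a' + t * s' - a) / s) h0 h1).trans h2
    have h4 : min |(a' + t * s' - a) / s - t| 1 ≤ δ / c := by
      rw [le_div_iff₀ hc]; linarith
    have h5 : δ / c < 1 := by rw [div_lt_one hc]; linarith
    rcases min_le_iff.1 h4 with h6 | h6
    · exact h6
    · linarith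
  -- The test at t = 0 controls location; its difference with t = 1 controls the ratio of scales.
  have k0 := hkey 0 le_rfl zero_le_one
  have k1 := hkey 1 zero_le_one le_rfl
  set ε := δ / c with hε
  have hε4 : ε < 1 / 4 := by rw [hε, div_lt_iff₀ hc]; linarith
  have e1 : (a' + 1 * s' - a) / s = (a' + 0 * s' - a) / s + s' / s := by ring
  rw [e1] at k1
  have k0' := abs_le.1 k0
  have k1' := abs_le.1 k1
  have k2 : |s' / s - 1| ≤ 2 * ε := abs_le.2 ⟨by linarith, by linarith⟩
  have k3 : s ≤ 2 * s' := by
    have h1 : 1 / 2 ≤ s' / s := by linarith [(abs_le.1 k2).1]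
    rw [le_div_iff₀ hs] at h1
    linarith
  have hε0 : 0 ≤ ε := (abs_nonneg _).trans k0
  have k4 : |a - a'| ≤ 4 * s' * ε := by
    have : a - a' = -(s * ((a' + 0 * s' - a) / s - 0)) := by field_simp; ring
    rw [this, abs_neg, abs_mul, abs_of_pos hs]
    calc s * |(a' + 0 * s' - a) / s - 0| ≤ (2 * s') * ε := by gcongr
      _ ≤ _ := by nlinarith [mul_nonneg hs'.le hε0]
  have k5 : |s - s'| ≤ 4 * s' * ε := by
    have : s - s' = -(s * (s' / s - 1)) := by field_simp; ring
    rw [this, abs_neg, abs_mul, abs_of_pos hs]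
    calc s * |s' / s - 1| ≤ (2 * s') * (2 * ε) := by gcongr
      _ = _ := by ring
  calc _ ≤ (c / (4 * s')) * (4 * s' * ε) :=
        mul_le_mul (min_le_right _ _) ((min_le_left _ _).trans (max_le k4 k5)) hM0 (by positivity)
    _ = δ := by rw [hε]; field_simp

/-- Separation of location-scale regression models. -/
lemma exists_separation_prod (hf : IsUnimodalDensity f₀) {W : Type} [MeasurableSpace W]
    (ν : Measure W) [IsProbabilityMeasure ν] {s' : ℝ} (hs' : 0 < s') :
    ∃ c > 0, ∀ (a a' : W → ℝ) (s : ℝ), Measurable a → Measurable a' → 0 < s →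
      c * (∫ w, min |a w - a' w| 1 ∂ν + min |s - s'| 1) ≤
      ∫ z : ℝ × W, |s⁻¹ * f₀ ((z.1 - a z.2) / s) - s'⁻¹ * f₀ ((z.1 - a' z.2) / s')|
        ∂((volume : Measure ℝ).prod ν) := by
  obtain ⟨c, hc, hsep⟩ := hf.exists_separation hs'
  refine ⟨c / 2, by positivity, fun a a' s ha ha' hs => ?_⟩
  have hintg : ∀ (b : W → ℝ) (t : ℝ), Measurable b → 0 < t →
      Integrable (fun z : ℝ × W => t⁻¹ * f₀ ((z.1 - b z.2) / t)) ((volume : Measure ℝ).prod ν) := by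
    intro b t hb ht
    exact integrable_prod_of_shift ν (F := fun x => t⁻¹ * f₀ (x / t))
      (by simpa using hf.integrable_scale 0 ht)
      ((hf.measurable.comp (measurable_id.div_const t)).const_mul _) hb
  have hd := ((hintg a s ha hs).sub (hintg a' s' ha' hs')).abs
  have hmi : Integrable (fun w => min |a w - a' w| 1) ν := by
    refine Integrable.of_bound ((ha.sub ha').abs.min measurable_const).aestronglyMeasurable 1
      (ae_of_all _ fun w => ?_)
    rw [Real.norm_of_nonneg (le_min (abs_nonneg _) zero_le_one)]
    exact min_le_right _ _
  have e : ∫ z : ℝ × W, |s⁻¹ * f₀ ((z.1 - a z.2) / s) - s'⁻¹ * f₀ ((z.1 - a' z.2) / s')|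
      ∂((volume : Measure ℝ).prod ν) = ∫ w, (∫ x, |s⁻¹ * f₀ ((x - a w) / s) -
        s'⁻¹ * f₀ ((x - a' w) / s')|) ∂ν := integral_prod_symm _ hd
  rw [e]
  have h1 : ∫ w, (c / 2 * (min |a w - a' w| 1 + min |s - s'| 1)) ∂ν =
      c / 2 * (∫ w, min |a w - a' w| 1 ∂ν + min |s - s'| 1) := by
    rw [integral_const_mul, integral_add hmi (integrable_const _)]
    simp
  rw [← h1]
  refine integral_mono ((hmi.add (integrable_const _)).const_mul _) hd.integral_prod_right
    fun w => ?_
  refine le_trans ?_ (hsep (a w) (a' w) s hs)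
  -- The average of the two truncated gaps is at most the truncated maximum, which explains c/2.
  have h2 : min |a w - a' w| 1 ≤ min (max |a w - a' w| |s - s'|) 1 :=
    min_le_min_right _ (le_max_left _ _)
  have h3 : min |s - s'| 1 ≤ min (max |a w - a' w| |s - s'|) 1 :=
    min_le_min_right _ (le_max_right _ _)
  beta_reduce
  nlinarith

end IsUnimodalDensity

namespace IsUnimodalDensity

variable {f₀ : ℝ → ℝ}

/-- Hellinger brackets for cells of relative size of order `u ^ 2`. -/
lemma exists_hellinger_bracket (hf : IsUnimodalDensity f₀) {W : Type} [MeasurableSpace W]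
    (ν : Measure W) [IsProbabilityMeasure ν] : ∃ κ > 0, ∀ u, 0 < u → u ≤ 1 →
    ∀ (a₀ : W → ℝ) (s₀ : ℝ), Measurable a₀ → 0 < s₀ →
    ∃ L U : ℝ × W → ℝ, (∀ z, 0 ≤ L z) ∧ Measurable L ∧ Measurable U ∧
      Integrable L ((volume : Measure ℝ).prod ν) ∧ Integrable U ((volume : Measure ℝ).prod ν) ∧
      hellinger ((volume : Measure ℝ).prod ν) L U ≤ u ∧
      ∀ (a : W → ℝ) (s : ℝ), |s - s₀| ≤ κ * u ^ 2 * s₀ →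
        (∀ w, |a w - a₀ w| ≤ κ * u ^ 2 * s₀) → ∀ z : ℝ × W,
        L z ≤ s⁻¹ * f₀ ((z.1 - a z.2) / s) ∧ s⁻¹ * f₀ ((z.1 - a z.2) / s) ≤ U z := by
  have h0 := hf.pos 0
  -- Chosen so that the L¹ width (6 + 8 f₀(0)) η equals 2u².
  refine ⟨1 / (3 + 4 * f₀ 0), by positivity, fun u hu hu1 a₀ s₀ ha₀ hs₀ => ?_⟩
  set η := 1 / (3 + 4 * f₀ 0) * u ^ 2 with hη
  have hη0 : 0 < η := by positivity
  have hη2 : η ≤ 1 / 2 := by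
    have h1 : 1 / (3 + 4 * f₀ 0) ≤ 1 / 2 := one_div_le_one_div_of_le two_pos (by linarith)
    have h2 : u ^ 2 ≤ 1 := pow_le_one₀ hu.le hu1
    nlinarith [sq_nonneg u]
  obtain ⟨L, U, hL0, hLU, hLm, hUm, hLi, hUi, hintg, hcell⟩ :=
    hf.exists_bracket ν ha₀ hs₀ hη0 hη2
  refine ⟨L, U, hL0, hLm, hUm, hLi, hUi,
    hellinger_le_of_integral_sub_le hu.le hLi hUi hL0 hLU (hintg.trans ?_),
    fun a s hs ha z => hcell (a z.2) s hs z (ha z.2)⟩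
  rw [hη]
  apply le_of_eq
  field_simp
  ring

end IsUnimodalDensity

/-! ### Regression models with a dispersion parameter -/

section Dispersion

variable {d : ℕ}

/-- The regression coefficients of a parameter `(θ, s)`. -/
def regCoef (ϑ : EuclideanSpace ℝ (Fin (d + 1))) : EuclideanSpace ℝ (Fin d) :=
  WithLp.toLp 2 fun i => ϑ i.castSucc

lemma linPred_regCoef (ϑ : EuclideanSpace ℝ (Fin (d + 1))) (w : Covariate d) :
    linPred (regCoef ϑ) w = linPredS ϑ w := rfl

lemma regCoef_sub (ϑ ϑ' : EuclideanSpace ℝ (Fin (d + 1))) :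
    regCoef (ϑ - ϑ') = regCoef ϑ - regCoef ϑ' := by ext i; simp [regCoef]

lemma norm_sq_regCoef (ϑ : EuclideanSpace ℝ (Fin (d + 1))) :
    ‖ϑ‖ ^ 2 = ‖regCoef ϑ‖ ^ 2 + ϑ (Fin.last d) ^ 2 := by
  simp [EuclideanSpace.norm_sq_eq, Fin.sum_univ_castSucc, regCoef]

lemma norm_regCoef_le (ϑ : EuclideanSpace ℝ (Fin (d + 1))) : ‖regCoef ϑ‖ ≤ ‖ϑ‖ := by
  have := norm_sq_regCoef ϑ
  exact abs_le_of_sq_le_sq' (by nlinarith [sq_nonneg (ϑ (Fin.last d))]) (norm_nonneg _) |>.2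

lemma norm_le_regCoef_add (ϑ : EuclideanSpace ℝ (Fin (d + 1))) :
    ‖ϑ‖ ≤ ‖regCoef ϑ‖ + |ϑ (Fin.last d)| := by
  have := norm_sq_regCoef ϑ
  refine abs_le_of_sq_le_sq' ?_ (by positivity) |>.2
  rw [add_sq, sq_abs, this]
  nlinarith [mul_nonneg (norm_nonneg (regCoef ϑ)) (abs_nonneg (ϑ (Fin.last d)))]

lemma abs_linPredS_sub_le (ϑ ϑ' : EuclideanSpace ℝ (Fin (d + 1))) (w : Covariate d) :
    |linPredS ϑ w - linPredS ϑ' w| ≤ d * ‖ϑ - ϑ'‖ := by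
  rw [← linPred_regCoef, ← linPred_regCoef, ← linPred_sub, ← regCoef_sub]
  exact (abs_linPred_le _ w).trans (by gcongr; exact norm_regCoef_le _)

lemma abs_linPred_sub_le_of_forall {θ θ' : EuclideanSpace ℝ (Fin d)} {b : ℝ}
    (h : ∀ i, |θ i - θ' i| ≤ b) (w : Covariate d) : |linPred θ w - linPred θ' w| ≤ d * b := by
  rw [← linPred_sub]
  refine (abs_linPred_le_sum _ w).trans ?_
  calc ∑ i, |(θ - θ') i| ≤ ∑ _i : Fin d, b := Finset.sum_le_sum fun i _ => by simpa using h i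
    _ = _ := by simp

lemma linPredS_add_smul (ϑ u : EuclideanSpace ℝ (Fin (d + 1))) (ξ : ℝ) (w : Covariate d) :
    linPredS (ϑ + ξ • u) w = linPredS ϑ w + ξ * linPredS u w := by
  simp [linPredS, add_mul, Finset.sum_add_distrib, Finset.mul_sum, mul_assoc]

lemma measurable_linPred_prod {𝒳 : Type} [MeasurableSpace 𝒳] :
    Measurable fun z : EuclideanSpace ℝ (Fin d) × 𝒳 × Covariate d => linPred z.1 z.2.2 := by
  unfold linPred
  refine Finset.measurable_sum _ fun i _ => Measurable.mul ?_ ?_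
  · exact (by fun_prop : Measurable fun θ : EuclideanSpace ℝ (Fin d) => θ i).comp measurable_fst
  · exact ((measurable_pi_apply i).comp measurable_subtype_coe).comp
      (measurable_snd.comp measurable_snd)

lemma measurable_linPredS_prod : Measurable fun
    z : EuclideanSpace ℝ (Fin (d + 1)) × ℝ × Covariate d => linPredS z.1 z.2.2 := by
  unfold linPredS
  refine Finset.measurable_sum _ fun i _ => Measurable.mul ?_ ?_
  · exact (by fun_prop : Measurable fun θ : EuclideanSpace ℝ (Fin (d + 1)) =>
      θ i.castSucc).comp measurable_fst
  · exact ((measurable_pi_apply i).comp measurable_subtype_coe).comp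
      (measurable_snd.comp measurable_snd)

/-- A parametrization `σ` of scales by `(0, ∞)`. -/
structure IsScaleLink (σ : ℝ → ℝ) : Prop where
  measurable : Measurable σ
  pos : ∀ t, 0 < t → 0 < σ t
  differentiableAt : ∀ t, 0 < t → DifferentiableAt ℝ σ t
  abs_sub_mul_le : ∀ t t', 0 < t → 0 < t' → |σ t' - σ t| * t ≤ |t' - t| * σ t
  min_le : ∀ t, 0 < t → min t 1 ≤ σ t
  separation : ∀ t, 0 < t → ∃ c > 0, ∀ t', 0 < t' → c * min |t' - t| 1 ≤ min |σ t' - σ t| 1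

/-- The absolute value, rather than the identity, since √(t²) = |t|: the Gaussian model then agrees
with a dispersion model for every parameter, not only on Ω. -/
lemma isScaleLink_abs : IsScaleLink fun t => |t| where
  measurable := measurable_id.abs
  pos t ht := abs_pos.2 ht.ne'
  differentiableAt t ht := differentiableAt_abs ht.ne'
  abs_sub_mul_le t t' ht ht' := by rw [abs_of_pos ht, abs_of_pos ht']
  min_le t ht := by rw [abs_of_pos ht]; exact min_le_left _ _
  separation t ht := ⟨1, one_pos, fun t' ht' => by rw [abs_of_pos ht, abs_of_pos ht', one_mul]⟩

/-- Each estimate uses t' - t = (√t' - √t)(√t' + √t); in `separation` the truncation at 1 handles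
large t'. -/
lemma isScaleLink_sqrt : IsScaleLink Real.sqrt where
  measurable := Real.continuous_sqrt.measurable
  pos t ht := Real.sqrt_pos.2 ht
  differentiableAt t ht := (Real.hasDerivAt_sqrt ht.ne').differentiableAt
  abs_sub_mul_le t t' ht ht' := by
    have h1 := Real.sqrt_pos.2 ht
    have h2 := Real.sqrt_pos.2 ht'
    have e : |t' - t| = |√t' - √t| * (√t' + √t) := by
      rw [← abs_of_pos (add_pos h2 h1), ← abs_mul]
      congr 1
      linear_combination -Real.sq_sqrt ht'.le + Real.sq_sqrt ht.le
    rw [e]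
    calc |√t' - √t| * t = |√t' - √t| * √t * √t := by rw [mul_assoc, Real.mul_self_sqrt ht.le]
      _ ≤ _ := by gcongr; linarith
  min_le t ht := by
    rcases le_total t 1 with h | h
    · rw [min_eq_left h]
      exact Real.le_sqrt_of_sq_le (by nlinarith)
    · rw [min_eq_right h]
      exact Real.one_le_sqrt.2 h
  separation t ht := by
    have h1 := Real.sqrt_pos.2 ht
    refine ⟨1 / (1 + 2 * √t), by positivity, fun t' ht' => ?_⟩
    have h2 := Real.sqrt_pos.2 ht'
    have e : |t' - t| = |√t' - √t| * (√t' + √t) := by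
      rw [← abs_of_pos (add_pos h2 h1), ← abs_mul]
      congr 1
      linear_combination -Real.sq_sqrt ht'.le + Real.sq_sqrt ht.le
    rw [one_div_mul_eq_div, div_le_iff₀ (by positivity)]
    rcases le_total |√t' - √t| 1 with h | h
    · rw [min_eq_left h]
      refine (min_le_left _ _).trans ?_
      rw [e]
      exact mul_le_mul_of_nonneg_left (by linarith [(abs_le.1 h).2]) (abs_nonneg _)
    · rw [min_eq_right h]
      exact (min_le_right _ _).trans (by linarith)

/-- Regression with error density `f₀`, rescaled by the link `σ` of the dispersion parameter. -/
noncomputable def dispersionModel (f₀ σ : ℝ → ℝ) (ν : Measure (Covariate d))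
    (g : ℝ × Covariate d → ℝ)
    (m : EuclideanSpace ℝ (Fin (d + 1))) (S : Matrix (Fin (d + 1)) (Fin (d + 1)) ℝ)
    (ϑs : EuclideanSpace ℝ (Fin (d + 1))) : ContamModel (ℝ × Covariate d) (Fin (d + 1)) where
  base := (volume : Measure ℝ).prod ν
  Ω := posDispersion d
  f ϑ z := (σ (ϑ (Fin.last d)))⁻¹ * f₀ ((z.1 - linPredS ϑ z.2) / σ (ϑ (Fin.last d)))
  g := g
  prior := cond (multivariateGaussian m S) (posDispersion d)
  θs := ϑs

lemma measurable_linPredS (ϑ : EuclideanSpace ℝ (Fin (d + 1))) :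
    Measurable (linPredS ϑ : Covariate d → ℝ) := measurable_linPred (regCoef ϑ)

/-- The coefficient part is bounded through the nondegenerate design and the dispersion part through
the link; truncation at 1 is subadditive, which combines them. -/
lemma dispersionModel_separation {f₀ σ : ℝ → ℝ} (hf : IsUnimodalDensity f₀) (hσ : IsScaleLink σ)
    (hd : 0 < d) {ν : Measure (Covariate d)} [IsProbabilityMeasure ν] (hν : NondegenerateDesign ν)
    {ϑs : EuclideanSpace ℝ (Fin (d + 1))} (hϑs : 0 < ϑs (Fin.last d)) :
    ∃ c₀ > 0, ∀ ϑ ∈ posDispersion d, c₀ * min ‖ϑ - ϑs‖ 1 ≤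
      ∫ z : ℝ × Covariate d,
        |(σ (ϑ (Fin.last d)))⁻¹ * f₀ ((z.1 - linPredS ϑ z.2) / σ (ϑ (Fin.last d))) -
        (σ (ϑs (Fin.last d)))⁻¹ * f₀ ((z.1 - linPredS ϑs z.2) / σ (ϑs (Fin.last d)))|
        ∂((volume : Measure ℝ).prod ν) := by
  obtain ⟨c₁, hc₁, h₁⟩ := hf.exists_separation_prod ν (hσ.pos _ hϑs)
  obtain ⟨c₂, hc₂, h₂⟩ := hν.exists_min_ge hd
  obtain ⟨c₃, hc₃, h₃⟩ := hσ.separation _ hϑs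
  refine ⟨c₁ * min c₂ c₃, by positivity, fun ϑ hϑ => ?_⟩
  refine le_trans ?_ (h₁ (linPredS ϑ) (linPredS ϑs) (σ (ϑ (Fin.last d))) (measurable_linPredS ϑ)
    (measurable_linPredS ϑs) (hσ.pos _ hϑ))
  rw [mul_assoc]
  refine mul_le_mul_of_nonneg_left ?_ hc₁.le
  have k2 := h₂ (regCoef (ϑ - ϑs))
  simp only [regCoef_sub, linPred_sub, linPred_regCoef] at k2
  have k3 := h₃ _ hϑ
  have k4 := norm_le_regCoef_add (ϑ - ϑs)
  rw [PiLp.sub_apply, regCoef_sub] at k4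
  set A := ‖regCoef ϑ - regCoef ϑs‖
  set B := |ϑ (Fin.last d) - ϑs (Fin.last d)|
  have hA : 0 ≤ A := norm_nonneg _
  have hB : 0 ≤ B := abs_nonneg _
  have k5 : min ‖ϑ - ϑs‖ 1 ≤ min A 1 + min B 1 := by
    rcases le_total A 1 with h | h <;> rcases le_total B 1 with h' | h' <;>
      simp only [min_eq_left, min_eq_right, h, h'] <;>
      first
      | exact (min_le_left _ _).trans k4
      | exact (min_le_right _ _).trans (by linarith)
  have hmA : 0 ≤ min A 1 := le_min hA zero_le_one
  have hmB : 0 ≤ min B 1 := le_min hB zero_le_one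
  calc min c₂ c₃ * min ‖ϑ - ϑs‖ 1 ≤ min c₂ c₃ * (min A 1 + min B 1) := by gcongr
    _ = min c₂ c₃ * min A 1 + min c₂ c₃ * min B 1 := by ring
    _ ≤ c₂ * min A 1 + c₃ * min B 1 := by
        gcongr
        · exact min_le_left _ _
        · exact min_le_right _ _
    _ ≤ _ := add_le_add k2 k3

/-- Apart from the local log-Lipschitz bound, which depends on the tails of the error, unimodality
and differentiability of the error density suffice. The sieve keeps the dispersion above ε. -/
theorem dispersionModel_isRegular {f₀ σ : ℝ → ℝ} (hf : IsUnimodalDensity f₀)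
    (hf' : Differentiable ℝ f₀) (hσ : IsScaleLink σ)
    (hd : 0 < d) {ν : Measure (Covariate d)} [IsProbabilityMeasure ν] (hν : NondegenerateDesign ν)
    {g : ℝ × Covariate d → ℝ} {m ϑs : EuclideanSpace ℝ (Fin (d + 1))}
    {S : Matrix (Fin (d + 1)) (Fin (d + 1)) ℝ} (hS : S.PosDef) (hϑs : 0 < ϑs (Fin.last d))
    (hg : (dispersionModel f₀ σ ν g m S ϑs).IsContamination)
    (hlog : ∀ θ ∈ posDispersion d, ∃ r > 0, ∃ (L : ℝ × Covariate d → ℝ) (T B : ℝ),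
      (∀ x, 0 ≤ L x) ∧
      (∀ θ', ‖θ' - θ‖ ≤ r → θ' ∈ posDispersion d ∧ ∀ x,
        |Real.log ((dispersionModel f₀ σ ν g m S ϑs).f θ' x) -
          Real.log ((dispersionModel f₀ σ ν g m S ϑs).f θ x)| ≤ ‖θ' - θ‖ * L x) ∧
      ∀ x, L x * Real.exp (r * L x) * (dispersionModel f₀ σ ν g m S ϑs).f θ x ≤ T * g x ∧
        L x * Real.exp (r * L x) * (dispersionModel f₀ σ ν g m S ϑs).f θ x ≤ B) :
    (dispersionModel f₀ σ ν g m S ϑs).IsRegular where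
  isProbabilityMeasure := cond_isProbabilityMeasure (multivariateGaussian_posDispersion_ne_zero hS)
  measurable_f := by
    have h1 : Measurable fun z : EuclideanSpace ℝ (Fin (d + 1)) × ℝ × Covariate d =>
        σ (z.1 (Fin.last d)) :=
      hσ.measurable.comp ((by fun_prop : Measurable fun θ : EuclideanSpace ℝ (Fin (d + 1)) =>
        θ (Fin.last d)).comp measurable_fst)
    exact h1.inv.mul (hf.measurable.comp
      (((measurable_fst.comp measurable_snd).sub measurable_linPredS_prod).div h1))
  measurableSet_Ω := (isOpen_posDispersion d).measurableSet
  f_pos θ hθ x := mul_pos (inv_pos.2 (hσ.pos _ hθ)) (hf.pos _)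
  lintegral_f θ hθ := hf.lintegral_prod_scale ν (measurable_linPredS θ) (hσ.pos _ hθ)
  θs_mem := hϑs
  contamination := hg
  logLipschitz := hlog
  differentiable θ hθ x u _ := by
    refine DifferentiableAt.differentiableWithinAt ?_
    simp only [dispersionModel, linPredS_add_smul, PiLp.add_apply, PiLp.smul_apply, smul_eq_mul]
    have h1 : DifferentiableAt ℝ (fun ξ : ℝ => σ (θ (Fin.last d) + ξ * u (Fin.last d))) 0 := by
      refine DifferentiableAt.comp (g := σ) (0 : ℝ) ?_ (by fun_prop)
      simpa using hσ.differentiableAt _ hθ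
    have h2 : σ (θ (Fin.last d) + 0 * u (Fin.last d)) ≠ 0 := by
      simpa using (hσ.pos _ hθ).ne'
    refine (h1.inv h2).mul ?_
    refine DifferentiableAt.comp (g := f₀) (0 : ℝ) (hf' _) ?_
    exact DifferentiableAt.fun_div (by fun_prop) h1 h2
  separation := dispersionModel_separation hf hσ hd hν hϑs
  prior_ball := cond_closedBall_ge hS hϑs
  sieve := by
    obtain ⟨A, hA, htail⟩ := cond_tail_le (m := m) hS
    obtain ⟨κ, hκ, hbr⟩ := hf.exists_hellinger_bracket ν
    have hmeas : Measurable fun ϑ : EuclideanSpace ℝ (Fin (d + 1)) => ϑ (Fin.last d) := by fun_prop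
    -- Dividing κ by d + 1 compensates for summing d coordinates in the linear predictor.
    refine ⟨fun ε => {ϑ | ε ≤ ϑ (Fin.last d)}, A, κ / (d + 1), hA, by positivity,
      fun ε ε' h ϑ hϑ => h.trans hϑ, fun ε hε ϑ hϑ => hε.trans_le hϑ,
      fun ϑ hϑ => ⟨_, hϑ, le_refl (ϑ (Fin.last d))⟩,
      fun ε => measurableSet_le measurable_const hmeas, htail, ?_⟩
    intro ε u hε hε1 hu hu1 θ₀ hθ₀
    have hθ₀' : ε ≤ θ₀ (Fin.last d) := hθ₀
    have ht : 0 < θ₀ (Fin.last d) := hε.trans_le hθ₀'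
    have hs := hσ.pos _ ht
    have hεσ : ε ≤ σ (θ₀ (Fin.last d)) := (le_min hθ₀' hε1).trans (hσ.min_le _ ht)
    obtain ⟨L, U, hL0, hLm, hUm, hLi, hUi, hh, hcell⟩ :=
      hbr u hu hu1 (linPredS θ₀) _ (measurable_linPredS θ₀) hs
    refine ⟨L, U, hL0, hLm, hUm, hLi, hUi, hh, fun θ hθ hθθ₀ => ?_⟩
    have hd1 : κ / (d + 1) ≤ κ := div_le_self hκ.le (by linarith [Nat.cast_nonneg (α := ℝ) d])
    refine hcell (linPredS θ) (σ (θ (Fin.last d))) ?_ fun w => ?_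
    · have h1 := hσ.abs_sub_mul_le _ _ ht hθ
      refine le_of_mul_le_mul_right (h1.trans ?_) ht
      calc |θ (Fin.last d) - θ₀ (Fin.last d)| * σ (θ₀ (Fin.last d))
          ≤ (κ / (d + 1) * u ^ 2 * ε) * σ (θ₀ (Fin.last d)) := by gcongr; exact hθθ₀ _
        _ ≤ (κ * u ^ 2 * θ₀ (Fin.last d)) * σ (θ₀ (Fin.last d)) := by gcongr
        _ = _ := by ring
    · have h1 := abs_linPred_sub_le_of_forall (θ := regCoef θ) (θ' := regCoef θ₀)
        (fun i => hθθ₀ i.castSucc) w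
      refine h1.trans ?_
      calc d * (κ / (d + 1) * u ^ 2 * ε) = (d / (d + 1)) * (κ * u ^ 2 * ε) := by ring
        _ ≤ 1 * (κ * u ^ 2 * σ (θ₀ (Fin.last d))) := by
            gcongr
            rw [div_le_one (by positivity)]
            linarith
        _ = _ := one_mul _

end Dispersion

lemma abs_log_sub_log_le {a b m : ℝ} (hm : 0 < m) (ha : m ≤ a) (hb : m ≤ b) :
    |Real.log a - Real.log b| ≤ |a - b| / m := by
  have key : ∀ x y : ℝ, m ≤ x → m ≤ y → Real.log x - Real.log y ≤ |x - y| / m := by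
    intro x y hx hy
    have hx0 := hm.trans_le hx
    have hy0 := hm.trans_le hy
    rw [← Real.log_div hx0.ne' hy0.ne']
    calc Real.log (x / y) ≤ x / y - 1 := Real.log_le_sub_one_of_pos (div_pos hx0 hy0)
      _ = (x - y) / y := by field_simp
      _ ≤ |x - y| / m := div_le_div₀ (abs_nonneg _) (le_abs_self _) hm hy
  refine abs_le.2 ⟨?_, key a b ha hb⟩
  have := key b a hb ha
  rw [abs_sub_comm] at this
  linarith

/-- A uniform Lipschitz constant for the log-likelihood suffices for the contamination bounds. -/
lemma ContamModel.IsContamination.exists_logLipschitz {𝒳 : Type} [MeasurableSpace 𝒳] {ι : Type}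
    [Fintype ι] {M : ContamModel 𝒳 ι} (hg : M.IsContamination) {θ : EuclideanSpace ℝ ι}
    (hθ : θ ∈ M.Ω) {b r K : ℝ} (hb : ∀ x, M.f θ x ≤ b) (hr : 0 < r) (hK : 0 ≤ K)
    (hlip : ∀ θ', ‖θ' - θ‖ ≤ r →
      θ' ∈ M.Ω ∧ ∀ x, |Real.log (M.f θ' x) - Real.log (M.f θ x)| ≤ ‖θ' - θ‖ * K) :
    ∃ r > 0, ∃ (L : 𝒳 → ℝ) (T B : ℝ), (∀ x, 0 ≤ L x) ∧
      (∀ θ', ‖θ' - θ‖ ≤ r → θ' ∈ M.Ω ∧ ∀ x,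
        |Real.log (M.f θ' x) - Real.log (M.f θ x)| ≤ ‖θ' - θ‖ * L x) ∧
      ∀ x, L x * Real.exp (r * L x) * M.f θ x ≤ T * M.g x ∧
        L x * Real.exp (r * L x) * M.f θ x ≤ B := by
  obtain ⟨κ, hκ, hle⟩ := hg.heavy_tail θ hθ
  have hE : 0 ≤ K * Real.exp (r * K) := by positivity
  refine ⟨r, hr, fun _ => K, K * Real.exp (r * K) / κ, K * Real.exp (r * K) * b, fun _ => hK, hlip,
    fun x => ⟨?_, mul_le_mul_of_nonneg_left (hb x) hE⟩⟩
  rw [div_mul_eq_mul_div, le_div_iff₀ hκ, mul_assoc, mul_comm (M.f θ x) κ]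
  exact mul_le_mul_of_nonneg_left (hle x) hE

/-! ### Gaussian linear regression -/

section Gaussian

lemma isUnimodalDensity_gaussian : IsUnimodalDensity (gaussianPDFReal 0 1) where
  measurable := measurable_gaussianPDFReal 0 1
  pos x := gaussianPDFReal_pos 0 1 x one_ne_zero
  mono := by
    intro x hx y hy hxy
    have hx' : x ≤ 0 := hx
    have hy' : y ≤ 0 := hy
    simp only [gaussianPDFReal, sub_zero]
    gcongr _ * Real.exp (?_ / _)
    nlinarith
  anti := by
    intro x hx y hy hxy
    have hx' : 0 ≤ x := hx
    simp only [gaussianPDFReal, sub_zero]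
    gcongr _ * Real.exp (?_ / _)
    nlinarith
  integrable := integrable_gaussianPDFReal 0 1
  integral_eq_one := integral_gaussianPDFReal_eq_one 0 one_ne_zero

lemma linearModel_eq {d : ℕ} (ν : Measure (Covariate d)) (g : ℝ × Covariate d → ℝ)
    (m : EuclideanSpace ℝ (Fin (d + 1))) (S : Matrix (Fin (d + 1)) (Fin (d + 1)) ℝ)
    (ϑs : EuclideanSpace ℝ (Fin (d + 1))) :
    linearModel ν g m S ϑs = dispersionModel (gaussianPDFReal 0 1) (fun t => |t|) ν g m S ϑs := by
  unfold linearModel dispersionModel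
  congr 1
  funext ϑ z
  rw [gaussianPDFReal, Real.sqrt_mul (by positivity), Real.sqrt_sq_eq_abs, mul_inv, ← mul_assoc,
    mul_comm (|ϑ (Fin.last d)|)⁻¹]
  simp only [NNReal.coe_one, mul_one, sub_zero, div_pow, sq_abs]
  congr 2
  rw [neg_div, neg_div, div_div, mul_comm (2 : ℝ)]

lemma log_gaussian_density {t : ℝ} (ht : 0 < t) (u : ℝ) :
    Real.log ((√(2 * Real.pi * t ^ 2))⁻¹ * Real.exp (-u ^ 2 / (2 * t ^ 2))) =
      -Real.log √(2 * Real.pi) - (Real.log t + u ^ 2 / (2 * t ^ 2)) := by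
  have h1 : 0 < √(2 * Real.pi) := by positivity
  rw [Real.sqrt_mul (by positivity), Real.sqrt_sq ht.le, Real.log_mul (by positivity)
    (Real.exp_ne_zero _), Real.log_exp, Real.log_inv, Real.log_mul h1.ne' ht.ne', neg_div]
  ring

/-- The residual is changed first, at the new scale, and the scale second. The constant grows
quadratically in u, so no uniform Lipschitz bound is available. -/
lemma abs_log_gaussian_sub_le {t t' u u' D ρ : ℝ} (ht : 0 < t) (hρ1 : ρ ≤ 1) (hρt : ρ ≤ t / 2)
    (htt' : |t' - t| ≤ ρ) (hD : 0 ≤ D) (huu' : |u' - u| ≤ D * ρ) :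
    |(Real.log t' + u' ^ 2 / (2 * t' ^ 2)) - (Real.log t + u ^ 2 / (2 * t ^ 2))| ≤
      ρ * ((2 / t + 2 * D * (1 + D) / t ^ 2 + 6 / t ^ 3) * (1 + u ^ 2)) := by
  have hρ : 0 ≤ ρ := (abs_nonneg _).trans htt'
  have ht' : t / 2 ≤ t' := by linarith [(abs_le.1 htt').1]
  have ht'0 : 0 < t' := by linarith
  have hi : 1 / (2 * t' ^ 2) ≤ 2 / t ^ 2 := by
    rw [div_le_div_iff₀ (by positivity) (by positivity)]
    nlinarith
  have hA : |Real.log t' - Real.log t| ≤ ρ * (2 / t) := by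
    refine (abs_log_sub_log_le (half_pos ht) ht' (by linarith)).trans ?_
    calc |t' - t| / (t / 2) ≤ ρ / (t / 2) := by gcongr
      _ = _ := by field_simp
  have hB : |u' ^ 2 / (2 * t' ^ 2) - u ^ 2 / (2 * t' ^ 2)| ≤
      ρ * (2 * D * (1 + D + u ^ 2) / t ^ 2) := by
    have e : u' ^ 2 / (2 * t' ^ 2) - u ^ 2 / (2 * t' ^ 2) =
        ((u' - u) * (2 * u + (u' - u))) * (1 / (2 * t' ^ 2)) := by ring
    rw [e, abs_mul, abs_mul, abs_of_pos (by positivity : 0 < 1 / (2 * t' ^ 2))]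
    have h1 : |2 * u + (u' - u)| ≤ 1 + D + u ^ 2 := by
      refine (abs_add_le _ _).trans ?_
      have h2 : |2 * u| ≤ 1 + u ^ 2 :=
        abs_le.2 ⟨by nlinarith [sq_nonneg (u + 1)], by nlinarith [sq_nonneg (u - 1)]⟩
      have h3 : D * ρ ≤ D := mul_le_of_le_one_right hD hρ1
      linarith
    calc |u' - u| * |2 * u + (u' - u)| * (1 / (2 * t' ^ 2))
        ≤ (D * ρ) * (1 + D + u ^ 2) * (2 / t ^ 2) := by gcongr
      _ = _ := by ring
  have hC : |u ^ 2 / (2 * t' ^ 2) - u ^ 2 / (2 * t ^ 2)| ≤ ρ * (6 / t ^ 3 * u ^ 2) := by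
    have e : u ^ 2 / (2 * t' ^ 2) - u ^ 2 / (2 * t ^ 2) =
        -(u ^ 2 * ((t' - t) * (t' + t)) * (1 / (2 * t' ^ 2)) * (1 / t ^ 2)) := by
      field_simp
      ring
    rw [e, abs_neg, abs_mul, abs_mul, abs_mul, abs_mul, abs_of_nonneg (sq_nonneg u),
      abs_of_pos (by positivity : 0 < 1 / (2 * t' ^ 2)), abs_of_pos (by positivity : 0 < 1 / t ^ 2),
      abs_of_pos (by positivity : 0 < t' + t)]
    calc u ^ 2 * (|t' - t| * (t' + t)) * (1 / (2 * t' ^ 2)) * (1 / t ^ 2)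
        ≤ u ^ 2 * (ρ * (3 * t)) * (2 / t ^ 2) * (1 / t ^ 2) := by
          gcongr
          linarith [(abs_le.1 htt').2]
      _ = _ := by field_simp; ring
  have e : (Real.log t' + u' ^ 2 / (2 * t' ^ 2)) - (Real.log t + u ^ 2 / (2 * t ^ 2)) =
      (Real.log t' - Real.log t) + (u' ^ 2 / (2 * t' ^ 2) - u ^ 2 / (2 * t' ^ 2)) +
        (u ^ 2 / (2 * t' ^ 2) - u ^ 2 / (2 * t ^ 2)) := by ring
  rw [e]
  refine (abs_add_three _ _ _).trans ((add_le_add_three hA hB hC).trans ?_)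
  rw [← mul_add, ← mul_add]
  refine mul_le_mul_of_nonneg_left ?_ hρ
  have h1 : 2 * D * (1 + D + u ^ 2) / t ^ 2 ≤ 2 * D * (1 + D) / t ^ 2 * (1 + u ^ 2) := by
    rw [div_mul_eq_mul_div, mul_assoc (2 * D)]
    gcongr
    nlinarith [mul_nonneg hD (sq_nonneg u)]
  have h2 : 0 ≤ 2 / t * u ^ 2 := by positivity
  have h3 : 0 ≤ 6 / t ^ 3 := by positivity
  linarith

/-- Doubling the scale absorbs the quadratic factor and the quadratic exponent: in units of u²/t²,
1/4 + 1/8 - 1/2 = -1/8. -/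
lemma gaussian_density_mul_exp_le {t r K u : ℝ} (ht : 0 < t) (hK : 0 ≤ K)
    (hrK : r * K ≤ 1 / (8 * t ^ 2)) :
    K * (1 + u ^ 2) * Real.exp (r * (K * (1 + u ^ 2))) *
      ((√(2 * Real.pi * t ^ 2))⁻¹ * Real.exp (-u ^ 2 / (2 * t ^ 2))) ≤
    2 * K * (1 + 4 * t ^ 2) * Real.exp (r * K) *
      ((√(2 * Real.pi * (2 * t) ^ 2))⁻¹ * Real.exp (-u ^ 2 / (2 * (2 * t) ^ 2))) := by
  have e1 : (√(2 * Real.pi * (2 * t) ^ 2))⁻¹ = (√(2 * Real.pi * t ^ 2))⁻¹ / 2 := by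
    rw [Real.sqrt_mul (by positivity), Real.sqrt_mul (x := 2 * Real.pi) (by positivity) (t ^ 2),
      Real.sqrt_sq (by positivity), Real.sqrt_sq ht.le]
    have : √(2 * Real.pi) ≠ 0 := by positivity
    field_simp
  have h1 : 1 + u ^ 2 ≤ (1 + 4 * t ^ 2) * Real.exp (u ^ 2 / (4 * t ^ 2)) := by
    have h2 := Real.add_one_le_exp (u ^ 2 / (4 * t ^ 2))
    have h3 : 0 ≤ u ^ 2 / (4 * t ^ 2) := by positivity
    have h4 : 4 * t ^ 2 * (u ^ 2 / (4 * t ^ 2)) = u ^ 2 := by field_simp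
    nlinarith [mul_le_mul_of_nonneg_left h2 (by positivity : 0 ≤ 1 + 4 * t ^ 2)]
  have h2 : Real.exp (u ^ 2 / (4 * t ^ 2)) * Real.exp (r * (K * (1 + u ^ 2))) *
      Real.exp (-u ^ 2 / (2 * t ^ 2)) ≤
      Real.exp (r * K) * Real.exp (-u ^ 2 / (2 * (2 * t) ^ 2)) := by
    rw [← Real.exp_add, ← Real.exp_add, ← Real.exp_add]
    refine Real.exp_le_exp.2 ?_
    have h3 := mul_le_mul_of_nonneg_right hrK (sq_nonneg u)
    have h4 : u ^ 2 / (4 * t ^ 2) + 1 / (8 * t ^ 2) * u ^ 2 + -u ^ 2 / (2 * t ^ 2) =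
      -u ^ 2 / (2 * (2 * t) ^ 2) := by field_simp; ring
    linarith
  rw [e1]
  set N := (√(2 * Real.pi * t ^ 2))⁻¹
  have hN : 0 ≤ N := by positivity
  calc _ ≤ K * ((1 + 4 * t ^ 2) * Real.exp (u ^ 2 / (4 * t ^ 2))) *
        Real.exp (r * (K * (1 + u ^ 2))) * (N * Real.exp (-u ^ 2 / (2 * t ^ 2))) := by gcongr
    _ = K * (1 + 4 * t ^ 2) * N * (Real.exp (u ^ 2 / (4 * t ^ 2)) *
        Real.exp (r * (K * (1 + u ^ 2))) * Real.exp (-u ^ 2 / (2 * t ^ 2))) := by ring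
    _ ≤ K * (1 + 4 * t ^ 2) * N *
        (Real.exp (r * K) * Real.exp (-u ^ 2 / (2 * (2 * t) ^ 2))) := by gcongr
    _ = _ := by ring

theorem linearModel_isRegular {d : ℕ} (hd : 0 < d) {ν : Measure (Covariate d)}
    [IsProbabilityMeasure ν] (hν : NondegenerateDesign ν)
    {g : ℝ × Covariate d → ℝ} {m ϑs : EuclideanSpace ℝ (Fin (d + 1))}
    {S : Matrix (Fin (d + 1)) (Fin (d + 1)) ℝ} (hS : S.PosDef) (hϑs : 0 < ϑs (Fin.last d))
    (hg : (linearModel ν g m S ϑs).IsContamination) : (linearModel ν g m S ϑs).IsRegular := by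
  have hdiff : Differentiable ℝ (gaussianPDFReal 0 1) := by
    unfold gaussianPDFReal
    fun_prop
  have hg' := hg
  rw [linearModel_eq] at hg' ⊢
  refine dispersionModel_isRegular isUnimodalDensity_gaussian hdiff isScaleLink_abs hd hν hS hϑs
    hg' fun ϑ hϑ => ?_
  simp only [← linearModel_eq]
  have ht : 0 < ϑ (Fin.last d) := hϑ
  set t := ϑ (Fin.last d) with htdef
  -- The contamination dominates every density of the model, in particular the one with the same
  -- coefficients and twice the scale, which dominates the quadratic log-Lipschitz constant.
  set ϑ₂ := ϑ + t • EuclideanSpace.single (Fin.last d) 1 with hϑ₂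
  have hlast : ϑ₂ (Fin.last d) = 2 * t := by
    simp [hϑ₂, ← htdef]
    ring
  have hlin : ∀ w : Covariate d, linPredS ϑ₂ w = linPredS ϑ w := by
    intro w
    rw [hϑ₂, linPredS_add_smul]
    simp [linPredS, (Fin.castSucc_lt_last _).ne]
  obtain ⟨κ, hκ, hle⟩ := hg.heavy_tail ϑ₂ (show 0 < ϑ₂ (Fin.last d) by rw [hlast]; positivity)
  set K := 2 / t + 2 * d * (1 + d) / t ^ 2 + 6 / t ^ 3 with hK
  have hK0 : 0 < K := by positivity
  -- The last term ensures r K ≤ 1/(8t²), the room left by doubling the scale; the others keep the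
  -- scale above t/2 and the increments below 1.
  set r := min (min 1 (t / 2)) (1 / (8 * t ^ 2 * K)) with hr
  have hr0 : 0 < r := by positivity
  have hrK : r * K ≤ 1 / (8 * t ^ 2) := by
    calc r * K ≤ 1 / (8 * t ^ 2 * K) * K := by gcongr; exact min_le_right _ _
      _ = _ := by field_simp
  set C := 2 * K * (1 + 4 * t ^ 2) * Real.exp (r * K) with hC
  have hC0 : 0 ≤ C := by positivity
  have hf₂ : ∀ x, (linearModel ν g m S ϑs).f ϑ₂ x = (√(2 * Real.pi * (2 * t) ^ 2))⁻¹ *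
      Real.exp (-(x.1 - linPredS ϑ x.2) ^ 2 / (2 * (2 * t) ^ 2)) := by
    intro x
    simp only [linearModel, hlast, hlin]
  have hdom : ∀ x : ℝ × Covariate d, K * (1 + (x.1 - linPredS ϑ x.2) ^ 2) *
      Real.exp (r * (K * (1 + (x.1 - linPredS ϑ x.2) ^ 2))) * (linearModel ν g m S ϑs).f ϑ x ≤
      C * (linearModel ν g m S ϑs).f ϑ₂ x := by
    intro x
    rw [hf₂]
    exact gaussian_density_mul_exp_le ht hK0.le hrK
  refine ⟨r, hr0, fun x => K * (1 + (x.1 - linPredS ϑ x.2) ^ 2), C / κ,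
    C * (√(2 * Real.pi * (2 * t) ^ 2))⁻¹, fun x => by positivity, fun ϑ' hϑ' => ?_,
    fun x => ⟨(hdom x).trans ?_, (hdom x).trans ?_⟩⟩
  · have hr2 : ‖ϑ' - ϑ‖ ≤ t / 2 :=
      hϑ'.trans ((min_le_left _ _).trans (min_le_right _ _))
    have hr1 : ‖ϑ' - ϑ‖ ≤ 1 := hϑ'.trans ((min_le_left _ _).trans (min_le_left _ _))
    have hmem : ϑ' ∈ posDispersion d :=
      closedBall_subset_posDispersion (le_refl (ϑ (Fin.last d) / 2)) ht
        (mem_closedBall_iff_norm.2 hr2)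
    refine ⟨hmem, fun x => ?_⟩
    have h1 : |ϑ' (Fin.last d) - t| ≤ ‖ϑ' - ϑ‖ :=
      EuclideanSpace.abs_apply_le_norm (ϑ' - ϑ) (Fin.last d)
    have h2 : |(x.1 - linPredS ϑ' x.2) - (x.1 - linPredS ϑ x.2)| ≤ d * ‖ϑ' - ϑ‖ := by
      rw [sub_sub_sub_cancel_left, abs_sub_comm]
      exact abs_linPredS_sub_le ϑ' ϑ x.2
    have h3 := abs_log_gaussian_sub_le ht hr1 hr2 h1 (Nat.cast_nonneg d) h2
    simp only [linearModel]
    rw [log_gaussian_density hmem, log_gaussian_density ht, abs_sub_comm]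
    rwa [sub_sub_sub_cancel_left]
  · rw [div_mul_eq_mul_div, le_div_iff₀ hκ, mul_assoc, mul_comm _ κ]
    exact mul_le_mul_of_nonneg_left (hle x) hC0
  · rw [hf₂]
    refine mul_le_mul_of_nonneg_left (mul_le_of_le_one_right (by positivity) ?_) hC0
    rw [Real.exp_le_one_iff]
    exact div_nonpos_of_nonpos_of_nonneg (neg_nonpos.2 (sq_nonneg _)) (by positivity)

end Gaussian

/-! ### Cauchy regression -/

section Cauchy

lemma isUnimodalDensity_cauchy :
    IsUnimodalDensity fun x : ℝ => Real.pi⁻¹ * (1 + x ^ 2)⁻¹ where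
  measurable := by fun_prop
  pos x := by positivity
  mono := by
    intro x hx y hy hxy
    have hx' : x ≤ 0 := hx
    have hy' : y ≤ 0 := hy
    have : y ^ 2 ≤ x ^ 2 := by nlinarith
    dsimp only
    gcongr
  anti := by
    intro x hx y hy hxy
    have hx' : 0 ≤ x := hx
    dsimp only
    gcongr
  integrable := integrable_inv_one_add_sq.const_mul _
  integral_eq_one := by
    rw [integral_const_mul, integral_univ_inv_one_add_sq, inv_mul_cancel₀ Real.pi_ne_zero]

lemma cauchyModel_eq {d : ℕ} (ν : Measure (Covariate d)) (g : ℝ × Covariate d → ℝ)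
    (m : EuclideanSpace ℝ (Fin (d + 1))) (S : Matrix (Fin (d + 1)) (Fin (d + 1)) ℝ)
    (ϑs : EuclideanSpace ℝ (Fin (d + 1))) :
    cauchyModel ν g m S ϑs =
      dispersionModel (fun x => Real.pi⁻¹ * (1 + x ^ 2)⁻¹) Real.sqrt ν g m S ϑs := by
  unfold cauchyModel dispersionModel
  congr 1
  funext ϑ z
  -- For nonpositive dispersion both densities vanish, by the conventions for roots and inverses.
  rcases le_total (ϑ (Fin.last d)) 0 with h | h
  · simp [Real.sqrt_eq_zero_of_nonpos h]
  · beta_reduce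
    rw [div_pow, Real.sq_sqrt h, mul_inv]
    ring

lemma log_cauchy_density {t : ℝ} (ht : 0 < t) (u : ℝ) :
    Real.log ((Real.pi * √t)⁻¹ * (1 + u ^ 2 / t)⁻¹) =
      -Real.log Real.pi + (Real.log t / 2 - Real.log (t + u ^ 2)) := by
  have hs := Real.sqrt_pos.2 ht
  have e : 1 + u ^ 2 / t = (t + u ^ 2) / t := by field_simp
  have h1 : 0 < t + u ^ 2 := by positivity
  rw [e, Real.log_mul (by positivity) (by positivity), Real.log_inv, Real.log_inv,
    Real.log_mul Real.pi_ne_zero hs.ne', Real.log_div h1.ne' ht.ne', Real.log_sqrt ht.le]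
  ring

/-- Unlike in the Gaussian case, the linear growth of the increment of u² is dominated by t + u², so
the bound is uniform in u. Exchanging u and u' gives the other direction. -/
lemma log_add_sq_sub_le {t D ρ u u' : ℝ} (ht : 0 < t) (hD : 0 ≤ D) (hρ : 0 ≤ ρ) (hρ1 : ρ ≤ 1)
    (huu' : |u' - u| ≤ D * ρ) :
    Real.log (t + u' ^ 2) - Real.log (t + u ^ 2) ≤ ρ * (D * (1 + (1 + D) / t)) := by
  have h1 : 0 < t + u ^ 2 := by positivity
  have h2 : 0 < t + u' ^ 2 := by positivity
  rw [← Real.log_div h2.ne' h1.ne']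
  refine (Real.log_le_sub_one_of_pos (div_pos h2 h1)).trans ?_
  have e : (t + u' ^ 2) / (t + u ^ 2) - 1 = ((u' - u) * (2 * u + (u' - u))) / (t + u ^ 2) := by
    field_simp
    ring
  rw [e, div_le_iff₀ h1]
  have h3 : |2 * u + (u' - u)| ≤ 1 + u ^ 2 + D := by
    refine (abs_add_le _ _).trans ?_
    have h4 : |2 * u| ≤ 1 + u ^ 2 :=
      abs_le.2 ⟨by nlinarith [sq_nonneg (u + 1)], by nlinarith [sq_nonneg (u - 1)]⟩
    have h5 : D * ρ ≤ D := mul_le_of_le_one_right hD hρ1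
    linarith
  have h6 : 1 + u ^ 2 + D ≤ (1 + (1 + D) / t) * (t + u ^ 2) := by
    have h7 : (1 + D) / t * (t + u ^ 2) = (1 + D) + (1 + D) / t * u ^ 2 := by field_simp
    have h8 : 0 ≤ (1 + D) / t * u ^ 2 := by positivity
    nlinarith
  calc (u' - u) * (2 * u + (u' - u)) ≤ |u' - u| * |2 * u + (u' - u)| := by
        rw [← abs_mul]; exact le_abs_self _
    _ ≤ (D * ρ) * ((1 + (1 + D) / t) * (t + u ^ 2)) := by gcongr; exact h3.trans h6
    _ = _ := by ring

lemma abs_log_cauchy_sub_le {t t' u u' D ρ : ℝ} (ht : 0 < t) (hρ1 : ρ ≤ 1) (hρt : ρ ≤ t / 2)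
    (htt' : |t' - t| ≤ ρ) (hD : 0 ≤ D) (huu' : |u' - u| ≤ D * ρ) :
    |(Real.log t' / 2 - Real.log (t' + u' ^ 2)) - (Real.log t / 2 - Real.log (t + u ^ 2))| ≤
      ρ * (3 / t + D * (1 + (1 + D) / t)) := by
  have hρ : 0 ≤ ρ := (abs_nonneg _).trans htt'
  have ht' : t / 2 ≤ t' := by linarith [(abs_le.1 htt').1]
  have hA : |Real.log t' - Real.log t| ≤ ρ * (2 / t) := by
    refine (abs_log_sub_log_le (half_pos ht) ht' (by linarith)).trans ?_
    calc |t' - t| / (t / 2) ≤ ρ / (t / 2) := by gcongr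
      _ = _ := by field_simp
  have hB : |Real.log (t' + u' ^ 2) - Real.log (t + u' ^ 2)| ≤ ρ * (2 / t) := by
    refine (abs_log_sub_log_le (half_pos ht) (by nlinarith [sq_nonneg u'])
      (by nlinarith [sq_nonneg u'])).trans ?_
    rw [add_sub_add_right_eq_sub]
    calc |t' - t| / (t / 2) ≤ ρ / (t / 2) := by gcongr
      _ = _ := by field_simp
  have hC := log_add_sq_sub_le ht hD hρ hρ1 huu'
  have hC' := log_add_sq_sub_le ht hD hρ hρ1 ((abs_sub_comm u u').le.trans huu')
  have e : ρ * (3 / t + D * (1 + (1 + D) / t)) =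
      ρ * (2 / t) / 2 + ρ * (2 / t) + ρ * (D * (1 + (1 + D) / t)) := by ring
  rw [e]
  obtain ⟨a1, a2⟩ := abs_le.1 hA
  obtain ⟨b1, b2⟩ := abs_le.1 hB
  exact abs_le.2 ⟨by linarith, by linarith⟩

theorem cauchyModel_isRegular {d : ℕ} (hd : 0 < d) {ν : Measure (Covariate d)}
    [IsProbabilityMeasure ν] (hν : NondegenerateDesign ν)
    {g : ℝ × Covariate d → ℝ} {m ϑs : EuclideanSpace ℝ (Fin (d + 1))}
    {S : Matrix (Fin (d + 1)) (Fin (d + 1)) ℝ} (hS : S.PosDef) (hϑs : 0 < ϑs (Fin.last d))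
    (hg : (cauchyModel ν g m S ϑs).IsContamination) : (cauchyModel ν g m S ϑs).IsRegular := by
  have hdiff : Differentiable ℝ fun x : ℝ => Real.pi⁻¹ * (1 + x ^ 2)⁻¹ := by
    have : ∀ x : ℝ, 1 + x ^ 2 ≠ 0 := fun x => by positivity
    fun_prop (disch := assumption)
  have hg' := hg
  rw [cauchyModel_eq] at hg' ⊢
  refine dispersionModel_isRegular isUnimodalDensity_cauchy hdiff isScaleLink_sqrt hd hν hS hϑs
    hg' fun ϑ hϑ => ?_
  simp only [← cauchyModel_eq]
  have ht : 0 < ϑ (Fin.last d) := hϑ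
  set t := ϑ (Fin.last d) with htdef
  refine hg.exists_logLipschitz hϑ (b := (Real.pi * √t)⁻¹) (r := min 1 (t / 2))
    (K := 3 / t + d * (1 + (1 + d) / t)) (fun x => ?_) (by positivity) (by positivity)
    fun ϑ' hϑ' => ?_
  · refine mul_le_of_le_one_right (by positivity) (inv_le_one_of_one_le₀ ?_)
    have : 0 ≤ (x.1 - linPredS ϑ x.2) ^ 2 / t := by positivity
    linarith
  · have hr2 : ‖ϑ' - ϑ‖ ≤ t / 2 := hϑ'.trans (min_le_right _ _)
    have hr1 : ‖ϑ' - ϑ‖ ≤ 1 := hϑ'.trans (min_le_left _ _)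
    have hmem : ϑ' ∈ posDispersion d :=
      closedBall_subset_posDispersion (le_refl (ϑ (Fin.last d) / 2)) ht
        (mem_closedBall_iff_norm.2 hr2)
    refine ⟨hmem, fun x => ?_⟩
    have h1 : |ϑ' (Fin.last d) - t| ≤ ‖ϑ' - ϑ‖ :=
      EuclideanSpace.abs_apply_le_norm (ϑ' - ϑ) (Fin.last d)
    have h2 : |(x.1 - linPredS ϑ' x.2) - (x.1 - linPredS ϑ x.2)| ≤ d * ‖ϑ' - ϑ‖ := by
      rw [sub_sub_sub_cancel_left, abs_sub_comm]
      exact abs_linPredS_sub_le ϑ' ϑ x.2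
    have h3 := abs_log_cauchy_sub_le ht hr1 hr2 h1 (Nat.cast_nonneg d) h2
    simp only [cauchyModel]
    rw [log_cauchy_density hmem, log_cauchy_density ht]
    rwa [add_sub_add_left_eq_sub]

end Cauchy

/-! ### Quantile regression -/

section Quantile

variable {τ : ℝ}

lemma checkLoss_of_nonneg (τ : ℝ) {u : ℝ} (hu : 0 ≤ u) : checkLoss τ u = τ * u := by
  rw [checkLoss, abs_of_nonneg hu]; ring

lemma checkLoss_of_nonpos (τ : ℝ) {u : ℝ} (hu : u ≤ 0) : checkLoss τ u = -((1 - τ) * u) := by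
  rw [checkLoss, abs_of_nonpos hu]; ring

lemma abs_checkLoss_sub_le (h0 : 0 < τ) (h1 : τ < 1) (u u' : ℝ) :
    |checkLoss τ u - checkLoss τ u'| ≤ |u - u'| := by
  have e : checkLoss τ u - checkLoss τ u' =
      (1 / 2) * ((|u| - |u'|) + (2 * τ - 1) * (u - u')) := by simp only [checkLoss]; ring
  have h2 : |2 * τ - 1| ≤ 1 := abs_le.2 ⟨by linarith, by linarith⟩
  rw [e, abs_mul, abs_of_pos (by norm_num : (0 : ℝ) < 1 / 2)]
  have h3 := abs_add_le (|u| - |u'|) ((2 * τ - 1) * (u - u'))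
  rw [abs_mul] at h3
  have h4 := abs_abs_sub_abs_le_abs_sub u u'
  have h5 := mul_le_of_le_one_left (abs_nonneg (u - u')) h2
  linarith

lemma continuous_checkLoss (τ : ℝ) : Continuous (checkLoss τ) := by
  unfold checkLoss; fun_prop

lemma checkLoss_nonneg (h0 : 0 < τ) (h1 : τ < 1) (u : ℝ) : 0 ≤ checkLoss τ u := by
  rcases le_total u 0 with h | h
  · rw [checkLoss_of_nonpos τ h]; nlinarith
  · rw [checkLoss_of_nonneg τ h]; positivity

/-- The check loss is linear on each half-line, so monotonicity and the integral reduce to two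
exponentials. -/
lemma isUnimodalDensity_quantile (h0 : 0 < τ) (h1 : τ < 1) :
    IsUnimodalDensity fun x => τ * (1 - τ) * Real.exp (-checkLoss τ x) := by
  have hτ : 0 < 1 - τ := by linarith
  have eR : EqOn (fun x => Real.exp (-τ * x)) (fun x => Real.exp (-checkLoss τ x)) (Ioi 0) := by
    intro x hx
    simp only [checkLoss_of_nonneg τ (mem_Ioi.1 hx).le, neg_mul]
  have eL : EqOn (fun x => Real.exp ((1 - τ) * x)) (fun x => Real.exp (-checkLoss τ x))
      (Iic 0) := by
    intro x hx
    simp only [checkLoss_of_nonpos τ (mem_Iic.1 hx), neg_neg]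
  have iR : IntegrableOn (fun x => Real.exp (-checkLoss τ x)) (Ioi 0) :=
    (integrableOn_exp_mul_Ioi (neg_lt_zero.2 h0) 0).congr_fun eR measurableSet_Ioi
  have iL : IntegrableOn (fun x => Real.exp (-checkLoss τ x)) (Iic 0) :=
    (integrableOn_exp_mul_Iic hτ 0).congr_fun eL measurableSet_Iic
  refine ⟨by have := (continuous_checkLoss τ).measurable; fun_prop, fun x => by positivity, ?_, ?_,
    ?_, ?_⟩
  · intro x hx y hy hxy
    simp only [checkLoss_of_nonpos τ (mem_Iic.1 hx), checkLoss_of_nonpos τ (mem_Iic.1 hy), neg_neg]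
    gcongr
  · intro x hx y hy hxy
    simp only [checkLoss_of_nonneg τ (mem_Ici.1 hx), checkLoss_of_nonneg τ (mem_Ici.1 hy)]
    gcongr
  · refine Integrable.const_mul ?_ _
    rw [← integrableOn_univ, ← Iic_union_Ioi (a := (0 : ℝ))]
    exact iL.union iR
  · rw [integral_const_mul, ← intervalIntegral.integral_Iic_add_Ioi iL iR,
      ← setIntegral_congr_fun measurableSet_Ioi eR, ← setIntegral_congr_fun measurableSet_Iic eL,
      integral_exp_mul_Ioi (neg_lt_zero.2 h0), integral_exp_mul_Iic hτ]
    simp only [mul_zero, Real.exp_zero]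
    field_simp
    ring

/-- The kink is met only when c = 0, and then |ξb| is linear in ξ on the half-line ξ ≥ 0. -/
lemma differentiableWithinAt_checkLoss (τ c b : ℝ) :
    DifferentiableWithinAt ℝ (fun ξ : ℝ => checkLoss τ (c - ξ * b)) (Ici 0) 0 := by
  have habs : DifferentiableWithinAt ℝ (fun ξ : ℝ => |c - ξ * b|) (Ici 0) 0 := by
    rcases eq_or_ne c 0 with rfl | hc
    · refine DifferentiableWithinAt.congr (f := fun ξ : ℝ => ξ * |b|) (by fun_prop) ?_ (by simp)
      intro ξ hξ
      rw [zero_sub, abs_neg, abs_mul, abs_of_nonneg (mem_Ici.1 hξ)]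
    · refine DifferentiableAt.differentiableWithinAt (DifferentiableAt.abs (by fun_prop) ?_)
      simpa using hc
  unfold checkLoss
  exact (habs.add (by fun_prop)).const_mul _

/-- A location family at scale 1. There is no singular boundary, so the ε-part of the sieve is
everything; the log-density is globally Lipschitz. -/
theorem quantileModel_isRegular (h0 : 0 < τ) (h1 : τ < 1) {d : ℕ} (hd : 0 < d)
    {ν : Measure (Covariate d)} [IsProbabilityMeasure ν] (hν : NondegenerateDesign ν)
    {g : ℝ × Covariate d → ℝ} {m θs : EuclideanSpace ℝ (Fin d)}
    {S : Matrix (Fin d) (Fin d) ℝ} (hS : S.PosDef)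
    (hg : (quantileModel τ ν g m S θs).IsContamination) :
    (quantileModel τ ν g m S θs).IsRegular := by
  have hτ : 0 < 1 - τ := by linarith
  have hf := isUnimodalDensity_quantile h0 h1
  refine
    { isProbabilityMeasure := inferInstanceAs (IsProbabilityMeasure (multivariateGaussian m S))
      measurable_f := hf.measurable.comp
        ((measurable_fst.comp measurable_snd).sub measurable_linPred_prod)
      measurableSet_Ω := MeasurableSet.univ
      f_pos := fun θ _ x => hf.pos _
      lintegral_f := fun θ _ => ?_
      θs_mem := mem_univ _
      contamination := hg
      logLipschitz := fun θ hθ => ?_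
      differentiable := fun θ _ x u _ => ?_
      separation := ?_
      prior_ball := multivariateGaussian_closedBall_ge hS m θs
      sieve := ?_ }
  · have k := hf.lintegral_prod_scale ν (measurable_linPred θ) one_pos
    simp only [inv_one, one_mul, div_one] at k
    exact k
  · refine hg.exists_logLipschitz hθ (b := τ * (1 - τ)) (r := 1) (K := d) (fun x => ?_) one_pos
      (Nat.cast_nonneg d) fun θ' _ => ⟨mem_univ _, fun x => ?_⟩
    · refine mul_le_of_le_one_right (by positivity) (Real.exp_le_one_iff.2 ?_)
      exact neg_nonpos.2 (checkLoss_nonneg h0 h1 _)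
    · simp only [quantileModel]
      rw [Real.log_mul (by positivity) (Real.exp_ne_zero _),
        Real.log_mul (by positivity) (Real.exp_ne_zero _), Real.log_exp, Real.log_exp,
        add_sub_add_left_eq_sub, neg_sub_neg]
      refine (abs_checkLoss_sub_le h0 h1 _ _).trans ?_
      rw [sub_sub_sub_cancel_left, ← linPred_sub, mul_comm]
      exact abs_linPred_le _ _
  · simp only [quantileModel, linPred_add_smul, ← sub_sub]
    exact ((differentiableWithinAt_checkLoss τ _ _).neg.exp).const_mul _
  · obtain ⟨c₁, hc₁, h₁⟩ := hf.exists_separation_prod ν one_pos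
    obtain ⟨c₂, hc₂, h₂⟩ := hν.exists_min_ge hd
    refine ⟨c₁ * c₂, by positivity, fun θ _ => ?_⟩
    have k1 := h₁ (linPred θ) (linPred θs) 1 (measurable_linPred θ) (measurable_linPred θs) one_pos
    simp only [inv_one, one_mul, div_one, sub_self, abs_zero, zero_le_one, min_eq_left,
      add_zero, ← linPred_sub] at k1
    refine le_trans ?_ k1
    rw [mul_assoc]
    exact mul_le_mul_of_nonneg_left (h₂ _) hc₁.le
  · obtain ⟨A, hA, htail⟩ := gaussian_tail_le (m := m) hS
    obtain ⟨κ, hκ, hbr⟩ := hf.exists_hellinger_bracket ν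
    refine ⟨fun _ => univ, A, κ / (d + 1), hA, by positivity, fun _ _ _ => Subset.rfl,
      fun _ _ => Subset.rfl, fun θ _ => ⟨1, one_pos, mem_univ _⟩, fun _ => MeasurableSet.univ,
      htail, ?_⟩
    intro ε u hε hε1 hu hu1 θ₀ _
    obtain ⟨L, U, hL0, hLm, hUm, hLi, hUi, hh, hcell⟩ :=
      hbr u hu hu1 (linPred θ₀) 1 (measurable_linPred θ₀) one_pos
    refine ⟨L, U, hL0, hLm, hUm, hLi, hUi, hh, fun θ hθ hθθ₀ => ?_⟩
    have k1 := hcell (linPred θ) 1 (by simp only [sub_self, abs_zero]; positivity) fun w => by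
      refine (abs_linPred_sub_le_of_forall hθθ₀ w).trans ?_
      calc d * (κ / (d + 1) * u ^ 2 * ε) = (d / (d + 1)) * (κ * u ^ 2 * ε) := by ring
        _ ≤ 1 * (κ * u ^ 2 * 1) := by
            gcongr
            rw [div_le_one (by positivity)]
            linarith
        _ = _ := one_mul _
    simp only [inv_one, one_mul, div_one] at k1
    exact k1

end Quantile

/-! ### Logistic regression -/

section Logistic

lemma abs_sigmoid_sub_le (a b : ℝ) : |Real.sigmoid a - Real.sigmoid b| ≤ |a - b| := by
  have h := Convex.norm_image_sub_le_of_norm_hasDerivWithin_le (f := Real.sigmoid)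
    (f' := fun x => Real.sigmoid x * (1 - Real.sigmoid x)) (C := 1) (s := univ) (x := b) (y := a)
    (fun x _ => (Real.hasDerivAt_sigmoid x).hasDerivWithinAt) (fun x _ => ?_) convex_univ
    (mem_univ _) (mem_univ _)
  · simpa [Real.norm_eq_abs] using h
  · have h1 := Real.sigmoid_pos x
    have h2 := Real.sigmoid_lt_one x
    rw [Real.norm_of_nonneg (by nlinarith)]
    nlinarith

lemma abs_log_sigmoid_sub_le (a b : ℝ) :
    |Real.log (Real.sigmoid a) - Real.log (Real.sigmoid b)| ≤ |a - b| := by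
  have h := Convex.norm_image_sub_le_of_norm_hasDerivWithin_le
    (f := fun x => Real.log (Real.sigmoid x))
    (f' := fun x => Real.sigmoid x * (1 - Real.sigmoid x) / Real.sigmoid x)
    (C := 1) (s := univ) (x := b) (y := a)
    (fun x _ => ((Real.hasDerivAt_sigmoid x).log (Real.sigmoid_pos x).ne').hasDerivWithinAt)
    (fun x _ => ?_) convex_univ (mem_univ _) (mem_univ _)
  · simpa [Real.norm_eq_abs] using h
  · have h1 := Real.sigmoid_pos x
    have h2 := Real.sigmoid_lt_one x
    rw [mul_div_cancel_left₀ _ h1.ne', Real.norm_of_nonneg (by linarith)]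
    linarith

/-- On [-(B + 1), B + 1] the derivative σ(x)σ(-x) is at least σ(-(B + 1))². If a lies farther than 1
from b, monotonicity reduces to the point at distance 1. -/
lemma exists_abs_sigmoid_sub_ge (B : ℝ) : ∃ c > 0, ∀ a b : ℝ, |b| ≤ B →
    c * min |a - b| 1 ≤ |Real.sigmoid a - Real.sigmoid b| := by
  set c := Real.sigmoid (-(B + 1)) * Real.sigmoid (-(B + 1)) with hc
  have hs := Real.sigmoid_pos (-(B + 1))
  have hseg : ∀ x y : ℝ, -(B + 1) ≤ x → x ≤ y → y ≤ B + 1 →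
      c * (y - x) ≤ Real.sigmoid y - Real.sigmoid x := by
    intro x y hx hxy hy
    refine Convex.mul_sub_le_image_sub_of_le_deriv (convex_Icc (-(B + 1)) (B + 1))
      differentiable_sigmoid.continuous.continuousOn
      differentiable_sigmoid.differentiableOn (fun t ht => ?_) x ⟨hx, hxy.trans hy⟩ y
      ⟨hx.trans hxy, hy⟩ hxy
    rw [interior_Icc] at ht
    rw [Real.deriv_sigmoid]
    beta_reduce
    rw [← Real.sigmoid_neg]
    exact mul_le_mul (Real.sigmoid_le ht.1.le) (Real.sigmoid_le (by linarith [ht.2])) hs.le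
      (Real.sigmoid_pos _).le
  refine ⟨c, by positivity, fun a b hb => ?_⟩
  obtain ⟨hb1, hb2⟩ := abs_le.1 hb
  rcases le_total b a with h | h
  · rw [abs_of_nonneg (sub_nonneg.2 h)]
    refine le_trans ?_ (le_abs_self _)
    have h1 := min_le_left (a - b) 1
    have h2 := min_le_right (a - b) 1
    have h3 : 0 ≤ min (a - b) 1 := le_min (by linarith) zero_le_one
    have h4 := hseg b (b + min (a - b) 1) (by linarith) (by linarith) (by linarith)
    have h5 : Real.sigmoid (b + min (a - b) 1) ≤ Real.sigmoid a := Real.sigmoid_le (by linarith)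
    rw [add_sub_cancel_left] at h4
    linarith
  · rw [abs_sub_comm a b, abs_sub_comm (Real.sigmoid a), abs_of_nonneg (sub_nonneg.2 h)]
    refine le_trans ?_ (le_abs_self _)
    have h1 := min_le_left (b - a) 1
    have h2 := min_le_right (b - a) 1
    have h3 : 0 ≤ min (b - a) 1 := le_min (by linarith) zero_le_one
    have h4 := hseg (b - min (b - a) 1) b (by linarith) (by linarith) (by linarith)
    have h5 : Real.sigmoid a ≤ Real.sigmoid (b - min (b - a) 1) := Real.sigmoid_le (by linarith)
    rw [sub_sub_cancel] at h4
    linarith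

/-- The sign `2 x - 1` of a response `x ∈ {0, 1}`. -/
def responseSign : Fin 2 → ℝ := ![-1, 1]

lemma abs_responseSign (x : Fin 2) : |responseSign x| = 1 := by
  fin_cases x <;> simp [responseSign]

variable {d : ℕ} {ν : Measure (Covariate d)} {g : Fin 2 × Covariate d → ℝ}
  {m θs : EuclideanSpace ℝ (Fin d)} {S : Matrix (Fin d) (Fin d) ℝ}

/-- Writing both responses as one sigmoid of a signed predictor avoids treating them separately. -/
lemma logisticModel_f (θ : EuclideanSpace ℝ (Fin d)) (z : Fin 2 × Covariate d) :
    (logisticModel ν g m S θs).f θ z = Real.sigmoid (responseSign z.1 * linPred θ z.2) := by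
  obtain ⟨x, w⟩ := z
  fin_cases x <;> simp [logisticModel, responseSign]

lemma measurable_logisticModel_f (θ : EuclideanSpace ℝ (Fin d)) :
    Measurable ((logisticModel ν g m S θs).f θ) := by
  rw [funext (logisticModel_f θ)]
  exact differentiable_sigmoid.continuous.measurable.comp
    (((measurable_of_finite responseSign).comp measurable_fst).mul
      ((measurable_linPred θ).comp measurable_snd))

lemma integrable_logisticModel_f [IsProbabilityMeasure ν] (θ : EuclideanSpace ℝ (Fin d)) :
    Integrable ((logisticModel ν g m S θs).f θ) ((Measure.count : Measure (Fin 2)).prod ν) := by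
  refine Integrable.of_bound (measurable_logisticModel_f θ).aestronglyMeasurable 1
    (ae_of_all _ fun z => ?_)
  rw [logisticModel_f, Real.norm_of_nonneg (Real.sigmoid_nonneg _)]
  exact Real.sigmoid_le_one _

lemma abs_logisticModel_f_sub_le (θ θ' : EuclideanSpace ℝ (Fin d)) (z : Fin 2 × Covariate d) :
    |(logisticModel ν g m S θs).f θ z - (logisticModel ν g m S θs).f θ' z| ≤
      |linPred θ z.2 - linPred θ' z.2| := by
  rw [logisticModel_f, logisticModel_f]
  refine (abs_sigmoid_sub_le _ _).trans ?_
  rw [← mul_sub, abs_mul, abs_responseSign, one_mul]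

lemma lintegral_logisticModel_f [IsProbabilityMeasure ν] (θ : EuclideanSpace ℝ (Fin d)) :
    ∫⁻ z, ENNReal.ofReal ((logisticModel ν g m S θs).f θ z)
      ∂((Measure.count : Measure (Fin 2)).prod ν) = 1 := by
  rw [lintegral_prod_symm _ (measurable_logisticModel_f θ).ennreal_ofReal.aemeasurable]
  have h : ∀ w, ∫⁻ x, ENNReal.ofReal ((logisticModel ν g m S θs).f θ (x, w))
      ∂(Measure.count : Measure (Fin 2)) = 1 := by
    intro w
    rw [lintegral_count, tsum_fintype, Fin.sum_univ_two, logisticModel_f, logisticModel_f,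
      ← ENNReal.ofReal_add (Real.sigmoid_nonneg _) (Real.sigmoid_nonneg _)]
    simp [responseSign, Real.sigmoid_neg]
  simp [h]

/-- The response 1 alone separates; predictors at the truth are bounded by d‖θs‖, while those at θ
may be arbitrarily large. -/
lemma logisticModel_separation [IsProbabilityMeasure ν] (hd : 0 < d) (hν : NondegenerateDesign ν) :
    ∃ c₀ > 0, ∀ θ, c₀ * min ‖θ - θs‖ 1 ≤
      ∫ z, |(logisticModel ν g m S θs).f θ z - (logisticModel ν g m S θs).f θs z|
        ∂((Measure.count : Measure (Fin 2)).prod ν) := by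
  obtain ⟨c₁, hc₁, h₁⟩ := exists_abs_sigmoid_sub_ge (d * ‖θs‖)
  obtain ⟨c₂, hc₂, h₂⟩ := hν.exists_min_ge hd
  refine ⟨c₁ * c₂, by positivity, fun θ => ?_⟩
  have hi := ((integrable_logisticModel_f (g := g) (m := m) (S := S) (θs := θs) (ν := ν) θ).sub
    (integrable_logisticModel_f (g := g) (m := m) (S := S) (θs := θs) (ν := ν) θs)).abs
  calc c₁ * c₂ * min ‖θ - θs‖ 1 = c₁ * (c₂ * min ‖θ - θs‖ 1) := by ring
    _ ≤ c₁ * ∫ w, min |linPred (θ - θs) w| 1 ∂ν := by gcongr; exact h₂ _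
    _ = ∫ w, c₁ * min |linPred (θ - θs) w| 1 ∂ν := (integral_const_mul _ _).symm
    _ ≤ ∫ w, (∫ x, |(logisticModel ν g m S θs).f θ (x, w) -
          (logisticModel ν g m S θs).f θs (x, w)| ∂(Measure.count : Measure (Fin 2))) ∂ν := by
        refine integral_mono ((integrable_min_abs_linPred ν _).const_mul _) hi.integral_prod_right
          fun w => ?_
        have k1 := h₁ (linPred θ w) (linPred θs w) (abs_linPred_le θs w)
        beta_reduce
        rw [linPred_sub, integral_fintype Integrable.of_finite, Fin.sum_univ_two]
        simp only [logisticModel_f]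
        simp only [responseSign, Matrix.cons_val_zero, Matrix.cons_val_one, one_mul, neg_mul,
          measureReal_def, Measure.count_singleton, ENNReal.toReal_one, smul_eq_mul]
        exact k1.trans (le_add_of_nonneg_left (abs_nonneg _))
    _ = _ := (integral_prod_symm _ hi).symm

theorem logisticModel_isRegular [IsProbabilityMeasure ν] (hd : 0 < d) (hν : NondegenerateDesign ν)
    (hS : S.PosDef) (hg : (logisticModel ν g m S θs).IsContamination) :
    (logisticModel ν g m S θs).IsRegular := by
  refine
    { isProbabilityMeasure := inferInstanceAs (IsProbabilityMeasure (multivariateGaussian m S))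
      measurable_f := ?_
      measurableSet_Ω := MeasurableSet.univ
      f_pos := fun θ _ x => by rw [logisticModel_f]; exact Real.sigmoid_pos _
      lintegral_f := fun θ _ => lintegral_logisticModel_f θ
      θs_mem := mem_univ _
      contamination := hg
      logLipschitz := fun θ hθ => ?_
      differentiable := fun θ _ x u _ => ?_
      separation := ?_
      prior_ball := multivariateGaussian_closedBall_ge hS m θs
      sieve := ?_ }
  · simp only [logisticModel_f]
    exact differentiable_sigmoid.continuous.measurable.comp
      (((measurable_of_finite responseSign).comp (measurable_fst.comp measurable_snd)).mul
        measurable_linPred_prod)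
  · refine hg.exists_logLipschitz hθ (b := 1) (r := 1) (K := d) (fun x => ?_) one_pos
      (Nat.cast_nonneg d) fun θ' _ => ⟨mem_univ _, fun x => ?_⟩
    · rw [logisticModel_f]; exact Real.sigmoid_le_one _
    · rw [logisticModel_f, logisticModel_f]
      refine (abs_log_sigmoid_sub_le _ _).trans ?_
      rw [← mul_sub, abs_mul, abs_responseSign, one_mul, ← linPred_sub, mul_comm]
      exact abs_linPred_le _ _
  · simp only [logisticModel_f, linPred_add_smul]
    have h : Differentiable ℝ fun ξ : ℝ =>
      responseSign x.1 * (linPred θ x.2 + ξ * linPred u x.2) := by fun_prop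
    exact (differentiable_sigmoid.comp h).differentiableAt.differentiableWithinAt
  · obtain ⟨c₀, hc₀, h⟩ := logisticModel_separation (g := g) (m := m) (S := S) (θs := θs) hd hν
    exact ⟨c₀, hc₀, fun θ _ => h θ⟩
  · obtain ⟨A, hA, htail⟩ := gaussian_tail_le (m := m) hS
    refine ⟨fun _ => univ, A, 1 / (2 * (d + 1)), hA, by positivity, fun _ _ _ => Subset.rfl,
      fun _ _ => Subset.rfl, fun θ _ => ⟨1, one_pos, mem_univ _⟩, fun _ => MeasurableSet.univ,
      htail, ?_⟩
    intro ε u hε hε1 hu hu1 θ₀ _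
    set F := (logisticModel ν g m S θs).f θ₀ with hF
    have hFm : Measurable F := measurable_logisticModel_f θ₀
    have hFi : Integrable F ((Measure.count : Measure (Fin 2)).prod ν) :=
      integrable_logisticModel_f θ₀
    have hFpos : ∀ x, 0 < F x := fun x => by rw [hF, logisticModel_f]; exact Real.sigmoid_pos _
    -- The base measure has mass 2, so uniform brackets of width at most 2η have L¹ size at most 4η
    -- = 2u².
    set η := u ^ 2 / 2 with hη
    have hη0 : 0 < η := by positivity
    have hLm : Measurable fun x => max (F x - η) 0 := (hFm.sub_const _).max measurable_const
    have hLi : Integrable (fun x => max (F x - η) 0)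
        ((Measure.count : Measure (Fin 2)).prod ν) :=
      (hFi.sub (integrable_const _)).sup (integrable_const _)
    have hUi : Integrable (fun x => F x + η) ((Measure.count : Measure (Fin 2)).prod ν) :=
      hFi.add (integrable_const _)
    refine ⟨fun x => max (F x - η) 0, fun x => F x + η, fun x => le_max_right _ _, hLm,
      hFm.add_const _, hLi, hUi, ?_, fun θ _ hθ x => ?_⟩
    · refine hellinger_le_of_integral_sub_le hu.le hLi hUi (fun x => le_max_right _ _)
        (fun x => max_le (by linarith) (by linarith [hFpos x])) ?_
      change ∫ x, (F x + η) ∂((Measure.count : Measure (Fin 2)).prod ν) -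
        ∫ x, max (F x - η) 0 ∂((Measure.count : Measure (Fin 2)).prod ν) ≤ _
      rw [← integral_sub hUi hLi]
      calc ∫ x, (F x + η - max (F x - η) 0) ∂((Measure.count : Measure (Fin 2)).prod ν)
          ≤ ∫ _x, 2 * η ∂((Measure.count : Measure (Fin 2)).prod ν) := by
            refine integral_mono (hUi.sub hLi) (integrable_const _) fun x => ?_
            have := le_max_left (F x - η) 0
            beta_reduce
            linarith
        _ = 2 * u ^ 2 := by
            rw [integral_const, measureReal_def, ← univ_prod_univ, Measure.prod_prod,
              measure_univ (μ := ν), mul_one, Measure.count_univ]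
            simp only [Fintype.card_fin, ENat.card_eq_coe_fintype_card, hη,
              smul_eq_mul]
            norm_num
            ring
    · have h1 : |(logisticModel ν g m S θs).f θ x - F x| ≤ η := by
        refine (abs_logisticModel_f_sub_le θ θ₀ x).trans
          ((abs_linPred_sub_le_of_forall hθ x.2).trans ?_)
        calc d * (1 / (2 * (d + 1)) * u ^ 2 * ε) = (d / (d + 1)) * (u ^ 2 / 2 * ε) := by
              field_simp
          _ ≤ 1 * (u ^ 2 / 2 * 1) := by
              gcongr
              rw [div_le_one (by positivity)]
              linarith
          _ = _ := by rw [hη]; ring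
      obtain ⟨h2, h3⟩ := abs_le.1 h1
      refine ⟨max_le (by linarith) ?_, by linarith⟩
      rw [logisticModel_f]
      exact Real.sigmoid_nonneg _

end Logistic

/-! ### The four regression models -/

theorem mainTheorem10 (d : ℕ) (hd : 0 < d) (c : ℝ) (hc : 0 < c) :
    ∃ cbar : ℝ, 0 < cbar ∧ ∀ c₁ c₂ q : ℝ, 0 < c₁ → c₁ ≤ cbar → 0 < c₂ → 4 < q →
      ∀ (ν : Measure (Covariate d)) [IsProbabilityMeasure ν], NondegenerateDesign ν →
      -- Gaussian linear regression
      (∀ (g : ℝ × Covariate d → ℝ) (m ϑs : EuclideanSpace ℝ (Fin (d + 1)))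
        (S : Matrix (Fin (d + 1)) (Fin (d + 1)) ℝ), S.PosDef → 0 < ϑs (Fin.last d) →
        (linearModel ν g m S ϑs).IsContamination →
        (linearModel ν g m S ϑs).SatisfiesRates q c c₁ c₂) ∧
      -- logistic regression
      (∀ (g : Fin 2 × Covariate d → ℝ) (m θs : EuclideanSpace ℝ (Fin d))
        (S : Matrix (Fin d) (Fin d) ℝ), S.PosDef →
        (logisticModel ν g m S θs).IsContamination →
        (logisticModel ν g m S θs).SatisfiesRates q c c₁ c₂) ∧
      -- Cauchy regression
      (∀ (g : ℝ × Covariate d → ℝ) (m ϑs : EuclideanSpace ℝ (Fin (d + 1)))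
        (S : Matrix (Fin (d + 1)) (Fin (d + 1)) ℝ), S.PosDef → 0 < ϑs (Fin.last d) →
        (cauchyModel ν g m S ϑs).IsContamination →
        (cauchyModel ν g m S ϑs).SatisfiesRates q c c₁ c₂) ∧
      -- quantile regression
      (∀ (τ : ℝ) (g : ℝ × Covariate d → ℝ) (m θs : EuclideanSpace ℝ (Fin d))
        (S : Matrix (Fin d) (Fin d) ℝ), 0 < τ → τ < 1 → S.PosDef →
        (quantileModel τ ν g m S θs).IsContamination →
        (quantileModel τ ν g m S θs).SatisfiesRates q c c₁ c₂) := by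

  have hd0 : (0 : ℝ) < d := by exact_mod_cast hd
  -- The constant for d + 1 parameters, which also covers the models with d.
  refine ⟨c ^ 2 / (3 * (d + 1)), by positivity, fun c₁ c₂ q hc₁ hcb hc₂ hq ν _ hν => ?_⟩
  have h1 : 3 * ((d : ℝ) + 1) * c₁ ≤ c ^ 2 := by
    rw [le_div_iff₀ (by positivity)] at hcb
    linarith
  have h2 : 3 * (Fintype.card (Fin d) : ℝ) * c₁ ≤ c ^ 2 := by
    rw [Fintype.card_fin]
    nlinarith
  have h3 : 3 * (Fintype.card (Fin (d + 1)) : ℝ) * c₁ ≤ c ^ 2 := by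
    rw [Fintype.card_fin]
    push_cast
    exact h1
  refine ⟨fun g m ϑs S hS hϑs hg => ?_, fun g m θs S hS hg => ?_,
    fun g m ϑs S hS hϑs hg => ?_, fun τ g m θs S hτ0 hτ1 hS hg => ?_⟩
  · exact (linearModel_isRegular hd hν hS hϑs hg).satisfiesRates hq hc hc₁ hc₂ h3
  · exact (logisticModel_isRegular hd hν hS hg).satisfiesRates hq hc hc₁ hc₂ h2
  · exact (cauchyModel_isRegular hd hν hS hϑs hg).satisfiesRates hq hc hc₁ hc₂ h3
  · exact (quantileModel_isRegular hτ0 hτ1 hd hν hS hg).satisfiesRates hq hc hc₁ hc₂ h2
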